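/- **Setting.** Let $A=(a_{ij})_{i,j\in I}$ be a generalized Cartan matrix ($I$ finite) with a (minimal) realization over $\mathbb C$: simple roots $\alpha_i\in\mathfrak h^*$ and simple coroots $\alpha_i^\vee\in\mathfrak h$ with $\langle\alpha_j,\alpha_i^\vee\rangle=a_{ij}$. Let $\mathfrak g$ be any Kac--Moody algebra for it, i.e. a quotient of the Lie algebra $\widetilde{\mathfrak g}(A)$ generated by $\mathfrak h,e_i,f_i$ ($i\in I$) with the Chevalley--Serre relations, by an ideal meeting $\mathfrak h$ trivially. Let $\mathfrak n^-$ be the subalgebra generated by the $f_i$, let $s_i$ be the simple reflections of $\mathfrak h^*$, and let $w\bullet\mu=w(\mu+\rho)-\rho$, where $\langle\rho,\alpha_i^\vee\rangle=1$ for all $i$. Fix $\lambda\in\mathfrak h^*$ and put $J_\lambda=\{i\in I:\langle\lambda,\alpha_i^\vee\rangle\in\mathbb Z_{\ge0}\}$. A set $H\subset I$ is independent if the Dynkin diagram has no edge between nodes of $H$; for independent $H\subset J_\lambda$ put $$\mathbf f_H=\prod_{h\in H}f_h^{\langle\lambda,\alpha_h^\vee\rangle+1},\qquad \mathbf s_H=\prod_{h\in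 H}s_h,\qquad \lambda_H=\lambda-\sum_{h\in H}(\langle\lambda,\alpha_h^\vee\rangle+1)\alpha_h .$$ For a set $\mathcal H$ of independent subsets of $J_\lambda$, let $\mathbb M(\lambda,\mathcal H)=M(\lambda)\big/\sum_{H\in\mathcal H}U\mathfrak g\,\mathbf f_H m_\lambda$, where $M(\mu)$ denotes the Verma module with highest weight vector $m_\mu$. Let $H_1,\dots,H_k$ be the distinct minimal elements of $\mathcal H$ under inclusion, and for $J\subset\{1,\dots,k\}$ put $H_J=\bigcup_{j\in J}H_j$ and $\lambda(J)=\lambda_{H_J}$. **Theorem.** Assume that (i) $H_1,\dots,H_k$ are pairwise orthogonal ($a_{hh'}=0$ for $h\in H_i$, $h'\in H_j$, $i\ne j$; in particular they are disjoint), or (ii) the Dynkin diagram has no edges between nodes of $J_\lambda$. (a) Put $M_t=\bigoplus_{|J|=t}M(\lambda(J))$; so $M_t=0$ for $t>k$. There are $\mathfrak g$-module maps $d_t:M_t\to M_{t-1}$ ($t\ge1$) and $d_0:M_0=M(\lambda)\to\mathbb M(\lambda,\mathcal H)$, the latter the quotient map, with $$d_t(m_{\lambda(J)})=\sum_{j=1}^t(-1)^{j-1}\,\mathbf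 f_{H_{i_j}\setminus H_{J\setminus\{i_j\}}}\;m_{\lambda(J\setminus\{i_j\})}\qquad(J=\{i_1<\dots<i_t\}),$$ and $$0\to M_k\xrightarrow{d_k}M_{k-1}\to\cdots\xrightarrow{d_1}M_0\xrightarrow{d_0}\mathbb M(\lambda,\mathcal H)\to0$$ is exact. Each $M_t$ is $U\mathfrak n^-$-free on the vectors $m_{\lambda(J)}$, $|J|=t$. (b) $\mathbb M(\lambda,\mathcal H)$ and all Verma modules are sums of finite-dimensional weight spaces, and $$\operatorname{ch}\mathbb M(\lambda,\mathcal H)=\sum_{J\subset\{1,\dots,k\}}(-1)^{|J|}\operatorname{ch}M(\lambda(J)).$$ (c) $\mathbf s_{H_J}\bullet\lambda=\lambda(J)$ for all $J$. Let $D=\prod_{\alpha\in\Delta^+}(1-e^{-\alpha})^{\dim\mathfrak g_{-\alpha}}$, where $\Delta^+$ is the set of nonzero $\alpha\in\sum_i\mathbb Z_{\ge0}\alpha_i$ with $\mathfrak g_{-\alpha}\ne0$. These root spaces are finite-dimensional, and the product converges to a unit of $\mathbb Z[[e^{-\alpha_i}:i\in I]]$. If $\mathfrak g$ has a Chevalley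 involution ($e_i\mapsto-f_i$, $f_i\mapsto-e_i$, $-1$ on $\mathfrak h$), then $\dim\mathfrak g_{-\alpha}=\dim\mathfrak g_\alpha$ for all such $\alpha$. (d) In case (i), if moreover $\emptyset\notin\mathcal H$ (i.e. $\mathbb M(\lambda,\mathcal H)\neq0$), let $W_{\mathcal H}=\langle\mathbf s_{H_1},\dots,\mathbf s_{H_k}\rangle$, a subgroup of the Weyl group, with $\ell_{\mathcal H}$ the word length in these generators. Then $W_{\mathcal H}\simeq(\mathbb Z/2\mathbb Z)^k$, the element $\mathbf s_{H_J}$ corresponding to the indicator vector of $J$, and $\ell_{\mathcal H}(\mathbf s_{H_J})=|J|$. In case (ii), let $W_{\mathcal H}$ be the set of pairs $w=(w_J,J)$, $J\subset\{1,\dots,k\}$, $w_J=\mathbf s_{H_J}$, with product $(w_J,J)(w_K,K)=(w_{J\cup K},J\cup K)$, length $\ell_{\mathcal H}((w_J,J))=|J|$ and $(w_J,J)\bullet\lambda=w_J\bullet\lambda$; this semigroup acts on $\{\lambda(K):K\subset\{1,\dots,k\}\}$ by $(w_J,J)\cdot\lambda(K)=\lambda(J\cup K)$. In both cases $$M_t\cong\bigoplus_{w\in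 W_{\mathcal H},\ \ell_{\mathcal H}(w)=t}M(w\bullet\lambda)\quad\text{for all }t,\qquad \operatorname{ch}\mathbb M(\lambda,\mathcal H)=\sum_{w\in W_{\mathcal H}}\frac{(-1)^{\ell_{\mathcal H}(w)}e^{w\bullet\lambda}}{\prod_{\alpha\in\Delta^+}(1-e^{-\alpha})^{\dim\mathfrak g_{-\alpha}}}.$$ -/

import Mathlib

open scoped DirectSum MvPowerSeries.WithPiTopology

noncomputable section

namespace KacMoody

universe u v w

attribute [local instance 100] LieRing.ofAssociativeRing

variable {I : Type u} [Fintype I] [DecidableEq I]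

/-! ### Generalized Cartan matrices and realizations -/

/-- `A` is a generalized Cartan matrix. -/
structure IsGCM (A : Matrix I I ℤ) : Prop where
  diag : ∀ i, A i i = 2
  nonpos : ∀ i j, i ≠ j → A i j ≤ 0
  zero_symm : ∀ i j, A i j = 0 → A j i = 0

/-- A (minimal) realization `(𝔥, Π, Π^∨)` over `ℂ` of a generalized Cartan matrix `A`:
linearly independent simple roots `root i ∈ 𝔥^*` and simple coroots `coroot i ∈ 𝔥` with
`⟨root j, coroot i⟩ = A i j` and `dim 𝔥 = 2 |I| - rank A`. -/
structure Realization (A : Matrix I I ℤ) (𝔥 : Type v) [AddCommGroup 𝔥] [Module ℂ 𝔥]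
    [FiniteDimensional ℂ 𝔥] where
  isGCM : IsGCM A
  root : I → Module.Dual ℂ 𝔥
  coroot : I → 𝔥
  root_linearIndependent : LinearIndependent ℂ root
  coroot_linearIndependent : LinearIndependent ℂ coroot
  pairing : ∀ i j, root j (coroot i) = (A i j : ℂ)
  finrank_add_rank : Module.finrank ℂ 𝔥 + (A.map (Int.cast : ℤ → ℂ)).rank = 2 * Fintype.card I

/-- A set of nodes is independent if the Dynkin diagram has no edge between any two of them. -/
def IsIndep (A : Matrix I I ℤ) (S : Set I) : Prop := S.Pairwise fun i j => A i j = 0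

/-- `Indep(J)`: the independent subsets of `J`. -/
def Indep (A : Matrix I I ℤ) (J : Set I) : Set (Finset I) :=
  {H | IsIndep A (H : Set I) ∧ (H : Set I) ⊆ J}

/-- Two sets of nodes are orthogonal: `⟨α_j, α_i^∨⟩ = 0` for `i` in the first and `j` in the
second. (As `A i i = 2`, orthogonal sets are disjoint.) -/
def Orthogonal (A : Matrix I I ℤ) (H H' : Finset I) : Prop := ∀ i ∈ H, ∀ j ∈ H', A i j = 0

/-- The union `⋃_{j ∈ J} H j` for `J ⊆ {1, …, k}`. -/
def unionH {k : ℕ} (H : Fin k → Finset I) (J : Finset (Fin k)) : Finset I := J.biUnion H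

variable {A : Matrix I I ℤ} {𝔥 : Type v} [AddCommGroup 𝔥] [Module ℂ 𝔥] [FiniteDimensional ℂ 𝔥]

/-! ### The Lie algebra with the Chevalley–Serre presentation -/

/-- Generators of the Kac–Moody algebra: `e_i`, `f_i` for `i ∈ I`, and the elements of `𝔥`. -/
inductive Gen (I : Type u) (𝔥 : Type v) : Type (max u v)
  | E : I → Gen I 𝔥
  | F : I → Gen I 𝔥
  | H : 𝔥 → Gen I 𝔥

namespace Realization

variable (R : Realization A 𝔥)

/-- The free Lie algebra on the generators. -/
abbrev Free (_R : Realization A 𝔥) : Type (max u v) := FreeLieAlgebra ℂ (Gen I 𝔥)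

/-- The free generator `e_i`. -/
def freeE (i : I) : R.Free := FreeLieAlgebra.of ℂ (Gen.E i)
/-- The free generator `f_i`. -/
def freeF (i : I) : R.Free := FreeLieAlgebra.of ℂ (Gen.F i)
/-- The free generator attached to `x ∈ 𝔥`. -/
def freeH (x : 𝔥) : R.Free := FreeLieAlgebra.of ℂ (Gen.H x)

/-- The Chevalley–Serre relations (as elements which are to become zero). -/
inductive Rel : R.Free → Prop
  | linear (c : ℂ) (x y : 𝔥) : Rel (R.freeH (c • x + y) - (c • R.freeH x + R.freeH y))
  | hh (x y : 𝔥) : Rel ⁅R.freeH x, R.freeH y⁆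
  | he (x : 𝔥) (i : I) : Rel (⁅R.freeH x, R.freeE i⁆ - R.root i x • R.freeE i)
  | hf (x : 𝔥) (i : I) : Rel (⁅R.freeH x, R.freeF i⁆ + R.root i x • R.freeF i)
  | ef (i : I) : Rel (⁅R.freeE i, R.freeF i⁆ - R.freeH (R.coroot i))
  | ef_ne (i j : I) (h : i ≠ j) : Rel ⁅R.freeE i, R.freeF j⁆
  | serreE (i j : I) (h : i ≠ j) :
      Rel ((LieAlgebra.ad ℂ R.Free (R.freeE i) ^ (1 - A i j).toNat) (R.freeE j))
  | serreF (i j : I) (h : i ≠ j) :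
      Rel ((LieAlgebra.ad ℂ R.Free (R.freeF i) ^ (1 - A i j).toNat) (R.freeF j))

/-- The ideal generated by the Chevalley–Serre relations. -/
def relIdeal : LieIdeal ℂ R.Free := LieSubmodule.lieSpan ℂ R.Free {x | R.Rel x}

/-- The Lie algebra `𝔤̃(A)` generated by `𝔥, e_i, f_i` subject to the Chevalley–Serre
relations. -/
abbrev Tilde : Type (max u v) := R.Free ⧸ R.relIdeal

/-- The image in `𝔤̃(A)` of an element of the free Lie algebra. -/
def toTilde : R.Free →ₗ⁅ℂ⁆ R.Tilde :=
  { (LieSubmodule.Quotient.mk' R.relIdeal : R.Free →ₗ[ℂ] R.Tilde) with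
    map_lie' := fun {_ _} => rfl }

/-! ### Weyl group and weights -/

/-- The simple reflection `s_i` of `𝔥^*`: `s_i μ = μ - ⟨μ, α_i^∨⟩ α_i`. -/
def simpleReflection (i : I) : Module.Dual ℂ 𝔥 ≃ₗ[ℂ] Module.Dual ℂ 𝔥 :=
  Module.reflection (x := R.root i) (f := Module.Dual.eval ℂ 𝔥 (R.coroot i))
    (by simp [R.pairing, R.isGCM.diag])

/-- The Weyl group. -/
def weylGroup : Subgroup (Module.Dual ℂ 𝔥 ≃ₗ[ℂ] Module.Dual ℂ 𝔥) :=
  Subgroup.closure (Set.range R.simpleReflection)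

/-- The dot action `w • μ = w(μ + ρ) - ρ`, with respect to `ρ`. -/
def dot (_R : Realization A 𝔥) (ρ : Module.Dual ℂ 𝔥)
    (w : Module.Dual ℂ 𝔥 ≃ₗ[ℂ] Module.Dual ℂ 𝔥) (μ : Module.Dual ℂ 𝔥) : Module.Dual ℂ 𝔥 :=
  w (μ + ρ) - ρ

theorem simpleReflection_commute {i j : I} (hij : A i j = 0) :
    Commute (R.simpleReflection i) (R.simpleReflection j) := by
  have hji := R.isGCM.zero_symm i j hij
  refine LinearEquiv.ext fun μ => ?_
  simp only [simpleReflection, LinearEquiv.mul_apply, Module.reflection_apply, map_sub, map_smul,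
    Module.Dual.eval_apply, R.pairing, hij, hji]
  simp only [Int.cast_zero, zero_smul, sub_zero]
  abel

open Classical in
/-- The product `𝐬_H = ∏_{h ∈ H} s_h` of the (commuting) simple reflections in an independent
set `H`; for dependent `H` it is set to `1`, which is never used. -/
def sH (H : Finset I) : Module.Dual ℂ 𝔥 ≃ₗ[ℂ] Module.Dual ℂ 𝔥 :=
  if hH : IsIndep A (H : Set I) then
    H.noncommProd R.simpleReflection
      (fun _ hi _ hj hij => R.simpleReflection_commute (hH hi hj hij))
  else 1

/-- `J_λ`: the nodes `i` with `⟨λ, α_i^∨⟩ ∈ ℤ_{≥ 0}`. -/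
def integrability (lam : Module.Dual ℂ 𝔥) : Set I := {i | ∃ n : ℕ, lam (R.coroot i) = (n : ℂ)}

/-- The natural number `⟨λ, α_i^∨⟩ + 1`, for `i ∈ J_λ`. -/
def expo (lam : Module.Dual ℂ 𝔥) (i : I) : ℕ := ⌊(lam (R.coroot i)).re⌋₊ + 1

/-- `λ_H = λ - ∑_{h ∈ H} (⟨λ, α_h^∨⟩ + 1) α_h`. -/
def lamH (lam : Module.Dual ℂ 𝔥) (H : Finset I) : Module.Dual ℂ 𝔥 :=
  lam - ∑ h ∈ H, (lam (R.coroot h) + 1) • R.root h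

/-- The element `∑_i β_i α_i` of the positive cone of the root lattice. -/
def rootSum (β : I →₀ ℕ) : Module.Dual ℂ 𝔥 := ∑ i, (β i : ℂ) • R.root i

open Classical in
/-- The formal function `e^ν P` on `𝔥^*`, where `P` is a formal power series in the variables
`e^{-α_i}`: its value at `ν - ∑_i β_i α_i` is the coefficient of `P` at `β`. (The simple roots
are linearly independent, so the sum has at most one nonzero term.) -/
def expMul (ν : Module.Dual ℂ 𝔥) (P : MvPowerSeries I ℤ) : Module.Dual ℂ 𝔥 → ℤ := fun μ =>
  ∑ᶠ β : I →₀ ℕ, if μ = ν - R.rootSum β then MvPowerSeries.coeff β P else 0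

end Realization

/-! ### Kac–Moody algebras -/

/-- `𝔤` is a Kac–Moody algebra for the realization `R`: a quotient of `𝔤̃(A)` by an ideal which
intersects `𝔥` trivially. In other words `𝔤̃(A) ↠ 𝔤 ↠ 𝔤̄(A)`, with `𝔤̄(A)` the quotient of
`𝔤̃(A)` by the largest such ideal. -/
structure KMAlgebra (R : Realization A 𝔥) (𝔤 : Type w) [LieRing 𝔤] [LieAlgebra ℂ 𝔤] where
  proj : R.Tilde →ₗ⁅ℂ⁆ 𝔤
  proj_surjective : Function.Surjective proj
  cartan_trivial : ∀ x : 𝔥, proj (R.toTilde (R.freeH x)) = 0 → x = 0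

variable {R : Realization A 𝔥} {𝔤 : Type w} [LieRing 𝔤] [LieAlgebra ℂ 𝔤]

namespace KMAlgebra

variable (K : KMAlgebra R 𝔤)

/-- The Chevalley generator `e_i`. -/
def e (i : I) : 𝔤 := K.proj (R.toTilde (R.freeE i))
/-- The Chevalley generator `f_i`. -/
def f (i : I) : 𝔤 := K.proj (R.toTilde (R.freeF i))
/-- The element `x` of the Cartan subalgebra `𝔥`, inside `𝔤`. -/
def h (x : 𝔥) : 𝔤 := K.proj (R.toTilde (R.freeH x))

/-- The weight space of `𝔤` under the adjoint action of `𝔥`. -/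
def rootSpace (γ : Module.Dual ℂ 𝔥) : Submodule ℂ 𝔤 where
  carrier := {x | ∀ y : 𝔥, ⁅K.h y, x⁆ = γ y • x}
  add_mem' := fun {a b} ha hb y => by
    rw [lie_add, ha y, hb y, smul_add]
  zero_mem' := fun y => by simp
  smul_mem' := fun c x hx y => by
    rw [lie_smul, hx y, smul_comm]

/-- `dim 𝔤_{-α}` for `α = ∑_i β_i α_i`. -/
def mult (β : I →₀ ℕ) : ℕ := Module.finrank ℂ (K.rootSpace (-R.rootSum β))

/-- The set `Δ^+` of `α = ∑_i β_i α_i ≠ 0` for which `-α` is a root of `𝔤`, written in the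
coordinates `β`. -/
def posRoots : Set (I →₀ ℕ) := {β | β ≠ 0 ∧ K.rootSpace (-R.rootSum β) ≠ ⊥}

/-- The factor `(1 - e^{-α})^{dim 𝔤_{-α}}`, a polynomial in the variables `e^{-α_i}`. -/
def factor (β : K.posRoots) : MvPowerSeries I ℤ :=
  (1 - MvPowerSeries.monomial (β : I →₀ ℕ) 1) ^ K.mult β

/-- The denominator `∏_{α ∈ Δ^+} (1 - e^{-α})^{dim 𝔤_{-α}}`. -/
def denominator : MvPowerSeries I ℤ := ∏' β : K.posRoots, K.factor β

/-- `𝔤` has a Chevalley involution: an endomorphism with `e_i ↦ -f_i`, `f_i ↦ -e_i`,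
`x ↦ -x` on `𝔥`. -/
def HasChevalleyInvolution : Prop :=
  ∃ ω : 𝔤 →ₗ⁅ℂ⁆ 𝔤, (∀ i, ω (K.e i) = -K.f i) ∧ (∀ i, ω (K.f i) = -K.e i) ∧
    ∀ x, ω (K.h x) = -K.h x

/-- The subalgebra `𝔫^-`, generated by the `f_i`. -/
def nMinus : LieSubalgebra ℂ 𝔤 := LieSubalgebra.lieSpan ℂ 𝔤 (Set.range K.f)

/-! ### Modules -/

/-- The universal enveloping algebra of `𝔤`. -/
abbrev U (_K : KMAlgebra R 𝔤) : Type w := UniversalEnvelopingAlgebra ℂ 𝔤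

/-- The universal enveloping algebra of `𝔫^-`. -/
abbrev UMinus : Type w := UniversalEnvelopingAlgebra ℂ K.nMinus

/-- The canonical map `𝔤 → U𝔤`. -/
def ι : 𝔤 →ₗ⁅ℂ⁆ K.U := UniversalEnvelopingAlgebra.ι ℂ

/-- The canonical map `U𝔫^- → U𝔤`. -/
def minusMap : K.UMinus →ₐ[ℂ] K.U :=
  UniversalEnvelopingAlgebra.lift ℂ (K.ι.comp K.nMinus.incl)

/-- The left ideal of `U𝔤` generated by the `e_i` and by `x - μ(x)` for `x ∈ 𝔥`. -/
def vermaIdeal (μ : Module.Dual ℂ 𝔥) : Submodule K.U K.U :=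
  Submodule.span K.U
    (Set.range (fun i => K.ι (K.e i)) ∪
      Set.range (fun x : 𝔥 => K.ι (K.h x) - algebraMap ℂ K.U (μ x)))

/-- The Verma module `M(μ)`, as a module over `U𝔤`. -/
abbrev Verma (μ : Module.Dual ℂ 𝔥) : Type w := K.U ⧸ K.vermaIdeal μ

/-- The highest weight vector `m_μ` of `M(μ)`. -/
def vermaVec (μ : Module.Dual ℂ 𝔥) : K.Verma μ := (K.vermaIdeal μ).mkQ 1

theorem f_commute {i j : I} (hne : i ≠ j) (hij : A i j = 0) :
    Commute (K.ι (K.f i)) (K.ι (K.f j)) := by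
  have h0 : R.toTilde ⁅R.freeF i, R.freeF j⁆ = 0 := by
    have hmem : ⁅R.freeF i, R.freeF j⁆ ∈ R.relIdeal := by
      apply LieSubmodule.subset_lieSpan
      have := Realization.Rel.serreF (R := R) i j hne
      simpa [hij] using this
    exact (LieSubmodule.Quotient.mk_eq_zero (N := R.relIdeal)).mpr hmem
  have h1 : ⁅K.f i, K.f j⁆ = 0 := by
    rw [f, f, ← LieHom.map_lie, ← LieHom.map_lie, h0, map_zero]
  have h2 : ⁅K.ι (K.f i), K.ι (K.f j)⁆ = 0 := by
    rw [← LieHom.map_lie, h1, map_zero]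
  rw [LieRing.of_associative_ring_bracket, sub_eq_zero] at h2
  exact h2

open Classical in
/-- The operator product `𝐟_H = ∏_{h ∈ H} f_h^{⟨λ, α_h^∨⟩ + 1}` in `U𝔤`, for an independent set
`H ⊆ J_λ` (the factors commute); for dependent `H` it is set to `1`, which is never used. -/
def fH (lam : Module.Dual ℂ 𝔥) (H : Finset I) : K.U :=
  if hH : IsIndep A (H : Set I) then
    H.noncommProd (fun i => K.ι (K.f i) ^ R.expo lam i)
      (fun _ hi _ hj hij => (K.f_commute hij (hH hi hj hij)).pow_pow _ _)
  else 1

/-- The submodule of `M(λ)` generated by the vectors `𝐟_H m_λ`, `H ∈ 𝓗`. -/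
def holeSubmodule (lam : Module.Dual ℂ 𝔥) (𝓗 : Set (Finset I)) :
    Submodule K.U (K.Verma lam) :=
  Submodule.span K.U ((fun H => K.fH lam H • K.vermaVec lam) '' 𝓗)

/-- The higher order Verma module `𝕄(λ, 𝓗)`. -/
abbrev HigherVerma (lam : Module.Dual ℂ 𝔥) (𝓗 : Set (Finset I)) : Type w :=
  K.Verma lam ⧸ K.holeSubmodule lam 𝓗

section Character

variable (V : Type*) [AddCommGroup V] [Module ℂ V] [Module K.U V] [IsScalarTower ℂ K.U V]

/-- The `μ`-weight space of a `𝔤`-module. -/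
def weightSpace (μ : Module.Dual ℂ 𝔥) : Submodule ℂ V where
  carrier := {v | ∀ x : 𝔥, K.ι (K.h x) • v = μ x • v}
  add_mem' := fun {a b} ha hb x => by
    rw [smul_add, ha x, hb x, smul_add]
  zero_mem' := fun x => by simp
  smul_mem' := fun c v hv x => by
    have : K.ι (K.h x) • c • v = c • K.ι (K.h x) • v := by
      rw [← algebraMap_smul K.U c v, ← mul_smul, ← Algebra.commutes, mul_smul, algebraMap_smul]
    rw [this, hv x, smul_comm]

/-- `V` is the sum of its weight spaces, and these are finite-dimensional, so that `V` has a
character. -/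
def HasCharacter : Prop :=
  (⨆ μ, K.weightSpace V μ) = ⊤ ∧ ∀ μ, FiniteDimensional ℂ (K.weightSpace V μ)

/-- The character `∑_μ dim(V_μ) e^μ` of `V`, as a function on `𝔥^*`. -/
def ch : Module.Dual ℂ 𝔥 → ℤ := fun μ => (Module.finrank ℂ (K.weightSpace V μ) : ℤ)

end Character

/-! ### The terms of the resolution -/

section Resolution

variable (lam : Module.Dual ℂ 𝔥) {k : ℕ} (H : Fin k → Finset I)

/-- The `t`-th term `⨁_{|J| = t} M(λ(J))`, over subsets `J` of `{1, …, k}`, where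
`λ(J) = λ_{⋃_{j ∈ J} H_j}`. -/
abbrev BGG (t : ℕ) : Type w :=
  ⨁ J : {J : Finset (Fin k) // J.card = t}, K.Verma (R.lamH lam (unionH H J))

/-- The highest weight vector `m_{λ(J)}` of the summand `M(λ(J))`. -/
def bggVec (t : ℕ) (J : {J : Finset (Fin k) // J.card = t}) : K.BGG lam H t :=
  DirectSum.lof K.U {J : Finset (Fin k) // J.card = t}
    (fun J => K.Verma (R.lamH lam (unionH H J))) J (K.vermaVec _)

/-- The value of the differential at `m_{λ(J)}`, for `J = {i_1 < ⋯ < i_{t+1}}`, namely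
`∑_j (-1)^{j-1} 𝐟_{H_{i_j} ∖ ⋃_{i ∈ J ∖ i_j} H_i} m_{λ(J ∖ i_j)}`. -/
def bggDiff (t : ℕ) (J : {J : Finset (Fin k) // J.card = t + 1}) : K.BGG lam H t :=
  ∑ j : {j // j ∈ J.1},
    ((-1 : ℤ) ^ (J.1.filter (fun i => i < j.1)).card) •
      (K.fH lam (H j.1 \ unionH H (J.1.erase j.1)) •
        K.bggVec lam H t ⟨J.1.erase j.1, by
          rw [Finset.card_erase_of_mem j.2, J.2, Nat.add_sub_cancel]⟩)

end Resolution

end KMAlgebra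

/-! ### Parabolic Weyl groups and semigroups -/

/-- The length of `w` with respect to a set `S` of generators. -/
def wordLength {G : Type*} [Group G] (S : Set G) (w : G) : ℕ :=
  sInf {n | ∃ l : List G, l.length = n ∧ (∀ x ∈ l, x ∈ S) ∧ l.prod = w}

/-- The parabolic Weyl group `⟨𝐬_{H_1}, …, 𝐬_{H_k}⟩`. -/
def parabolicWeylGroup (R : Realization A 𝔥) {k : ℕ} (H : Fin k → Finset I) :
    Subgroup (Module.Dual ℂ 𝔥 ≃ₗ[ℂ] Module.Dual ℂ 𝔥) :=
  Subgroup.closure (Set.range fun j => R.sH (H j))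

/-- The parabolic Weyl semigroup: the pairs `(w_J, J)` with `J ⊆ {1, …, k}` and
`w_J = 𝐬_{⋃_{j ∈ J} H_j}`. -/
def ParabolicWeylSemigroup (R : Realization A 𝔥) {k : ℕ} (H : Fin k → Finset I) : Type v :=
  {p : (Module.Dual ℂ 𝔥 ≃ₗ[ℂ] Module.Dual ℂ 𝔥) × Finset (Fin k) //
    p.1 = R.sH (unionH H p.2)}

namespace ParabolicWeylSemigroup

variable {k : ℕ} {H : Fin k → Finset I}

/-- The element `(w_J, J)`. -/
def mk (R : Realization A 𝔥) (H : Fin k → Finset I) (J : Finset (Fin k)) :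
    ParabolicWeylSemigroup R H := ⟨(R.sH (unionH H J), J), rfl⟩

/-- The product `(w_J, J) (w_K, K) = (w_{J ∪ K}, J ∪ K)`. -/
instance : Mul (ParabolicWeylSemigroup R H) := ⟨fun p q => mk R H (p.1.2 ∪ q.1.2)⟩

instance : Semigroup (ParabolicWeylSemigroup R H) where
  mul_assoc p q r := by
    change mk R H ((p.1.2 ∪ q.1.2) ∪ r.1.2) = mk R H (p.1.2 ∪ (q.1.2 ∪ r.1.2))
    rw [Finset.union_assoc]

/-- The semigroup consists of one element for each subset of `{1, …, k}`. -/
def equiv (R : Realization A 𝔥) (H : Fin k → Finset I) :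
    Finset (Fin k) ≃ ParabolicWeylSemigroup R H where
  toFun := mk R H
  invFun p := p.1.2
  left_inv _ := rfl
  right_inv p := Subtype.ext (Prod.ext p.2.symm rfl)

instance : Fintype (ParabolicWeylSemigroup R H) := Fintype.ofEquiv _ (equiv R H)

/-- The Weyl group element `w_J` of `(w_J, J)`. -/
def toWeyl (p : ParabolicWeylSemigroup R H) : Module.Dual ℂ 𝔥 ≃ₗ[ℂ] Module.Dual ℂ 𝔥 := p.1.1

/-- The length `|J|` of `(w_J, J)`. -/
def length (p : ParabolicWeylSemigroup R H) : ℕ := p.1.2.card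

end ParabolicWeylSemigroup

end KacMoody

end

/-!
# Resolutions of higher order Verma modules

In both settings the minimal elements `H j` of `𝓗` lie in one independent set `X ⊆ J_λ`
(`exists_independent_superset`), so that the `f_h`, `h ∈ X`, commute. For the resolution
and the character nothing else is needed about the sets `H j`, and the argument is one of monomial
combinatorics.

Triangular decomposition `𝔤 = 𝔫⁻ ⊕ 𝔟` and the Poincaré–Birkhoff–Witt theorem (`PBW.basis`, proved
through the action of a Lie algebra on its symmetric algebra) show that `M(μ)` is free over `U𝔫⁻`
on `m_μ`. Choose an ordered basis of `𝔫⁻` of iterated brackets of the `f_i` in which the `f_h`,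
`h ∈ X`, come last (`KMAlgebra.exists_negBasis`). Then right multiplication by `𝐟_S`, `S ⊆ X`,
carries ordered monomials to ordered monomials: it adds a multiset
(`NegBasis.minusMap_mono_mul_fH`). Hence the maps between Verma modules in question all act on
monomials as in a polynomial ring, as for a Taylor resolution of a monomial ideal.

* `𝐟_S m_λ` is singular by the usual `𝔰𝔩₂` computation, so the differentials exist
  (`KMAlgebra.exists_differential`).
* Graded by monomials `p`, the complex is a direct sum of augmented chain complexes of full
  simplices, the vertices of the one at `p` being the `j` for which `𝐟_{H_j}` divides `p`. Coning
  from the least vertex contracts each of them, unless there is no vertex and the complex is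
  concentrated in degree zero (`SimplexComplex.exact`). The image of `d_1` is the submodule by which
  one divides, as only the minimal elements of `𝓗` matter (`KMAlgebra.holeSubmodule_eq`).
* That submodule is spanned by the monomials divisible by some `𝐟_{H_j}`; the others are a basis of
  weight vectors of the quotient, and inclusion–exclusion gives its character
  (`KMAlgebra.ch_higherVerma`).
* The character of `M(μ)` is `e^μ` times the generating function of multisets of basis vectors of
  `𝔫⁻`, which is the inverse of the product over the basis vectors of the factors `1 - e^{-wt}`
  (`KMAlgebra.ch_verma`). For the product over the roots one needs that every `𝔤_{-α}` lies in
  `𝔫⁻`, and so has the basis vectors of weight `-α` as a basis.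
* For independent `S`, `𝐬_S μ = μ - ∑_{h ∈ S} ⟨μ, α_h^∨⟩ α_h` (`Realization.sH_apply`). All
  statements on the Weyl group follow from this formula: `𝐬_S • λ = λ_S`; `𝐬_S 𝐬_T` is `𝐬` of the
  symmetric difference, for `S, T ⊆ X`; and `S` can be read off from `𝐬_S ρ`, as well as from `λ_S`
  if `S ⊆ J_λ`.
-/

/-! ### The Poincaré–Birkhoff–Witt theorem -/

namespace PBW

attribute [local instance 100] LieRing.ofAssociativeRing

universe u v w

variable {k : Type u} {L : Type v} {ι : Type w} [CommRing k] [LieRing L] [LieAlgebra k L]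
  (b : Module.Basis ι k L)

/-- The monomials of degree at most `n` in the symmetric algebra `Multiset ι →₀ k`. -/
abbrev filt (k : Type u) [CommRing k] (ι : Type w) (n : ℕ) : Submodule k (Multiset ι →₀ k) :=
  Finsupp.supported k k {M | Multiset.card M ≤ n}

theorem single_mem_filt {n : ℕ} {M : Multiset ι} (h : Multiset.card M ≤ n) (c : k) :
    Finsupp.single M c ∈ filt k ι n :=
  Finsupp.single_mem_supported k c h

theorem filt_mono {m n : ℕ} (h : m ≤ n) : filt k ι m ≤ filt k ι n :=
  Finsupp.supported_mono fun _ hM => le_trans hM h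

theorem filt_eqOn {N : Type*} [AddCommGroup N] [Module k N] {n : ℕ}
    {f g : (Multiset ι →₀ k) →ₗ[k] N}
    (h : ∀ M : Multiset ι, Multiset.card M ≤ n →
      f (Finsupp.single M 1) = g (Finsupp.single M 1))
    {v : Multiset ι →₀ k} (hv : v ∈ filt k ι n) : f v = g v := by
  rw [filt, Finsupp.supported_eq_span_single] at hv
  refine LinearMap.eqOn_span (s := (fun i => Finsupp.single i (1 : k)) '' _) ?_ hv
  rintro _ ⟨M, hM, rfl⟩
  exact h M hM

theorem filt_map_mem {N : Type*} [AddCommGroup N] [Module k N] {n : ℕ}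
    {f : (Multiset ι →₀ k) →ₗ[k] N} {P : Submodule k N}
    (h : ∀ M : Multiset ι, Multiset.card M ≤ n → f (Finsupp.single M 1) ∈ P)
    {v : Multiset ι →₀ k} (hv : v ∈ filt k ι n) : f v ∈ P := by
  rw [filt, Finsupp.supported_eq_span_single] at hv
  have : Submodule.span k ((fun i => Finsupp.single i (1 : k)) '' {M | Multiset.card M ≤ n}) ≤
      P.comap f := by
    rw [Submodule.span_le]
    rintro _ ⟨M, hM, rfl⟩
    exact h M hM
  exact this hv

theorem basis_map_mem {N : Type*} [AddCommGroup N] [Module k N] {f : L →ₗ[k] N}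
    {P : Submodule k N} (h : ∀ i, f (b i) ∈ P) (x : L) : f x ∈ P := by
  have : Submodule.span k (Set.range b) ≤ P.comap f := by
    rw [Submodule.span_le]
    rintro _ ⟨i, rfl⟩
    exact h i
  exact this (b.mem_span x)

variable [LinearOrder ι]

/-- Approximations to the action of `L` on the symmetric algebra of `L`: the `n`-th one is
correct in degrees at most `n`. A basis vector `b i` sends a monomial `M` to `i ::ₘ M` if `i` is at
most the entries of `M`; otherwise `M = j ::ₘ N` with `j < i` its least entry, and the value is
dictated by `b i * b j = b j * b i + ⁅b i, b j⁆`. -/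
noncomputable def actAux : ℕ → (L →ₗ[k] Module.End k (Multiset ι →₀ k))
  | 0 => b.constr k fun i => Finsupp.linearCombination k fun M => Finsupp.single (i ::ₘ M) 1
  | n + 1 => b.constr k fun i => Finsupp.linearCombination k fun M =>
      match M.sort with
      | [] => Finsupp.single (i ::ₘ M) 1
      | j :: t =>
        if i ≤ j then Finsupp.single (i ::ₘ M) 1 else
          Finsupp.single (i ::ₘ M) 1 +
            actAux n (b j) (actAux n (b i) (Finsupp.single (t : Multiset ι) 1) -
              Finsupp.single (i ::ₘ (t : Multiset ι)) 1) +
            actAux n ⁅b i, b j⁆ (Finsupp.single (t : Multiset ι) 1)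

theorem actAux_of_le (n : ℕ) {i : ι} {M : Multiset ι} (h : ∀ j ∈ M, i ≤ j) :
    actAux b n (b i) (Finsupp.single M 1) = Finsupp.single (i ::ₘ M) 1 := by
  cases n with
  | zero => simp [actAux]
  | succ n =>
    simp only [actAux, Module.Basis.constr_basis, Finsupp.linearCombination_single, one_smul]
    split
    · rfl
    · rename_i j t hjt
      rw [if_pos]
      apply h
      rw [← Multiset.mem_sort (r := (· ≤ ·)), hjt]
      simp

theorem actAux_of_lt (n : ℕ) {i j : ι} {N : Multiset ι} (hij : j < i) (h : ∀ l ∈ N, j ≤ l) :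
    actAux b (n + 1) (b i) (Finsupp.single (j ::ₘ N) 1) =
      Finsupp.single (i ::ₘ j ::ₘ N) 1 +
        actAux b n (b j) (actAux b n (b i) (Finsupp.single N 1) - Finsupp.single (i ::ₘ N) 1) +
        actAux b n ⁅b i, b j⁆ (Finsupp.single N 1) := by
  simp only [actAux, Module.Basis.constr_basis, Finsupp.linearCombination_single, one_smul]
  rw [Multiset.sort_cons _ _ _ h]
  simp only [not_le.mpr hij, if_false, Multiset.sort_eq]

theorem exists_min_cons (i : ι) (M : Multiset ι) :
    (∀ j ∈ M, i ≤ j) ∨ ∃ j N, M = j ::ₘ N ∧ j < i ∧ ∀ l ∈ N, j ≤ l := by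
  have h2 := Multiset.pairwise_sort M (· ≤ ·)
  have h1 := Multiset.sort_eq M (· ≤ ·)
  cases h : M.sort (· ≤ ·) with
  | nil =>
    left; intro j hj; rw [← h1, h] at hj; simp at hj
  | cons j t =>
    rw [h] at h1 h2
    rw [List.pairwise_cons] at h2
    by_cases hij : i ≤ j
    · left
      intro l hl
      rw [← h1] at hl
      rcases List.mem_cons.mp (Multiset.mem_coe.mp hl) with rfl | hl
      · exact hij
      · exact hij.trans (h2.1 l hl)
    · right
      exact ⟨j, t, by rw [← h1]; rfl, not_le.mp hij, fun l hl => h2.1 l hl⟩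

theorem actAux_sub_mem (n : ℕ) (i : ι) (M : Multiset ι) :
    actAux b n (b i) (Finsupp.single M 1) - Finsupp.single (i ::ₘ M) 1 ∈
      filt k ι (Multiset.card M) := by
  induction n generalizing i M with
  | zero => simp [actAux]
  | succ n ih =>
    have key : ∀ (m : ℕ) (x : L) (v : Multiset ι →₀ k), v ∈ filt k ι m →
        actAux b n x v ∈ filt k ι (m + 1) := by
      intro m x v hv
      refine basis_map_mem b (f := (actAux b n).flip v) (fun i => ?_) x
      refine filt_map_mem (f := actAux b n (b i)) (fun M hM => ?_) hv
      have h1 := filt_mono (hM.trans (Nat.le_succ m)) (ih i M)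
      have h2 : Finsupp.single (i ::ₘ M) (1 : k) ∈ filt k ι (m + 1) :=
        single_mem_filt (by rw [Multiset.card_cons]; exact Nat.succ_le_succ hM) 1
      simpa using add_mem h1 h2
    rcases exists_min_cons i M with h | ⟨j, N, rfl, hji, hN⟩
    · rw [actAux_of_le b _ h, sub_self]; exact zero_mem _
    · rw [actAux_of_lt b n hji hN, add_assoc, add_sub_cancel_left, Multiset.card_cons]
      exact add_mem (key _ _ _ (ih i N)) (key _ _ _ (single_mem_filt le_rfl 1))

theorem actAux_succ (n : ℕ) (x : L) {v : Multiset ι →₀ k} (hv : v ∈ filt k ι n) :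
    actAux b n x v = actAux b (n + 1) x v := by
  induction n generalizing x v with
  | zero =>
    refine LinearMap.congr_fun (f := (actAux b 0).flip v) (g := (actAux b 1).flip v)
      (b.ext fun i => ?_) x
    refine filt_eqOn (f := actAux b 0 (b i)) (fun M hM => ?_) hv
    obtain rfl : M = 0 := by simpa using hM
    rw [actAux_of_le _ _ (by simp), actAux_of_le _ _ (by simp)]
  | succ n ih =>
    refine LinearMap.congr_fun (f := (actAux b (n + 1)).flip v) (g := (actAux b (n + 2)).flip v)
      (b.ext fun i => ?_) x
    refine filt_eqOn (f := actAux b (n + 1) (b i)) (fun M hM => ?_) hv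
    rcases exists_min_cons i M with h | ⟨j, N, rfl, hji, hN⟩
    · rw [actAux_of_le _ _ h, actAux_of_le _ _ h]
    · rw [Multiset.card_cons, Nat.succ_le_succ_iff] at hM
      rw [actAux_of_lt b n hji hN, actAux_of_lt b (n + 1) hji hN,
        ← ih _ (single_mem_filt hM 1), ← ih _ (single_mem_filt hM 1),
        ← ih _ (filt_mono hM (actAux_sub_mem b n i N))]

theorem actAux_eq {m n : ℕ} (h : m ≤ n) (x : L) {v : Multiset ι →₀ k} (hv : v ∈ filt k ι m) :
    actAux b m x v = actAux b n x v := by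
  induction h with
  | refl => rfl
  | step h ih => rw [ih, actAux_succ _ _ _ (filt_mono h hv)]

/-- The action of `L` on its symmetric algebra, as a linear map. -/
noncomputable def act : L →ₗ[k] Module.End k (Multiset ι →₀ k) :=
  b.constr k fun i => Finsupp.linearCombination k fun M =>
    actAux b (Multiset.card M) (b i) (Finsupp.single M 1)

theorem act_eq_actAux {n : ℕ} (x : L) {v : Multiset ι →₀ k} (hv : v ∈ filt k ι n) :
    act b x v = actAux b n x v := by
  refine LinearMap.congr_fun (f := (act b).flip v) (g := (actAux b n).flip v)
    (b.ext fun i => ?_) x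
  refine filt_eqOn (f := act b (b i)) (fun M hM => ?_) hv
  rw [← actAux_eq b hM _ (single_mem_filt le_rfl 1)]
  simp [act]

theorem act_of_le {i : ι} {M : Multiset ι} (h : ∀ j ∈ M, i ≤ j) :
    act b (b i) (Finsupp.single M 1) = Finsupp.single (i ::ₘ M) 1 := by
  rw [act_eq_actAux b _ (single_mem_filt le_rfl 1), actAux_of_le b _ h]

theorem act_sub_mem (i : ι) (M : Multiset ι) :
    act b (b i) (Finsupp.single M 1) - Finsupp.single (i ::ₘ M) 1 ∈
      filt k ι (Multiset.card M) := by
  rw [act_eq_actAux b _ (single_mem_filt le_rfl 1)]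
  exact actAux_sub_mem b _ i M

theorem act_of_lt {i j : ι} {N : Multiset ι} (hij : j < i) (h : ∀ l ∈ N, j ≤ l) :
    act b (b i) (Finsupp.single (j ::ₘ N) 1) =
      act b (b j) (act b (b i) (Finsupp.single N 1)) + act b ⁅b i, b j⁆ (Finsupp.single N 1) := by
  have h0 := single_mem_filt (k := k) (le_refl (Multiset.card N)) 1
  have h1 : act b (b j) (Finsupp.single (i ::ₘ N) 1) = Finsupp.single (j ::ₘ i ::ₘ N) 1 :=
    act_of_le b fun l hl => by
      rcases Multiset.mem_cons.mp hl with rfl | hl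
      · exact hij.le
      · exact h l hl
  rw [act_eq_actAux b (b i) (single_mem_filt (n := Multiset.card N + 1) (by simp) 1),
    actAux_of_lt b _ hij h, ← act_eq_actAux b ⁅b i, b j⁆ h0, ← act_eq_actAux b (b i) h0,
    ← act_eq_actAux b (b j) (act_sub_mem b i N), map_sub, h1, Multiset.cons_swap]
  abel

/-- The map `act` is a representation: the inductive step, in which the Jacobi identity enters. -/
theorem act_lie_single {n : ℕ} (IH : ∀ m < n, ∀ v ∈ filt k ι m, ∀ x y : L,
      act b ⁅x, y⁆ v = act b x (act b y v) - act b y (act b x v))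
    {M : Multiset ι} (hM : Multiset.card M ≤ n) {i j : ι} (hji : j < i) :
    act b ⁅b i, b j⁆ (Finsupp.single M 1) =
      act b (b i) (act b (b j) (Finsupp.single M 1)) -
        act b (b j) (act b (b i) (Finsupp.single M 1)) := by
  rcases exists_min_cons j M with h | ⟨l, N, rfl, hlj, hN⟩
  · rw [act_of_le b h, act_of_lt b hji h]
    abel
  · rw [Multiset.card_cons, Nat.succ_le_iff] at hM
    -- `claim` holds for the leading term by definition and for the remainder by induction
    have claim : ∀ p q : ι, l < p → l < q →
        act b (b p) (act b (b l) (act b (b q) (Finsupp.single N 1))) =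
          act b (b l) (act b (b p) (act b (b q) (Finsupp.single N 1))) +
            act b ⁅b p, b l⁆ (act b (b q) (Finsupp.single N 1)) := by
      intro p q hp hq
      have hqN : ∀ r ∈ q ::ₘ N, l ≤ r := fun r hr => by
        rcases Multiset.mem_cons.mp hr with rfl | hr
        · exact hq.le
        · exact hN r hr
      have h1 := act_of_lt b hp hqN
      rw [← act_of_le b hqN] at h1
      have h2 := IH _ hM _ (act_sub_mem b q N) (b p) (b l)
      simp only [map_sub] at h2
      rw [h1] at h2
      linear_combination (norm := module) -h2
    have IHN := IH _ hM _ (single_mem_filt (k := k) (le_refl (Multiset.card N)) 1)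
    have hi := act_of_lt b (hlj.trans hji) hN
    have hj := act_of_lt b hlj hN
    have hlN := act_of_le b hN
    have e1 := claim i j (hlj.trans hji) hlj
    have e2 := claim j i hlj (hlj.trans hji)
    have jac : ⁅b i, ⁅b j, b l⁆⁆ - ⁅b j, ⁅b i, b l⁆⁆ = ⁅⁅b i, b j⁆, b l⁆ := by
      rw [leibniz_lie (b i) (b j) (b l)]; abel
    have e3 := IHN ⁅b i, b j⁆ (b l)
    rw [← jac, map_sub, LinearMap.sub_apply, IHN (b i) ⁅b j, b l⁆,
      IHN (b j) ⁅b i, b l⁆, hlN, IHN (b i) (b j)] at e3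
    rw [hi, hj, map_add, map_add, e1, e2]
    rw [map_sub] at e3
    linear_combination (norm := module) -e3

theorem act_lie (x y : L) (v : Multiset ι →₀ k) :
    act b ⁅x, y⁆ v = act b x (act b y v) - act b y (act b x v) := by
  have main : ∀ n, ∀ v ∈ filt k ι n, ∀ x y : L,
      act b ⁅x, y⁆ v = act b x (act b y v) - act b y (act b x v) := by
    intro n
    induction n using Nat.strong_induction_on with
    | _ n IH =>
      intro v hv x y
      suffices h : ∀ i j, act b ⁅b i, b j⁆ v = act b (b i) (act b (b j) v) -
          act b (b j) (act b (b i) v) by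
        let f₁ : L →ₗ[k] L →ₗ[k] (Multiset ι →₀ k) :=
          LinearMap.mk₂ k (fun x y => act b ⁅x, y⁆ v) (by simp) (by simp) (by simp) (by simp)
        let f₂ : L →ₗ[k] L →ₗ[k] (Multiset ι →₀ k) :=
          LinearMap.mk₂ k (fun x y => act b x (act b y v) - act b y (act b x v))
            (by intros; simp; abel) (by intros; simp [smul_sub])
            (by intros; simp; abel) (by intros; simp [smul_sub])
        have : f₁ = f₂ := b.ext fun i => b.ext fun j => h i j
        exact LinearMap.congr_fun (LinearMap.congr_fun this x) y
      intro i j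
      refine filt_eqOn (f := act b ⁅b i, b j⁆)
        (g := (act b (b i)).comp (act b (b j)) - (act b (b j)).comp (act b (b i)))
        (fun M hM => ?_) hv
      simp only [LinearMap.sub_apply, LinearMap.comp_apply]
      rcases lt_trichotomy j i with hji | rfl | hij
      · exact act_lie_single b IH hM hji
      · simp
      · rw [← lie_skew, map_neg, LinearMap.neg_apply, act_lie_single b IH hM hij]
        abel
  have hv : v ∈ filt k ι (v.support.sup Multiset.card) := by
    rw [filt, Finsupp.mem_supported]
    intro M hM
    exact Finset.le_sup (f := Multiset.card) hM
  exact main _ v hv x y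

/-- The representation of `L` on its symmetric algebra. -/
noncomputable def actHom : L →ₗ⁅k⁆ Module.End k (Multiset ι →₀ k) :=
  { act b with
    map_lie' := fun {x y} => LinearMap.ext fun v => by
      rw [LieRing.of_associative_ring_bracket]
      exact act_lie b x y v }

/-- The ordered monomial in `U L` attached to a multiset of basis vectors. -/
noncomputable def mono (M : Multiset ι) : UniversalEnvelopingAlgebra k L :=
  (M.sort.map fun i => UniversalEnvelopingAlgebra.ι k (b i)).prod

theorem mono_zero : mono b 0 = 1 := by simp [mono]

theorem mono_cons {i : ι} {M : Multiset ι} (h : ∀ j ∈ M, i ≤ j) :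
    mono b (i ::ₘ M) = UniversalEnvelopingAlgebra.ι k (b i) * mono b M := by
  rw [mono, Multiset.sort_cons _ _ _ h, List.map_cons, List.prod_cons, mono]

/-- Evaluation of the representation of `U L` at `1`. -/
noncomputable def evalOne : UniversalEnvelopingAlgebra k L →ₗ[k] (Multiset ι →₀ k) :=
  (LinearMap.applyₗ (Finsupp.single (0 : Multiset ι) (1 : k))).comp
    (UniversalEnvelopingAlgebra.lift k (actHom b)).toLinearMap

theorem min_induction {P : Multiset ι → Prop} (h0 : P 0)
    (hc : ∀ i N, (∀ l ∈ N, i ≤ l) → P N → P (i ::ₘ N)) (M : Multiset ι) : P M := by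
  have h1 := Multiset.sort_eq M (· ≤ ·)
  have h2 := Multiset.pairwise_sort M (· ≤ ·)
  rw [← h1]
  clear h1
  generalize M.sort (· ≤ ·) = s at h2 ⊢
  induction s with
  | nil => exact h0
  | cons i t ih =>
    rw [List.pairwise_cons] at h2
    rw [← Multiset.cons_coe]
    exact hc i t (fun l hl => h2.1 l hl) (ih h2.2)

theorem lift_mono (M : Multiset ι) :
    UniversalEnvelopingAlgebra.lift k (actHom b) (mono b M) (Finsupp.single 0 1) =
      Finsupp.single M 1 := by
  induction M using min_induction with
  | h0 => rw [mono_zero, map_one, Module.End.one_apply]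
  | hc i N h ih =>
    rw [mono_cons b h, map_mul, Module.End.mul_apply, ih,
      UniversalEnvelopingAlgebra.lift_ι_apply]
    exact act_of_le b h

/-- The linear map from the symmetric algebra to `U L` which puts monomials in order. -/
noncomputable def ordered : (Multiset ι →₀ k) →ₗ[k] UniversalEnvelopingAlgebra k L :=
  Finsupp.linearCombination k (mono b)

theorem ordered_single (M : Multiset ι) : ordered b (Finsupp.single M 1) = mono b M := by
  simp [ordered]

theorem ordered_act (x : L) (v : Multiset ι →₀ k) :
    ordered b (act b x v) = UniversalEnvelopingAlgebra.ι k x * ordered b v := by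
  have main : ∀ n, ∀ v ∈ filt k ι n, ∀ x : L,
      ordered b (act b x v) = UniversalEnvelopingAlgebra.ι k x * ordered b v := by
    intro n
    induction n using Nat.strong_induction_on with
    | _ n IH =>
      intro v hv x
      refine LinearMap.congr_fun (f := (ordered b).comp ((act b).flip v))
        (g := (LinearMap.mulRight k (ordered b v)).comp
          (UniversalEnvelopingAlgebra.ι k : L →ₗ⁅k⁆ _).toLinearMap) (b.ext fun i => ?_) x
      refine filt_eqOn (f := (ordered b).comp (act b (b i)))
        (g := (LinearMap.mulLeft k (UniversalEnvelopingAlgebra.ι k (b i))).comp (ordered b))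
        (fun M hM => ?_) hv
      simp only [LinearMap.comp_apply, LinearMap.mulLeft_apply]
      rcases exists_min_cons i M with h | ⟨j, N, rfl, hji, hN⟩
      · rw [act_of_le b h, ordered_single, ordered_single, mono_cons b h]
      · rw [Multiset.card_cons, Nat.succ_le_iff] at hM
        have hiN : ∀ r ∈ i ::ₘ N, j ≤ r := fun r hr => by
          rcases Multiset.mem_cons.mp hr with rfl | hr
          · exact hji.le
          · exact hN r hr
        have h0 := single_mem_filt (k := k) (le_refl (Multiset.card N)) 1
        have h1 := IH _ hM _ (act_sub_mem b i N) (b j)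
        rw [map_sub, map_sub, map_sub, act_of_le b hiN, ordered_single, ordered_single,
          mono_cons b hiN, mul_sub, sub_left_inj, IH _ hM _ h0] at h1
        rw [act_of_lt b hji hN, map_add, h1, IH _ hM _ h0, ordered_single, ordered_single,
          mono_cons b hN, LieHom.map_lie, LieRing.of_associative_ring_bracket]
        noncomm_ring
  have hv : v ∈ filt k ι (v.support.sup Multiset.card) := by
    rw [filt, Finsupp.mem_supported]
    intro M hM
    exact Finset.le_sup (f := Multiset.card) hM
  exact main _ v hv x

omit [LinearOrder ι] in
/-- Induction principle for `U L`: a subspace stable under left multiplication by `L`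
and containing `1` is everything. -/
theorem mem_of_stable (P : Submodule k (UniversalEnvelopingAlgebra k L)) (h1 : 1 ∈ P)
    (hmul : ∀ x : L, ∀ u ∈ P, UniversalEnvelopingAlgebra.ι k x * u ∈ P)
    (u : UniversalEnvelopingAlgebra k L) : u ∈ P := by
  let S : Subalgebra k (UniversalEnvelopingAlgebra k L) :=
    { carrier := {u | ∀ p ∈ P, u * p ∈ P}
      mul_mem' := fun {a c} ha hc p hp => by rw [mul_assoc]; exact ha _ (hc _ hp)
      add_mem' := fun {a c} ha hc p hp => by rw [add_mul]; exact add_mem (ha p hp) (hc p hp)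
      algebraMap_mem' := fun r p hp => by
        rw [← Algebra.smul_def]; exact P.smul_mem r hp }
  let g : L →ₗ⁅k⁆ S :=
    { toFun := fun x => ⟨UniversalEnvelopingAlgebra.ι k x, hmul x⟩
      map_add' := fun x y => Subtype.ext (by simp)
      map_smul' := fun c x => Subtype.ext (by simp)
      map_lie' := fun {x y} => Subtype.ext (by
        refine (LieHom.map_lie (UniversalEnvelopingAlgebra.ι k) x y).trans ?_
        rw [LieRing.of_associative_ring_bracket, LieRing.of_associative_ring_bracket]; rfl) }
  have h : S.val.comp (UniversalEnvelopingAlgebra.lift k g) =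
      AlgHom.id k (UniversalEnvelopingAlgebra k L) := by
    apply UniversalEnvelopingAlgebra.hom_ext
    ext x
    change ((UniversalEnvelopingAlgebra.lift k g (UniversalEnvelopingAlgebra.ι k x) : S) :
      UniversalEnvelopingAlgebra k L) = UniversalEnvelopingAlgebra.ι k x
    rw [UniversalEnvelopingAlgebra.lift_ι_apply]
    rfl
  have h2 := AlgHom.congr_fun h u
  have h3 := (UniversalEnvelopingAlgebra.lift k g u).2 1 h1
  rw [mul_one] at h3
  rwa [show ((UniversalEnvelopingAlgebra.lift k g u : S) : UniversalEnvelopingAlgebra k L) = u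
    from h2] at h3

theorem ordered_evalOne (u : UniversalEnvelopingAlgebra k L) :
    ordered b (evalOne b u) = u := by
  refine mem_of_stable (LinearMap.eqLocus ((ordered b).comp (evalOne b)) LinearMap.id) ?_ ?_ u
  · simp [evalOne, ordered_single, mono_zero]
  · intro x u hu
    have hu' : ordered b (evalOne b u) = u := hu
    have h : evalOne b (UniversalEnvelopingAlgebra.ι k x * u) = act b x (evalOne b u) := by
      simp only [evalOne, LinearMap.comp_apply, AlgHom.toLinearMap_apply, map_mul,
        UniversalEnvelopingAlgebra.lift_ι_apply]
      rfl
    change ordered b (evalOne b (UniversalEnvelopingAlgebra.ι k x * u)) = _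
    rw [h, ordered_act, hu']
    rfl

/-- The Poincaré–Birkhoff–Witt theorem: the ordered monomials form a basis of `U L`. -/
noncomputable def basis : Module.Basis (Multiset ι) k (UniversalEnvelopingAlgebra k L) :=
  .ofRepr (LinearEquiv.ofLinearMap (evalOne b) (ordered b)
    (Finsupp.lhom_ext' fun M => LinearMap.ext_ring (by
      simp only [LinearMap.comp_apply, Finsupp.lsingle_apply, ordered_single]
      exact lift_mono b M))
    (LinearMap.ext (ordered_evalOne b)))

theorem basis_apply (M : Multiset ι) : basis b M = mono b M := by
  rw [← ordered_single]; rfl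

end PBW

/-! ### Consequences of the Poincaré–Birkhoff–Witt theorem -/

namespace PBW

attribute [local instance 100] LieRing.ofAssociativeRing

universe u v w

section Commuting

variable {k : Type u} {L : Type v} {ι : Type w} [CommRing k] [LieRing L] [LieAlgebra k L]
  (b : Module.Basis ι k L) [LinearOrder ι]

/-- If the largest basis vectors commute with each other, then multiplication by one of them on
the right permutes the ordered monomials. -/
theorem mono_cons_right {X : Set ι} (hX : IsUpperSet X)
    (hcomm : ∀ i ∈ X, ∀ j ∈ X, ⁅b i, b j⁆ = 0) {h : ι} (hh : h ∈ X) (M : Multiset ι) :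
    mono b (h ::ₘ M) = mono b M * UniversalEnvelopingAlgebra.ι k (b h) := by
  induction M using min_induction with
  | h0 => rw [mono_cons b (by simp), mono_zero, one_mul, mul_one]
  | hc i N hi ih =>
    rcases le_or_gt h i with hle | hlt
    · have hN : ∀ l ∈ i ::ₘ N, h ≤ l := fun l hl => by
        rcases Multiset.mem_cons.mp hl with rfl | hl
        · exact hle
        · exact hle.trans (hi l hl)
      rw [mono_cons b hN]
      refine Commute.list_prod_right _ _ fun y hy => ?_
      obtain ⟨l, hl, rfl⟩ := List.mem_map.mp hy
      rw [Multiset.mem_sort] at hl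
      have h0 := hcomm h hh l (hX (hN l hl) hh)
      rw [commute_iff_lie_eq, ← LieHom.map_lie, h0, map_zero]
    · have hN : ∀ l ∈ h ::ₘ N, i ≤ l := fun l hl => by
        rcases Multiset.mem_cons.mp hl with rfl | hl
        · exact hlt.le
        · exact hi l hl
      rw [Multiset.cons_swap, mono_cons b hN, ih, mono_cons b hi, mul_assoc]

end Commuting

section Induced

variable {k : Type u} {L : Type v} [Field k] [LieRing L] [LieAlgebra k L]

/-- The algebra map `U a → U L` for a subalgebra `a` of `L`. -/
noncomputable def inclMap (a : LieSubalgebra k L) :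
    UniversalEnvelopingAlgebra k a →ₐ[k] UniversalEnvelopingAlgebra k L :=
  UniversalEnvelopingAlgebra.lift k ((UniversalEnvelopingAlgebra.ι k).comp a.incl)

theorem inclMap_ι (a : LieSubalgebra k L) (x : a) :
    inclMap a (UniversalEnvelopingAlgebra.ι k x) = UniversalEnvelopingAlgebra.ι k (x : L) :=
  UniversalEnvelopingAlgebra.lift_ι_apply k _ x

variable {ι₁ ι₂ : Type*} [LinearOrder ι₁] [LinearOrder ι₂] {a c : LieSubalgebra k L}

/-- The basis of `L = a ⊕ c` obtained from bases of the summands, that of `a` coming first. -/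
noncomputable def sumBasis (ba : Module.Basis ι₁ k a) (bc : Module.Basis ι₂ k c)
    (h : IsCompl a.toSubmodule c.toSubmodule) : Module.Basis (ι₁ ⊕ₗ ι₂) k L :=
  ((Module.Basis.prod (M := a.toSubmodule) (M' := c.toSubmodule) ba bc).map
    (Submodule.prodEquivOfIsCompl _ _ h)).reindex toLex

variable (ba : Module.Basis ι₁ k a) (bc : Module.Basis ι₂ k c)
    (h : IsCompl a.toSubmodule c.toSubmodule)

omit [LinearOrder ι₁] [LinearOrder ι₂] in
theorem sumBasis_inl (i : ι₁) : sumBasis ba bc h (toLex (Sum.inl i)) = (ba i : L) := by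
  simp only [sumBasis, Module.Basis.reindex_apply, Module.Basis.map_apply, Equiv.symm_apply_apply,
    Module.Basis.prod_apply, Sum.elim_inl, Function.comp_apply, LinearMap.coe_inl,
    Submodule.coe_prodEquivOfIsCompl']
  exact add_zero _

omit [LinearOrder ι₁] [LinearOrder ι₂] in
theorem sumBasis_inr (i : ι₂) : sumBasis ba bc h (toLex (Sum.inr i)) = (bc i : L) := by
  simp only [sumBasis, Module.Basis.reindex_apply, Module.Basis.map_apply, Equiv.symm_apply_apply,
    Module.Basis.prod_apply, Sum.elim_inr, Function.comp_apply, LinearMap.coe_inr,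
    Submodule.coe_prodEquivOfIsCompl']
  exact zero_add _

/-- The multiset on a disjoint union with the given parts. -/
def glue (M : Multiset ι₁) (N : Multiset ι₂) : Multiset (ι₁ ⊕ₗ ι₂) :=
  M.map (fun i => toLex (Sum.inl i)) + N.map (fun i => toLex (Sum.inr i))

theorem mono_glue (M : Multiset ι₁) (N : Multiset ι₂) :
    mono (sumBasis ba bc h) (glue M N) = inclMap a (mono ba M) * inclMap c (mono bc N) := by
  induction M using min_induction with
  | h0 =>
    rw [mono_zero, map_one, one_mul, glue, Multiset.map_zero, zero_add]
    induction N using min_induction with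
    | h0 => simp [mono_zero]
    | hc i N hi ih =>
      rw [Multiset.map_cons, mono_cons, sumBasis_inr, ih, mono_cons bc hi, map_mul, inclMap_ι]
      intro l hl
      obtain ⟨j, hj, rfl⟩ := Multiset.mem_map.mp hl
      exact Sum.Lex.inr_le_inr_iff.mpr (hi j hj)
  | hc i M hi ih =>
    have : glue (i ::ₘ M) N = toLex (Sum.inl i) ::ₘ glue M N := by
      rw [glue, Multiset.map_cons, Multiset.cons_add, glue]
    rw [this, mono_cons, ih, sumBasis_inl, mono_cons ba hi, map_mul, inclMap_ι, mul_assoc]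
    intro l hl
    rcases Multiset.mem_add.mp hl with hl | hl
    · obtain ⟨j, hj, rfl⟩ := Multiset.mem_map.mp hl
      exact Sum.Lex.inl_le_inl_iff.mpr (hi j hj)
    · obtain ⟨j, hj, rfl⟩ := Multiset.mem_map.mp hl
      exact (Sum.Lex.inl_lt_inr _ _).le

omit [LinearOrder ι₁] [LinearOrder ι₂] in
theorem exists_glue (P : Multiset (ι₁ ⊕ₗ ι₂)) : ∃ M N, P = glue M N := by
  induction P using Multiset.induction_on with
  | empty => exact ⟨0, 0, rfl⟩
  | cons x P ih =>
    obtain ⟨M, N, rfl⟩ := ih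
    cases x using Lex.rec with
    | _ x =>
    rcases x with i | j
    · exact ⟨i ::ₘ M, N, by rw [glue, glue, Multiset.map_cons, Multiset.cons_add]⟩
    · exact ⟨M, j ::ₘ N, by rw [glue, glue, Multiset.map_cons, Multiset.add_cons]⟩

/-- The left part of a multiset on a disjoint union. -/
def leftPart (P : Multiset (ι₁ ⊕ₗ ι₂)) : Multiset ι₁ :=
  P.filterMap fun x => (ofLex x).getLeft?

/-- The right part of a multiset on a disjoint union. -/
def rightPart (P : Multiset (ι₁ ⊕ₗ ι₂)) : Multiset ι₂ :=
  P.filterMap fun x => (ofLex x).getRight?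

omit [LinearOrder ι₁] [LinearOrder ι₂] in
theorem leftPart_glue (M : Multiset ι₁) (N : Multiset ι₂) : leftPart (glue M N) = M := by
  rw [leftPart, glue, Multiset.filterMap_add, Multiset.filterMap_map, Multiset.filterMap_map]
  have h1 : M.filterMap ((fun x : ι₁ ⊕ₗ ι₂ => (ofLex x).getLeft?) ∘ fun i => toLex (Sum.inl i)) =
      M := Multiset.filterMap_some M
  have h2 : N.filterMap ((fun x : ι₁ ⊕ₗ ι₂ => (ofLex x).getLeft?) ∘ fun i => toLex (Sum.inr i)) =
      0 := by
    induction N using Multiset.induction_on with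
    | empty => rfl
    | cons j N ih => rw [Multiset.filterMap_cons_none _ _ rfl, ih]
  rw [h1, h2, add_zero]

omit [LinearOrder ι₁] [LinearOrder ι₂] in
theorem rightPart_glue (M : Multiset ι₁) (N : Multiset ι₂) : rightPart (glue M N) = N := by
  rw [rightPart, glue, Multiset.filterMap_add, Multiset.filterMap_map, Multiset.filterMap_map]
  have h1 : N.filterMap ((fun x : ι₁ ⊕ₗ ι₂ => (ofLex x).getRight?) ∘ fun i => toLex (Sum.inr i)) =
      N := Multiset.filterMap_some N
  have h2 : M.filterMap ((fun x : ι₁ ⊕ₗ ι₂ => (ofLex x).getRight?) ∘ fun i => toLex (Sum.inl i)) =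
      0 := by
    induction M using Multiset.induction_on with
    | empty => rfl
    | cons j N ih => rw [Multiset.filterMap_cons_none _ _ rfl, ih]
  rw [h1, h2, zero_add]

omit [LinearOrder ι₁] [LinearOrder ι₂] in
include h in
/-- If `L = a ⊕ c` for subalgebras `a` and `c`, then `U L` is spanned by the products `u * d` with
`u ∈ U a` and `d ∈ U c`. -/
theorem mem_of_mul_mem (P : Submodule k (UniversalEnvelopingAlgebra k L))
    (hP : ∀ u d, inclMap a u * inclMap c d ∈ P) (u : UniversalEnvelopingAlgebra k L) : u ∈ P := by
  classical
  let : LinearOrder (Module.Basis.ofVectorSpaceIndex k a) := linearOrderOfSTO WellOrderingRel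
  let : LinearOrder (Module.Basis.ofVectorSpaceIndex k c) := linearOrderOfSTO WellOrderingRel
  let e := sumBasis (Module.Basis.ofVectorSpace k a) (Module.Basis.ofVectorSpace k c) h
  have h2 : Submodule.span k (Set.range (basis e)) ≤ P := by
    rw [Submodule.span_le]
    rintro _ ⟨Q, rfl⟩
    obtain ⟨M, N, rfl⟩ := exists_glue Q
    rw [basis_apply, mono_glue]
    exact hP _ _
  exact h2 ((basis e).mem_span u)

/-- If `L = a ⊕ c` for subalgebras `a` and `c`, then `U L` is free as a right `U c`-module, with
`U a` as a complement to the right ideal structure: for any character `χ` of `c` there is a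
projection `U L → U a` through which `c` acts on the right by `χ`. -/
theorem exists_inducedProj (h : IsCompl a.toSubmodule c.toSubmodule) (χ : c →ₗ⁅k⁆ k) :
    ∃ φ : UniversalEnvelopingAlgebra k L →ₗ[k] UniversalEnvelopingAlgebra k a,
      (∀ u, φ (inclMap a u) = u) ∧
      ∀ u (x : c), φ (u * UniversalEnvelopingAlgebra.ι k (x : L)) = χ x • φ u := by
  classical
  let ba := Module.Basis.ofVectorSpace k a
  let bc := Module.Basis.ofVectorSpace k c
  let : LinearOrder (Module.Basis.ofVectorSpaceIndex k a) := linearOrderOfSTO WellOrderingRel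
  let : LinearOrder (Module.Basis.ofVectorSpaceIndex k c) := linearOrderOfSTO WellOrderingRel
  let X := UniversalEnvelopingAlgebra.lift k χ
  let φ : UniversalEnvelopingAlgebra k L →ₗ[k] UniversalEnvelopingAlgebra k a :=
    (basis (sumBasis ba bc h)).constr k fun P => X (mono bc (rightPart P)) • mono ba (leftPart P)
  have hφ : ∀ u d, φ (inclMap a u * inclMap c d) = X d • u := by
    intro u d
    let f₁ : UniversalEnvelopingAlgebra k a →ₗ[k] UniversalEnvelopingAlgebra k c →ₗ[k]
        UniversalEnvelopingAlgebra k a :=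
      LinearMap.mk₂ k (fun u d => φ (inclMap a u * inclMap c d))
        (by intros; simp [add_mul]) (by intros; simp) (by intros; simp [mul_add]) (by intros; simp)
    let f₂ : UniversalEnvelopingAlgebra k a →ₗ[k] UniversalEnvelopingAlgebra k c →ₗ[k]
        UniversalEnvelopingAlgebra k a :=
      LinearMap.mk₂ k (fun u d => X d • u)
        (by intros; simp) (by intros; rw [smul_comm]) (by intros; rw [map_add, add_smul])
        (by intros; simp [mul_smul])
    have : f₁ = f₂ := (basis ba).ext fun M => (basis bc).ext fun N => by
      simp only [f₁, f₂, LinearMap.mk₂_apply, basis_apply]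
      rw [← mono_glue ba bc h, ← basis_apply, Module.Basis.constr_basis, leftPart_glue,
        rightPart_glue]
    exact LinearMap.congr_fun (LinearMap.congr_fun this u) d
  refine ⟨φ, fun u => ?_, fun u x => ?_⟩
  · have := hφ u 1
    rwa [map_one, mul_one, map_one, one_smul] at this
  · refine LinearMap.congr_fun
      (f := φ.comp (LinearMap.mulRight k (UniversalEnvelopingAlgebra.ι k (x : L))))
      (g := χ x • φ) ((basis (sumBasis ba bc h)).ext fun P => ?_) u
    obtain ⟨M, N, rfl⟩ := exists_glue P
    simp only [LinearMap.comp_apply, LinearMap.mulRight_apply, LinearMap.smul_apply]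
    rw [basis_apply, mono_glue, ← inclMap_ι, mul_assoc, ← map_mul, hφ, hφ, map_mul,
      UniversalEnvelopingAlgebra.lift_ι_apply, smul_smul, mul_comm]

end Induced

end PBW

/-! ### Iterated brackets and weight vectors -/

namespace KacMoody

universe u v w

section Words

variable {k : Type v} {L : Type w} {I : Type u} [Field k] [LieRing L] [LieAlgebra k L]

/-- The iterated bracket `⁅x j₁, ⁅x j₂, … ⁅x jᵣ, x i⁆⁆⁆`. -/
def word (x : I → L) (i : I) (l : List I) : L := l.foldr (fun j y => ⁅x j, y⁆) (x i)

theorem word_cons (x : I → L) (i j : I) (l : List I) :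
    word x i (j :: l) = ⁅x j, word x i l⁆ := rfl

/-- The span of all iterated brackets. -/
def wordSpan (k : Type v) [Field k] [LieAlgebra k L] (x : I → L) : Submodule k L :=
  Submodule.span k (Set.range fun p : I × List I => word x p.1 p.2)

/-- The subalgebra of elements whose adjoint action preserves a given subspace. -/
def stab (W : Submodule k L) : LieSubalgebra k L where
  carrier := {y | ∀ z ∈ W, ⁅y, z⁆ ∈ W}
  add_mem' := fun ha hb z hz => by rw [add_lie]; exact add_mem (ha z hz) (hb z hz)
  zero_mem' := fun z _ => by rw [zero_lie]; exact zero_mem _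
  smul_mem' := fun c y hy z hz => by rw [smul_lie]; exact W.smul_mem c (hy z hz)
  lie_mem' := fun {a b} ha hb z hz => by
    rw [lie_lie]; exact sub_mem (ha _ (hb z hz)) (hb _ (ha z hz))

theorem word_mem_wordSpan (x : I → L) (i : I) (l : List I) : word x i l ∈ wordSpan k x :=
  Submodule.subset_span ⟨(i, l), rfl⟩

theorem lie_wordSpan_mem {x : I → L} {y : L} {W : Submodule k L}
    (h : ∀ i l, ⁅y, word x i l⁆ ∈ W) {z : L} (hz : z ∈ wordSpan k x) : ⁅y, z⁆ ∈ W := by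
  have : wordSpan k x ≤ W.comap (LieAlgebra.ad k L y) := by
    rw [wordSpan, Submodule.span_le]
    rintro _ ⟨p, rfl⟩
    exact h p.1 p.2
  exact this hz

theorem gen_mem_stab_wordSpan (x : I → L) (j : I) : x j ∈ stab (wordSpan k x) := fun _ hz =>
  lie_wordSpan_mem (fun i l => word_mem_wordSpan x i (j :: l)) hz

/-- The iterated brackets of the generators span the subalgebra which these generate. -/
theorem lieSpan_toSubmodule (x : I → L) :
    (LieSubalgebra.lieSpan k L (Set.range x)).toSubmodule = wordSpan k x := by
  have h1 : wordSpan k x ≤ (LieSubalgebra.lieSpan k L (Set.range x)).toSubmodule := by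
    rw [wordSpan, Submodule.span_le]
    rintro _ ⟨⟨i, l⟩, rfl⟩
    induction l with
    | nil => exact LieSubalgebra.subset_lieSpan ⟨i, rfl⟩
    | cons j l ih =>
      exact LieSubalgebra.lie_mem _ (LieSubalgebra.subset_lieSpan ⟨j, rfl⟩) ih
  have h2 : LieSubalgebra.lieSpan k L (Set.range x) ≤ stab (wordSpan k x) := by
    rw [LieSubalgebra.lieSpan_le]
    rintro _ ⟨j, rfl⟩
    exact gen_mem_stab_wordSpan x j
  let W : LieSubalgebra k L :=
    { wordSpan k x with lie_mem' := fun {a b} ha hb => h2 (h1 ha) b hb }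
  have h3 : LieSubalgebra.lieSpan k L (Set.range x) ≤ W := by
    rw [LieSubalgebra.lieSpan_le]
    rintro _ ⟨j, rfl⟩
    exact word_mem_wordSpan x j []
  exact le_antisymm h3 h1

variable {𝔥 : Type*} [AddCommGroup 𝔥] [Module k 𝔥] (hc : 𝔥 →ₗ[k] L)

theorem lie_word_weight {x : I → L} {γ : I → Module.Dual k 𝔥}
    (hw : ∀ a i, ⁅hc a, x i⁆ = γ i a • x i) (a : 𝔥) (i : I) (l : List I) :
    ⁅hc a, word x i l⁆ = ((i :: l).map γ).sum a • word x i l := by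
  induction l with
  | nil => simpa [word] using hw a i
  | cons j l ih =>
    rw [word_cons, leibniz_lie, hw, ih, smul_lie, lie_smul, ← add_smul]
    congr 1
    simp only [List.map_cons, List.sum_cons, LinearMap.add_apply]
    ring

theorem lie_cartan_wordSpan {x : I → L} {γ : I → Module.Dual k 𝔥}
    (hw : ∀ a i, ⁅hc a, x i⁆ = γ i a • x i) (a : 𝔥) {z : L} (hz : z ∈ wordSpan k x) :
    ⁅hc a, z⁆ ∈ wordSpan k x :=
  lie_wordSpan_mem (fun i l => by
    rw [lie_word_weight hc hw]
    exact Submodule.smul_mem _ _ (word_mem_wordSpan x i l)) hz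

theorem lie_gen_cartan {x : I → L} {γ : I → Module.Dual k 𝔥}
    (hw : ∀ a i, ⁅hc a, x i⁆ = γ i a • x i) (a : 𝔥) (i : I) :
    ⁅x i, hc a⁆ ∈ wordSpan k x := by
  rw [← lie_skew, hw]
  exact neg_mem (Submodule.smul_mem _ _ (word_mem_wordSpan x i []))

/-- If `⁅y i, x j⁆` lies in the Cartan subalgebra for all `i`, `j`, then bracketing with `y i` sends
the subalgebra generated by the `x j` into its sum with the Cartan subalgebra. -/
theorem lie_opposite_wordSpan {x y : I → L} {γ : I → Module.Dual k 𝔥}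
    (hw : ∀ a i, ⁅hc a, x i⁆ = γ i a • x i)
    (hxy : ∀ i j, ⁅y i, x j⁆ ∈ LinearMap.range hc) (i : I) {z : L} (hz : z ∈ wordSpan k x) :
    ⁅y i, z⁆ ∈ wordSpan k x ⊔ LinearMap.range hc := by
  refine lie_wordSpan_mem (fun j l => ?_) hz
  induction l with
  | nil => exact Submodule.mem_sup_right (hxy i j)
  | cons m l ih =>
    rw [word_cons, leibniz_lie]
    apply Submodule.mem_sup_left
    refine add_mem ?_ ?_
    · obtain ⟨a, ha⟩ := hxy i m
      rw [← ha]
      exact lie_cartan_wordSpan hc hw a (word_mem_wordSpan x j l)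
    · obtain ⟨p, hp, q, ⟨a, rfl⟩, hpq⟩ := Submodule.mem_sup.mp ih
      rw [← hpq, lie_add]
      exact add_mem (gen_mem_stab_wordSpan x m p hp) (lie_gen_cartan hc hw a m)

/-- Triangular decomposition. -/
theorem sup_wordSpan_eq_top {x y : I → L} {γ : I → Module.Dual k 𝔥}
    (hw : ∀ a i, ⁅hc a, x i⁆ = γ i a • x i) (hw' : ∀ a i, ⁅hc a, y i⁆ = -γ i a • y i)
    (hh : ∀ a c, ⁅hc a, hc c⁆ = 0) (hxy : ∀ i j, ⁅y i, x j⁆ ∈ LinearMap.range hc)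
    (hgen : LieSubalgebra.lieSpan k L (Set.range x ∪ Set.range y ∪ Set.range hc) = ⊤) :
    wordSpan k x ⊔ (LinearMap.range hc ⊔ wordSpan k y) = ⊤ := by
  set T := wordSpan k x ⊔ (LinearMap.range hc ⊔ wordSpan k y) with hT
  have hx : wordSpan k x ≤ T := le_sup_left
  have hc' : LinearMap.range hc ≤ T := le_sup_left.trans le_sup_right
  have hy : wordSpan k y ≤ T := le_sup_right.trans le_sup_right
  have hw'' : ∀ a i, ⁅hc a, y i⁆ = (-γ) i a • y i := hw'
  have key : ∀ g : L, (∀ z ∈ wordSpan k x, ⁅g, z⁆ ∈ T) → (∀ a, ⁅g, hc a⁆ ∈ T) →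
      (∀ z ∈ wordSpan k y, ⁅g, z⁆ ∈ T) → g ∈ stab T := by
    intro g h1 h2 h3 z hz
    obtain ⟨p, hp, q, hq, rfl⟩ := Submodule.mem_sup.mp hz
    obtain ⟨_, ⟨a, rfl⟩, r, hr, rfl⟩ := Submodule.mem_sup.mp hq
    rw [lie_add, lie_add]
    exact add_mem (h1 p hp) (add_mem (h2 a) (h3 r hr))
  have hyx : ∀ i j, ⁅x i, y j⁆ ∈ LinearMap.range hc := fun i j => by
    rw [← lie_skew]; exact neg_mem (hxy j i)
  have htop : stab T = ⊤ := by
    rw [eq_top_iff, ← hgen, LieSubalgebra.lieSpan_le]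
    rintro _ ((⟨i, rfl⟩ | ⟨i, rfl⟩) | ⟨a, rfl⟩)
    · refine key _ (fun z hz => hx (gen_mem_stab_wordSpan x i z hz))
        (fun a => hx (lie_gen_cartan hc hw a i)) fun z hz => ?_
      exact (sup_le hy hc') (lie_opposite_wordSpan hc hw'' hyx i hz)
    · refine key _ (fun z hz => (sup_le hx hc') (lie_opposite_wordSpan hc hw hxy i hz))
        (fun a => hy (lie_gen_cartan hc hw'' a i))
        fun z hz => hy (gen_mem_stab_wordSpan y i z hz)
    · exact key _ (fun z hz => hx (lie_cartan_wordSpan hc hw a hz))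
        (fun c => by rw [hh]; exact zero_mem _)
        fun z hz => hy (lie_cartan_wordSpan hc hw'' a hz)
  let T' : LieSubalgebra k L :=
    { T with lie_mem' := fun {a b} _ hb => (htop ▸ LieSubalgebra.mem_top a : a ∈ stab T) b hb }
  have h3 : T' = ⊤ := by
    rw [eq_top_iff, ← hgen, LieSubalgebra.lieSpan_le]
    rintro _ ((⟨i, rfl⟩ | ⟨i, rfl⟩) | ⟨a, rfl⟩)
    · exact hx (word_mem_wordSpan x i [])
    · exact hy (word_mem_wordSpan y i [])
    · exact hc' ⟨a, rfl⟩
  exact congrArg LieSubalgebra.toSubmodule h3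

theorem word_mem_eigenspace {x : I → L} {d : L} {c : k} (h : ∀ i, ⁅d, x i⁆ = c • x i) (i : I)
    (l : List I) : word x i l ∈
      Module.End.eigenspace (LieAlgebra.ad k L d) (((l.length : ℕ) + 1 : k) * c) := by
  rw [Module.End.mem_eigenspace_iff, LieAlgebra.ad_apply]
  induction l with
  | nil => simpa [word] using h i
  | cons j l ih =>
    rw [word_cons, leibniz_lie, h, ih, smul_lie, lie_smul, ← add_smul, List.length_cons]
    congr 1
    push_cast
    ring

theorem wordSpan_le_iSup {x : I → L} {d : L} {c : k} (h : ∀ i, ⁅d, x i⁆ = c • x i) :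
    wordSpan k x ≤ ⨆ z ∈ {z : k | ∃ n : ℕ, z = (n + 1 : k) * c},
      Module.End.eigenspace (LieAlgebra.ad k L d) z := by
  rw [wordSpan, Submodule.span_le]
  rintro _ ⟨⟨i, l⟩, rfl⟩
  exact (le_biSup (Module.End.eigenspace (LieAlgebra.ad k L d))
    (show _ ∈ {z : k | ∃ n : ℕ, z = (n + 1 : k) * c} from ⟨l.length, rfl⟩))
    (word_mem_eigenspace h i l)

end Words

/-! ### Spaces with a basis of weight vectors -/

section Weights

variable {V 𝔥 κ : Type*} [AddCommGroup V] [Module ℂ V] [AddCommGroup 𝔥] [Module ℂ 𝔥]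
  {T : 𝔥 → V →ₗ[ℂ] V} {b : Module.Basis κ ℂ V} {wt : κ → Module.Dual ℂ 𝔥}

theorem weight_eq_span (hb : ∀ y i, T y (b i) = wt i y • b i) {μ : Module.Dual ℂ 𝔥}
    {P : Submodule ℂ V} (hP : ∀ v, v ∈ P ↔ ∀ y, T y v = μ y • v) :
    P = Submodule.span ℂ (Set.range fun i : {i // wt i = μ} => b i) := by
  have hr : (Set.range fun i : {i // wt i = μ} => b i) = b '' {i | wt i = μ} := by
    ext v; simp
  apply le_antisymm
  · intro v hv
    rw [hr, Module.Basis.mem_span_image]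
    intro i hi
    by_contra hne
    obtain ⟨y, hy⟩ : ∃ y, wt i y ≠ μ y := by
      by_contra! h
      exact hne (LinearMap.ext h)
    have h1 := (hP v).mp hv y
    have h2 : b.repr (T y v) i = wt i y * b.repr v i := by
      have : (Finsupp.lapply i).comp (b.repr.toLinearMap.comp (T y)) =
          wt i y • (Finsupp.lapply i).comp b.repr.toLinearMap := by
        refine b.ext fun j => ?_
        simp only [LinearMap.comp_apply, LinearEquiv.coe_coe, hb, map_smul, LinearMap.smul_apply,
          Finsupp.lapply_apply, Module.Basis.repr_self]
        by_cases hij : j = i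
        · rw [hij]
        · simp [hij]
      exact LinearMap.congr_fun this v
    rw [h1, map_smul, Finsupp.smul_apply, smul_eq_mul] at h2
    have h3 : (wt i y - μ y) * b.repr v i = 0 := by rw [sub_mul, h2, sub_self]
    rcases mul_eq_zero.mp h3 with h | h
    · exact hy (sub_eq_zero.mp h)
    · exact Finsupp.mem_support_iff.mp hi h
  · rw [Submodule.span_le]
    rintro _ ⟨i, rfl⟩
    rw [SetLike.mem_coe, hP]
    intro y
    rw [hb, i.2]

theorem weight_finrank (hb : ∀ y i, T y (b i) = wt i y • b i) {μ : Module.Dual ℂ 𝔥}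
    {P : Submodule ℂ V} (hP : ∀ v, v ∈ P ↔ ∀ y, T y v = μ y • v) :
    Module.finrank ℂ P = Nat.card {i // wt i = μ} := by
  rw [weight_eq_span hb hP]
  exact Module.finrank_eq_nat_card_basis
    (Module.Basis.span (b.linearIndependent.comp _ Subtype.val_injective))

theorem weight_finite (hb : ∀ y i, T y (b i) = wt i y • b i) {μ : Module.Dual ℂ 𝔥}
    {P : Submodule ℂ V} (hP : ∀ v, v ∈ P ↔ ∀ y, T y v = μ y • v)
    (hfin : {i | wt i = μ}.Finite) : FiniteDimensional ℂ P := by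
  rw [weight_eq_span hb hP]
  have : Finite {i // wt i = μ} := hfin
  exact FiniteDimensional.span_of_finite ℂ (Set.finite_range _)

end Weights

end KacMoody

/-! ### The structure of a Kac–Moody algebra -/

noncomputable section

set_option linter.unusedSectionVars false

namespace KacMoody

attribute [local instance 100] LieRing.ofAssociativeRing

universe u v w

variable {I : Type u} [Fintype I] [DecidableEq I] {A : Matrix I I ℤ}
  {𝔥 : Type v} [AddCommGroup 𝔥] [Module ℂ 𝔥] [FiniteDimensional ℂ 𝔥]
  {R : Realization A 𝔥} {𝔤 : Type w} [LieRing 𝔤] [LieAlgebra ℂ 𝔤]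

namespace Realization

theorem rootSum_add (R : Realization A 𝔥) (β γ : I →₀ ℕ) :
    R.rootSum (β + γ) = R.rootSum β + R.rootSum γ := by
  simp [rootSum, add_smul, Finset.sum_add_distrib]

theorem rootSum_zero (R : Realization A 𝔥) : R.rootSum 0 = 0 := by simp [rootSum]

theorem rootSum_single (R : Realization A 𝔥) (i : I) (n : ℕ) :
    R.rootSum (Finsupp.single i n) = (n : ℂ) • R.root i := by
  rw [rootSum, Finset.sum_eq_single i]
  · simp
  · intro j _ hj
    rw [Finsupp.single_eq_of_ne hj]
    simp
  · simp

theorem rootSum_add_injective (R : Realization A 𝔥) {β γ : I →₀ ℕ}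
    (h : R.rootSum β = R.rootSum γ) : β = γ := by
  have h1 : ∑ i, ((β i : ℂ) - γ i) • R.root i = 0 := by
    simp only [sub_smul, Finset.sum_sub_distrib]
    exact sub_eq_zero.mpr h
  have h2 := Fintype.linearIndependent_iff.mp R.root_linearIndependent _ h1
  ext i
  exact_mod_cast sub_eq_zero.mp (h2 i)

/-- A sum of positive roots vanishes only trivially. -/
theorem eq_zero_of_rootSum_eq_neg (R : Realization A 𝔥) {β γ : I →₀ ℕ}
    (h : R.rootSum β = -R.rootSum γ) : β = 0 ∧ γ = 0 := by
  have h1 : β + γ = 0 := R.rootSum_add_injective (by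
    rw [rootSum_add, h, neg_add_cancel, rootSum_zero])
  exact add_eq_zero.mp h1

/-- The resulting element of `𝔥` defines the principal grading of `𝔤`. -/
theorem exists_root_eq_one (R : Realization A 𝔥) : ∃ y : 𝔥, ∀ i, R.root i y = 1 := by
  obtain ⟨g, hg⟩ := LinearMap.exists_leftInverse_of_injective
    (Fintype.linearCombination ℂ R.root)
    (LinearMap.ker_eq_bot.mpr (R.root_linearIndependent.fintypeLinearCombination_injective))
  classical
  let φ : Module.Dual ℂ (Module.Dual ℂ 𝔥) := (∑ i, LinearMap.proj i : (I → ℂ) →ₗ[ℂ] ℂ).comp g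
  refine ⟨(Module.evalEquiv ℂ 𝔥).symm φ, fun i => ?_⟩
  rw [Module.apply_evalEquiv_symm_apply]
  have h1 : Fintype.linearCombination ℂ R.root (Pi.single i 1) = R.root i := by
    simp [Fintype.linearCombination_apply_single]
  have h2 := LinearMap.congr_fun hg (Pi.single i 1)
  rw [LinearMap.comp_apply, h1] at h2
  rw [LinearMap.comp_apply, h2]
  simp

end Realization

namespace KMAlgebra

variable (K : KMAlgebra R 𝔤)

theorem proj_rel {z : R.Free} (h : R.Rel z) : K.proj (R.toTilde z) = 0 := by
  have h0 : R.toTilde z = 0 :=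
    (LieSubmodule.Quotient.mk_eq_zero (N := R.relIdeal)).mpr (LieSubmodule.subset_lieSpan h)
  rw [h0, map_zero]

/-- The embedding of the Cartan subalgebra, as a linear map. -/
def hLin : 𝔥 →ₗ[ℂ] 𝔤 :=
  have key : ∀ (c : ℂ) (x y : 𝔥), K.h (c • x + y) = c • K.h x + K.h y := fun c x y => by
    have := K.proj_rel (.linear c x y)
    simp only [map_sub, map_add, map_smul, sub_eq_zero] at this
    exact this
  have h0 : K.h 0 = 0 := by simpa using key 1 0 0
  { toFun := K.h
    map_add' := fun x y => by simpa using key 1 x y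
    map_smul' := fun c x => by simpa [h0] using key c x 0 }

theorem hLin_apply (x : 𝔥) : K.hLin x = K.h x := rfl

theorem hLin_injective : Function.Injective K.hLin :=
  (injective_iff_map_eq_zero _).mpr K.cartan_trivial

theorem lie_h_h (x y : 𝔥) : ⁅K.h x, K.h y⁆ = 0 := by
  have := K.proj_rel (.hh x y)
  simp only [LieHom.map_lie] at this
  exact this

theorem lie_h_e (x : 𝔥) (i : I) : ⁅K.h x, K.e i⁆ = R.root i x • K.e i := by
  have := K.proj_rel (.he x i)
  simp only [LieHom.map_lie, map_sub, map_smul, sub_eq_zero] at this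
  exact this

theorem lie_h_f (x : 𝔥) (i : I) : ⁅K.h x, K.f i⁆ = -R.root i x • K.f i := by
  have := K.proj_rel (.hf x i)
  simp only [LieHom.map_lie, map_add, map_smul] at this
  rw [neg_smul]
  exact eq_neg_of_add_eq_zero_left this

theorem lie_e_f (i : I) : ⁅K.e i, K.f i⁆ = K.h (R.coroot i) := by
  have := K.proj_rel (.ef i)
  simp only [LieHom.map_lie, map_sub, sub_eq_zero] at this
  exact this

theorem lie_e_f_ne {i j : I} (h : i ≠ j) : ⁅K.e i, K.f j⁆ = 0 := by
  have := K.proj_rel (.ef_ne i j h)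
  simp only [LieHom.map_lie] at this
  exact this

theorem lie_e_f_mem (i j : I) : ⁅K.e i, K.f j⁆ ∈ LinearMap.range K.hLin := by
  by_cases h : i = j
  · subst h; exact ⟨_, (K.lie_e_f i).symm⟩
  · rw [K.lie_e_f_ne h]; exact zero_mem _

theorem lie_f_f {i j : I} (hij : A i j = 0) (hne : i ≠ j) : ⁅K.f i, K.f j⁆ = 0 := by
  have := K.proj_rel (.serreF i j hne)
  simp only [hij, sub_zero, Int.toNat_one, pow_one, LieAlgebra.ad_apply, LieHom.map_lie] at this
  exact this

/-- The Chevalley generators generate. -/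
theorem lieSpan_generators :
    LieSubalgebra.lieSpan ℂ 𝔤 (Set.range K.f ∪ Set.range K.e ∪ Set.range K.hLin) = ⊤ := by
  set S := LieSubalgebra.lieSpan ℂ 𝔤 (Set.range K.f ∪ Set.range K.e ∪ Set.range K.hLin)
  have hS : Set.range K.f ∪ Set.range K.e ∪ Set.range K.hLin ⊆ S := LieSubalgebra.subset_lieSpan
  let g : Gen I 𝔥 → S := fun x => match x with
    | .E i => ⟨K.e i, hS (Or.inl (Or.inr ⟨i, rfl⟩))⟩
    | .F i => ⟨K.f i, hS (Or.inl (Or.inl ⟨i, rfl⟩))⟩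
    | .H y => ⟨K.h y, hS (Or.inr ⟨y, rfl⟩)⟩
  have h : S.incl.comp (FreeLieAlgebra.lift ℂ g) = K.proj.comp R.toTilde := by
    apply FreeLieAlgebra.hom_ext
    intro x
    rw [LieHom.comp_apply, FreeLieAlgebra.lift_of_apply]
    cases x <;> rfl
  rw [eq_top_iff]
  intro x _
  obtain ⟨y, rfl⟩ := K.proj_surjective x
  obtain ⟨z, rfl⟩ := LieSubmodule.Quotient.surjective_mk' (N := R.relIdeal) y
  have h2 := LieHom.congr_fun h z
  rw [show K.proj (LieSubmodule.Quotient.mk' R.relIdeal z) = (K.proj.comp R.toTilde) z from rfl,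
    ← h2]
  exact (FreeLieAlgebra.lift ℂ g z).2

theorem nMinus_toSubmodule : K.nMinus.toSubmodule = wordSpan ℂ K.f := lieSpan_toSubmodule K.f

/-- The subalgebra `𝔟 = 𝔥 ⊕ 𝔫⁺`. -/
def borel : LieSubalgebra ℂ 𝔤 :=
  { LinearMap.range K.hLin ⊔ wordSpan ℂ K.e with
    lie_mem' := fun {a b} ha hb => by
      obtain ⟨_, ⟨x, rfl⟩, p, hp, rfl⟩ := Submodule.mem_sup.mp ha
      obtain ⟨_, ⟨y, rfl⟩, q, hq, rfl⟩ := Submodule.mem_sup.mp hb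
      apply Submodule.mem_sup_right
      rw [add_lie, lie_add, lie_add, K.hLin_apply, K.hLin_apply, K.lie_h_h, zero_add]
      have hn : ∀ r ∈ wordSpan ℂ K.e, ∀ s ∈ wordSpan ℂ K.e, ⁅r, s⁆ ∈ wordSpan ℂ K.e := by
        rw [← lieSpan_toSubmodule]
        exact fun r hr s hs => LieSubalgebra.lie_mem _ hr hs
      refine add_mem (lie_cartan_wordSpan K.hLin K.lie_h_e x hq) (add_mem ?_ (hn p hp q hq))
      rw [← lie_skew]
      exact neg_mem (lie_cartan_wordSpan K.hLin K.lie_h_e y hp) }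

theorem borel_toSubmodule :
    K.borel.toSubmodule = LinearMap.range K.hLin ⊔ wordSpan ℂ K.e := rfl

/-- The sum `𝔫⁻ + 𝔥 + 𝔫⁺` is direct, as the summands are distinguished by the principal
grading. -/
theorem disjoint_triangular : Disjoint (wordSpan ℂ K.f) (LinearMap.range K.hLin ⊔ wordSpan ℂ K.e) ∧
    Disjoint (LinearMap.range K.hLin) (wordSpan ℂ K.e) := by
  -- eigenvalues of an element of `𝔥` at which all simple roots take the value `1`
  obtain ⟨y, hy⟩ := R.exists_root_eq_one
  set E := Module.End.eigenspace (LieAlgebra.ad ℂ 𝔤 (K.h y))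
  have hind : iSupIndep E := Module.End.eigenspaces_iSupIndep _
  have hf : wordSpan ℂ K.f ≤ ⨆ z ∈ {z : ℂ | ∃ n : ℕ, z = (n + 1 : ℂ) * (-1)}, E z :=
    wordSpan_le_iSup fun i => by rw [K.lie_h_f, hy]
  have he : wordSpan ℂ K.e ≤ ⨆ z ∈ {z : ℂ | ∃ n : ℕ, z = (n + 1 : ℂ) * 1}, E z :=
    wordSpan_le_iSup fun i => by rw [K.lie_h_e, hy]
  have hh : LinearMap.range K.hLin ≤ ⨆ z ∈ ({0} : Set ℂ), E z := by
    rintro _ ⟨x, rfl⟩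
    rw [iSup_singleton, Module.End.mem_eigenspace_iff, LieAlgebra.ad_apply, zero_smul]
    exact K.lie_h_h y x
  have hhe : LinearMap.range K.hLin ⊔ wordSpan ℂ K.e ≤
      ⨆ z ∈ {0} ∪ {z : ℂ | ∃ n : ℕ, z = (n + 1 : ℂ) * 1}, E z := by
    rw [iSup_union]
    exact sup_le_sup hh he
  constructor
  · refine (hind.disjoint_biSup_biSup ?_).mono hf hhe
    rw [Set.disjoint_left]
    rintro z ⟨n, rfl⟩ (h | ⟨m, h⟩)
    · have := congrArg Complex.re h
      simp at this
      have hn : (0 : ℝ) ≤ n := n.cast_nonneg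
      linarith
    · have := congrArg Complex.re h
      simp at this
      have hn : (0 : ℝ) ≤ n := n.cast_nonneg
      have hm : (0 : ℝ) ≤ m := m.cast_nonneg
      linarith
  · refine (hind.disjoint_biSup_biSup ?_).mono hh he
    rw [Set.disjoint_left]
    rintro z h ⟨n, hn⟩
    rw [h] at hn
    have := congrArg Complex.re hn
    simp at this
    have hn : (0 : ℝ) ≤ n := n.cast_nonneg
    linarith

theorem isCompl_nMinus_borel : IsCompl K.nMinus.toSubmodule K.borel.toSubmodule := by
  rw [nMinus_toSubmodule, borel_toSubmodule]
  refine ⟨K.disjoint_triangular.1, codisjoint_iff.mpr ?_⟩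
  exact sup_wordSpan_eq_top K.hLin (γ := fun i => -R.root i) K.lie_h_f
    (fun a i => by
      rw [LinearMap.neg_apply, neg_neg]; exact K.lie_h_e a i)
    K.lie_h_h K.lie_e_f_mem K.lieSpan_generators

theorem h_mem_borel (x : 𝔥) : K.h x ∈ K.borel := Submodule.mem_sup_left ⟨x, rfl⟩

theorem e_mem_borel (i : I) : K.e i ∈ K.borel :=
  Submodule.mem_sup_right (word_mem_wordSpan K.e i [])

/-- A weight `μ` extends to a character of `𝔟` which vanishes on `𝔫⁺`. -/
theorem exists_character (μ : Module.Dual ℂ 𝔥) : ∃ χ : K.borel →ₗ⁅ℂ⁆ ℂ,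
    (∀ x, χ ⟨K.h x, K.h_mem_borel x⟩ = μ x) ∧ ∀ i, χ ⟨K.e i, K.e_mem_borel i⟩ = 0 := by
  obtain ⟨g, hg⟩ := LinearMap.exists_leftInverse_of_injective
    ((wordSpan ℂ K.e).mkQ.comp K.hLin) (by
      rw [LinearMap.ker_comp, Submodule.ker_mkQ, Submodule.eq_bot_iff]
      intro x hx
      have := Submodule.disjoint_def.mp K.disjoint_triangular.2 (K.hLin x) ⟨x, rfl⟩ hx
      exact K.hLin_injective (this.trans (map_zero _).symm))
  let χ₀ : 𝔤 →ₗ[ℂ] ℂ := μ.comp (g.comp (wordSpan ℂ K.e).mkQ)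
  have hn : ∀ z ∈ wordSpan ℂ K.e, χ₀ z = 0 := fun z hz => by
    simp only [χ₀, LinearMap.comp_apply, Submodule.mkQ_apply,
      (Submodule.Quotient.mk_eq_zero _).mpr hz, map_zero]
  have hbr : ∀ a ∈ K.borel, ∀ b ∈ K.borel, χ₀ ⁅a, b⁆ = 0 := by
    intro a ha b hb
    obtain ⟨_, ⟨x, rfl⟩, p, hp, rfl⟩ := Submodule.mem_sup.mp ha
    obtain ⟨_, ⟨y, rfl⟩, q, hq, rfl⟩ := Submodule.mem_sup.mp hb
    rw [add_lie, lie_add, lie_add, K.hLin_apply, K.hLin_apply, K.lie_h_h, zero_add, map_add,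
      map_add, ← lie_skew p, map_neg]
    rw [hn ⁅K.h x, q⁆ (lie_cartan_wordSpan K.hLin K.lie_h_e x hq),
      hn ⁅K.h y, p⁆ (lie_cartan_wordSpan K.hLin K.lie_h_e y hp), neg_zero, zero_add, zero_add]
    apply hn
    rw [← lieSpan_toSubmodule] at hp hq ⊢
    exact LieSubalgebra.lie_mem _ hp hq
  refine ⟨{ χ₀.comp K.borel.subtype with
      map_lie' := fun {a b} => ?_ }, fun x => ?_, fun i => hn _ (word_mem_wordSpan K.e i [])⟩
  · rw [LieRing.of_associative_ring_bracket, mul_comm, sub_self]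
    exact hbr a a.2 b b.2
  · exact congrArg μ (LinearMap.congr_fun hg x)

/-- The element of the root lattice attached to a word in the simple roots. -/
def content (p : I × List I) : I →₀ ℕ := Multiset.toFinsupp (p.1 ::ₘ (p.2 : Multiset I))

theorem content_ne_zero (p : I × List I) : content p ≠ 0 := by
  intro h
  rw [content, map_eq_zero_iff _ (Multiset.toFinsupp.injective)] at h
  exact Multiset.cons_ne_zero h

theorem content_nil (i : I) : content (i, []) = Finsupp.single i 1 := by
  simp [content]

theorem finite_content (β : I →₀ ℕ) : {p : I × List I | content p = β}.Finite := by
  refine ((Set.finite_univ (α := I)).prod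
    (List.finite_length_le I (Multiset.card (Finsupp.toMultiset β)))).subset ?_
  rintro ⟨i, l⟩ hp
  refine ⟨trivial, ?_⟩
  have h1 : Finsupp.toMultiset β = i ::ₘ (l : Multiset I) := by
    rw [← (show content (i, l) = β from hp), content]
    exact Multiset.toFinsupp_toMultiset _
  change l.length ≤ _
  rw [h1]
  simp

theorem rootSum_content (p : I × List I) :
    R.rootSum (content p) = ((p.1 :: p.2).map R.root).sum := by
  have h : ∀ l : List I, R.rootSum (Multiset.toFinsupp (l : Multiset I)) =
      (l.map R.root).sum := by
    intro l
    induction l with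
    | nil => simp [Realization.rootSum_zero]
    | cons i l ih =>
      rw [← Multiset.cons_coe, ← Multiset.singleton_add, map_add, Realization.rootSum_add, ih,
        Multiset.toFinsupp_singleton, Realization.rootSum_single]
      simp
  exact h (p.1 :: p.2)

theorem word_f_mem (p : I × List I) : word K.f p.1 p.2 ∈ K.rootSpace (-R.rootSum (content p)) := by
  intro y
  have h := lie_word_weight K.hLin (γ := fun i => -R.root i) K.lie_h_f y p.1 p.2
  rw [rootSum_content]
  refine h.trans ?_
  congr 2
  induction (p.1 :: p.2) with
  | nil => simp
  | cons i l ih => simp [ih]; abel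

theorem word_e_mem (p : I × List I) : word K.e p.1 p.2 ∈ K.rootSpace (R.rootSum (content p)) := by
  intro y
  rw [rootSum_content]
  exact lie_word_weight K.hLin K.lie_h_e y p.1 p.2

theorem f_linearIndependent : LinearIndependent ℂ K.f := by
  rw [Fintype.linearIndependent_iff]
  intro c hc i
  have h1 : ⁅K.e i, ∑ j, c j • K.f j⁆ = c i • K.h (R.coroot i) := by
    rw [lie_sum, Finset.sum_eq_single i]
    · rw [lie_smul, K.lie_e_f]
    · intro j _ hj
      rw [lie_smul, K.lie_e_f_ne hj.symm, smul_zero]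
    · simp
  rw [hc, lie_zero] at h1
  rcases smul_eq_zero.mp h1.symm with h | h
  · exact h
  · exact absurd (K.cartan_trivial _ h) (R.coroot_linearIndependent.ne_zero i)

/-- An ordered basis of `𝔫⁻` which consists of iterated brackets of the `f_i` and contains the
`f_i` themselves; those with `i ∈ X` come last. -/
structure NegBasis (X : Set I) where
  /-- The index set. -/
  ι : Type u
  /-- The order of the basis. -/
  [ord : LinearOrder ι]
  /-- The basis. -/
  basis : Module.Basis ι ℂ K.nMinus
  /-- The basis vector `basis i` has weight `-wt i`. -/
  wt : ι → I →₀ ℕ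
  wt_ne_zero : ∀ i, wt i ≠ 0
  finite_wt : ∀ β, {i | wt i = β}.Finite
  basis_mem : ∀ i, (basis i : 𝔤) ∈ K.rootSpace (-R.rootSum (wt i))
  /-- The position of `f_i` in the basis. -/
  idx : I → ι
  idx_injective : Function.Injective idx
  basis_idx : ∀ i, (basis (idx i) : 𝔤) = K.f i
  wt_idx : ∀ i, wt (idx i) = Finsupp.single i 1
  isUpperSet : IsUpperSet (idx '' X)

attribute [instance] NegBasis.ord

theorem exists_negBasis (X : Set I) : Nonempty (K.NegBasis X) := by
  classical
  let v : I × List I → 𝔤 := fun p => word K.f p.1 p.2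
  have hs : LinearIndepOn ℂ v (Set.range fun i : I => (i, ([] : List I))) := by
    rw [linearIndepOn_range_iff (fun i j h => (Prod.ext_iff.mp h).1)]
    exact K.f_linearIndependent
  obtain ⟨B, -, hsB, hspan, hli⟩ := exists_linearIndepOn_extension hs (Set.subset_univ _)
  have hB : Submodule.span ℂ (Set.range fun p : B => v p) = K.nMinus.toSubmodule := by
    have h1 : (Set.range fun p : B => v p) = v '' B := by rw [Set.image_eq_range]
    rw [nMinus_toSubmodule, h1]
    apply le_antisymm
    · exact Submodule.span_mono (Set.image_subset_range v B)
    · rw [wordSpan, Submodule.span_le]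
      rintro _ ⟨p, rfl⟩
      exact hspan ⟨p, trivial, rfl⟩
  let b : Module.Basis B ℂ K.nMinus :=
    (Module.Basis.span hli).map (LinearEquiv.ofEq _ K.nMinus.toSubmodule hB)
  have hb : ∀ p : B, (b p : 𝔤) = v p := fun p => by
    simp only [b, Module.Basis.map_apply]
    exact congrArg Subtype.val (Module.Basis.span_apply hli p)
  let idx : I → B := fun i => ⟨(i, []), hsB ⟨i, rfl⟩⟩
  let ord₀ : LinearOrder B := linearOrderOfSTO WellOrderingRel
  -- the `f_i` with `i ∈ X` are put behind all other basis vectors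
  let key : B → Bool ×ₗ B := fun p => toLex (decide (p ∈ idx '' X), p)
  have hkey : Function.Injective key := fun p q h => (Prod.ext_iff.mp (toLex.injective h)).2
  let ord : LinearOrder B := @LinearOrder.lift' B _ _ key hkey
  refine ⟨{ ι := B, ord := ord, basis := b, wt := fun p => content p, idx := idx,
            wt_ne_zero := fun p => content_ne_zero _
            finite_wt := fun β => (finite_content β).preimage Subtype.val_injective.injOn
            basis_mem := fun p => by rw [hb]; exact K.word_f_mem p
            idx_injective := fun i j h => (Prod.ext_iff.mp (Subtype.ext_iff.mp h)).1
            basis_idx := fun i => hb _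
            wt_idx := content_nil
            isUpperSet := ?_ }⟩
  intro p q hpq hp
  by_contra hq
  have h1 : @LE.le (Bool ×ₗ B) (@Prod.Lex.instLE Bool B _ ord₀.toLE) (key p) (key q) := hpq
  rw [@Prod.Lex.le_iff] at h1
  have hp' : decide (p ∈ idx '' X) = true := decide_eq_true hp
  have hq' : decide (q ∈ idx '' X) = false := decide_eq_false hq
  simp only [key, ofLex_toLex, hp', hq'] at h1
  rcases h1 with h1 | h1
  · exact absurd h1 (by decide)
  · exact absurd h1.1 (by decide)

end KMAlgebra

end KacMoody

end

noncomputable section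

set_option linter.unusedSectionVars false

namespace KacMoody

attribute [local instance 100] LieRing.ofAssociativeRing

universe u v w

variable {I : Type u} [Fintype I] [DecidableEq I] {A : Matrix I I ℤ}
  {𝔥 : Type v} [AddCommGroup 𝔥] [Module ℂ 𝔥] [FiniteDimensional ℂ 𝔥]
  {R : Realization A 𝔥} {𝔤 : Type w} [LieRing 𝔤] [LieAlgebra ℂ 𝔤]

namespace KMAlgebra

variable (K : KMAlgebra R 𝔤)

/-! ### Root spaces -/

/-- The Borel subalgebra has a basis of weight vectors, with weights in the positive cone. -/
theorem exists_borelBasis : ∃ (κ : Type (max u v)) (b : Module.Basis κ ℂ K.borel)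
    (wt : κ → I →₀ ℕ), ∀ i, (b i : 𝔤) ∈ K.rootSpace (R.rootSum (wt i)) := by
  let x : 𝔥 ⊕ (I × List I) → 𝔤 := Sum.elim K.hLin fun p => word K.e p.1 p.2
  obtain ⟨B, -, -, hspan, hli⟩ := exists_linearIndepOn_extension (K := ℂ) (v := x)
    (linearIndepOn_empty ℂ x) (Set.subset_univ _)
  have hB : Submodule.span ℂ (Set.range fun p : B => x p) = K.borel.toSubmodule := by
    have h1 : (Set.range fun p : B => x p) = x '' B := by rw [Set.image_eq_range]
    have h2 : K.borel.toSubmodule = Submodule.span ℂ (Set.range x) := by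
      rw [borel_toSubmodule, Set.Sum.elim_range, Submodule.span_union, wordSpan,
        ← LinearMap.coe_range, Submodule.span_eq]
    rw [h1, h2]
    apply le_antisymm
    · exact Submodule.span_mono (Set.image_subset_range x B)
    · rw [Submodule.span_le, ← Set.image_univ]
      exact hspan
  refine ⟨B, (Module.Basis.span hli).map (LinearEquiv.ofEq _ K.borel.toSubmodule hB),
    fun p => Sum.elim (fun _ => 0) content p.1, fun p => ?_⟩
  have hp : (((Module.Basis.span hli).map (LinearEquiv.ofEq _ K.borel.toSubmodule hB) p :
      K.borel) : 𝔤) = x p := by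
    simp only [Module.Basis.map_apply]
    exact congrArg Subtype.val (Module.Basis.span_apply hli p)
  rw [hp]
  obtain ⟨y | q, _⟩ := p
  · intro z
    simp only [x, Sum.elim_inl, Realization.rootSum_zero, LinearMap.zero_apply, zero_smul]
    exact K.lie_h_h z y
  · exact K.word_e_mem q

variable {K}

/-- All of `𝔤_{-α}` lies in `𝔫⁻`, by the triangular decomposition. -/
theorem NegBasis.finiteDimensional_and_finrank_rootSpace {X : Set I} (B : K.NegBasis X)
    {β : I →₀ ℕ} (hβ : β ≠ 0) :
    FiniteDimensional ℂ (K.rootSpace (-R.rootSum β)) ∧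
      Module.finrank ℂ (K.rootSpace (-R.rootSum β)) = Nat.card {i // B.wt i = β} := by
  obtain ⟨κ, b, wt, hb⟩ := K.exists_borelBasis
  let e := PBW.sumBasis B.basis b K.isCompl_nMinus_borel
  let ω : B.ι ⊕ₗ κ → Module.Dual ℂ 𝔥 := fun x =>
    Sum.elim (fun i => -R.rootSum (B.wt i)) (fun j => R.rootSum (wt j)) (ofLex x)
  have he : ∀ y x, LieAlgebra.ad ℂ 𝔤 (K.h y) (e x) = ω x y • e x := by
    intro y x
    cases x using Lex.rec with
    | _ x =>
    rw [LieAlgebra.ad_apply]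
    rcases x with i | j
    · simp only [e, ω, PBW.sumBasis_inl]
      exact B.basis_mem i y
    · simp only [e, ω, PBW.sumBasis_inr]
      exact hb j y
  have hset : ∀ x, ω x = -R.rootSum β ↔ ∃ i, B.wt i = β ∧ x = toLex (Sum.inl i) := by
    intro x
    constructor
    · intro hx
      cases x using Lex.rec with
      | _ x =>
      rcases x with i | j
      · refine ⟨i, R.rootSum_add_injective ?_, rfl⟩
        exact neg_injective hx
      · exact absurd (R.eq_zero_of_rootSum_eq_neg (show R.rootSum (wt j) = _ from hx)).2 hβ
    · rintro ⟨i, hi, rfl⟩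
      exact congrArg (fun γ => -R.rootSum γ) hi
  refine ⟨weight_finite (T := fun y => LieAlgebra.ad ℂ 𝔤 (K.h y)) he (fun v => Iff.rfl) ?_, ?_⟩
  · refine ((B.finite_wt β).image fun i => toLex (Sum.inl i)).subset ?_
    intro x hx
    obtain ⟨i, hi, rfl⟩ := (hset x).mp hx
    exact ⟨i, hi, rfl⟩
  · rw [weight_finrank (T := fun y => LieAlgebra.ad ℂ 𝔤 (K.h y)) he (fun v => Iff.rfl)]
    symm
    refine Nat.card_congr (Equiv.ofBijective
      (fun i => ⟨toLex (Sum.inl i.1), (hset _).mpr ⟨i.1, i.2, rfl⟩⟩) ⟨?_, ?_⟩)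
    · intro i j h
      exact Subtype.ext (Sum.inl_injective (toLex.injective (Subtype.ext_iff.mp h)))
    · rintro ⟨x, hx⟩
      obtain ⟨i, hi, rfl⟩ := (hset x).mp hx
      exact ⟨⟨i, hi⟩, rfl⟩

variable (K)

theorem finrank_rootSpace_of_involution (hK : K.HasChevalleyInvolution) (β : I →₀ ℕ) :
    Module.finrank ℂ (K.rootSpace (R.rootSum β)) = K.mult β := by
  obtain ⟨ω, he, hf, hh⟩ := hK
  have hω : ∀ x, ω (ω x) = x := by
    let S : LieSubalgebra ℂ 𝔤 :=
      { LinearMap.eqLocus ((ω : 𝔤 →ₗ[ℂ] 𝔤).comp (ω : 𝔤 →ₗ[ℂ] 𝔤)) LinearMap.id with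
        lie_mem' := fun {a b} (ha : ω (ω a) = a) (hb : ω (ω b) = b) => by
          change ω (ω ⁅a, b⁆) = ⁅a, b⁆
          rw [LieHom.map_lie, LieHom.map_lie, ha, hb] }
    have hS : S = ⊤ := by
      rw [eq_top_iff, ← K.lieSpan_generators, LieSubalgebra.lieSpan_le]
      rintro _ ((⟨i, rfl⟩ | ⟨i, rfl⟩) | ⟨a, rfl⟩)
      · change ω (ω (K.f i)) = K.f i
        rw [hf, map_neg, he, neg_neg]
      · change ω (ω (K.e i)) = K.e i
        rw [he, map_neg, hf, neg_neg]
      · change ω (ω (K.h a)) = K.h a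
        rw [hh, map_neg, hh, neg_neg]
    exact fun x => (hS ▸ LieSubalgebra.mem_top x : x ∈ S)
  have hmap : ∀ γ x, x ∈ K.rootSpace γ → ω x ∈ K.rootSpace (-γ) := by
    intro γ x hx y
    have h1 : K.h y = -ω (K.h y) := by rw [hh, neg_neg]
    rw [h1, neg_lie, ← LieHom.map_lie, hx y, map_smul, LinearMap.neg_apply, neg_smul]
  refine LinearEquiv.finrank_eq
    { toFun := fun x => ⟨ω x, hmap _ _ x.2⟩
      invFun := fun x => ⟨ω x, by simpa using hmap _ _ x.2⟩
      map_add' := fun x y => Subtype.ext (by simp)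
      map_smul' := fun c x => Subtype.ext (by simp)
      left_inv := fun x => Subtype.ext (hω x)
      right_inv := fun x => Subtype.ext (hω x) }

/-! ### Weight spaces of modules -/

section Weights

variable {V : Type*} [AddCommGroup V] [Module ℂ V] [Module K.U V] [IsScalarTower ℂ K.U V]

variable {K} in
theorem smul_mem_weightSpace {γ μ : Module.Dual ℂ 𝔥} {x : 𝔤} {v : V} (hx : x ∈ K.rootSpace γ)
    (hv : v ∈ K.weightSpace V μ) : K.ι x • v ∈ K.weightSpace V (μ + γ) := by
  intro y
  have h1 : K.ι (K.h y) * K.ι x = K.ι x * K.ι (K.h y) + γ y • K.ι x := by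
    rw [← map_smul, ← hx y, LieHom.map_lie, LieRing.of_associative_ring_bracket]
    abel
  have h2 : K.ι x • μ y • v = μ y • K.ι x • v := smul_comm _ _ _
  rw [← mul_smul, h1, add_smul, mul_smul, hv y, h2, smul_assoc, ← add_smul, LinearMap.add_apply]

variable {κ : Type*} (b : Module.Basis κ ℂ V) {wt : κ → Module.Dual ℂ 𝔥}
  (hb : ∀ i, b i ∈ K.weightSpace V (wt i))

include hb

theorem hasCharacter_of_basis (hfin : ∀ μ, {i | wt i = μ}.Finite) : K.HasCharacter V := by
  constructor
  · rw [eq_top_iff, ← b.span_eq, Submodule.span_le]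
    rintro _ ⟨i, rfl⟩
    exact Submodule.mem_iSup_of_mem (wt i) (hb i)
  · intro μ
    exact weight_finite (T := fun y => DistribSMul.toLinearMap ℂ V (K.ι (K.h y)))
      (fun y i => hb i y) (fun v => Iff.rfl) (hfin μ)

theorem ch_of_basis (μ : Module.Dual ℂ 𝔥) : K.ch V μ = Nat.card {i // wt i = μ} := by
  rw [ch, weight_finrank (T := fun y => DistribSMul.toLinearMap ℂ V (K.ι (K.h y)))
      (fun y i => hb i y) (fun v => Iff.rfl)]

end Weights

/-! ### Verma modules -/

theorem minusMap_eq : K.minusMap = PBW.inclMap K.nMinus := rfl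

theorem ι_e_smul_vermaVec (μ : Module.Dual ℂ 𝔥) (i : I) :
    K.ι (K.e i) • K.vermaVec μ = 0 := by
  rw [vermaVec, ← map_smul, smul_eq_mul, mul_one, Submodule.mkQ_apply,
    Submodule.Quotient.mk_eq_zero]
  exact Submodule.subset_span (Or.inl ⟨i, rfl⟩)

theorem vermaVec_mem (μ : Module.Dual ℂ 𝔥) : K.vermaVec μ ∈ K.weightSpace (K.Verma μ) μ := by
  intro x
  have h : (K.ι (K.h x) - algebraMap ℂ K.U (μ x)) • K.vermaVec μ = 0 := by
    rw [vermaVec, ← map_smul, smul_eq_mul, mul_one, Submodule.mkQ_apply,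
      Submodule.Quotient.mk_eq_zero]
    exact Submodule.subset_span (Or.inr ⟨x, rfl⟩)
  rw [sub_smul, sub_eq_zero, algebraMap_smul] at h
  exact h

/-- The universal property of Verma modules. -/
theorem exists_verma_hom {V : Type*} [AddCommGroup V] [Module ℂ V] [Module K.U V]
    [IsScalarTower ℂ K.U V] {μ : Module.Dual ℂ 𝔥} {v : V} (hv : v ∈ K.weightSpace V μ)
    (he : ∀ i, K.ι (K.e i) • v = 0) :
    ∃ φ : K.Verma μ →ₗ[K.U] V, φ (K.vermaVec μ) = v := by
  refine ⟨(K.vermaIdeal μ).liftQ (LinearMap.toSpanSingleton K.U V v) ?_, ?_⟩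
  · rw [vermaIdeal, Submodule.span_le]
    rintro _ (⟨i, rfl⟩ | ⟨x, rfl⟩)
    · exact he i
    · change (K.ι (K.h x) - algebraMap ℂ K.U (μ x)) • v = 0
      rw [sub_smul, algebraMap_smul, hv x, sub_self]
  · rw [vermaVec, Submodule.mkQ_apply, Submodule.liftQ_apply, LinearMap.toSpanSingleton_apply,
      one_smul]

/-- The map `U𝔫⁻ → M(μ)`, `c ↦ c m_μ`. -/
def vermaMap (μ : Module.Dual ℂ 𝔥) : K.UMinus →ₗ[ℂ] K.Verma μ where
  toFun c := K.minusMap c • K.vermaVec μ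
  map_add' c d := by rw [map_add, add_smul]
  map_smul' r c := by rw [map_smul, smul_assoc]; rfl

theorem vermaMap_apply (μ : Module.Dual ℂ 𝔥) (c : K.UMinus) :
    K.vermaMap μ c = K.minusMap c • K.vermaVec μ := rfl

theorem vermaMap_injective (μ : Module.Dual ℂ 𝔥) : Function.Injective (K.vermaMap μ) := by
  obtain ⟨χ, hχh, hχe⟩ := K.exists_character μ
  obtain ⟨φ, hφ1, hφ2⟩ := PBW.exists_inducedProj K.isCompl_nMinus_borel χ
  rw [injective_iff_map_eq_zero]
  intro c hc
  rw [vermaMap_apply, vermaVec, ← map_smul, smul_eq_mul, mul_one, Submodule.mkQ_apply,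
    Submodule.Quotient.mk_eq_zero] at hc
  have key : ∀ u ∈ K.vermaIdeal μ, ∀ a, φ (a * u) = 0 := by
    intro u hu
    rw [vermaIdeal] at hu
    induction hu using Submodule.span_induction with
    | mem x hx =>
      intro a
      rcases hx with ⟨i, rfl⟩ | ⟨x, rfl⟩
      · exact (hφ2 a ⟨K.e i, K.e_mem_borel i⟩).trans (by rw [hχe, zero_smul])
      · have h1 : φ (a * K.ι (K.h x)) = μ x • φ a :=
          (hφ2 a ⟨K.h x, K.h_mem_borel x⟩).trans (by rw [hχh])
        rw [mul_sub, map_sub, h1, ← Algebra.commutes, ← Algebra.smul_def, map_smul, sub_self]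
    | zero => simp
    | add x y _ _ hx hy => intro a; rw [mul_add, map_add, hx, hy, add_zero]
    | smul c x _ hx => intro a; rw [smul_eq_mul, ← mul_assoc, hx]
  rw [← hφ1 c]
  have h := key _ hc 1
  rwa [one_mul] at h

theorem word_e_smul_vermaVec (μ : Module.Dual ℂ 𝔥) {x : 𝔤} (hx : x ∈ wordSpan ℂ K.e) :
    K.ι x • K.vermaVec μ = 0 := by
  rw [wordSpan] at hx
  induction hx using Submodule.span_induction with
  | mem x hx =>
    obtain ⟨⟨i, l⟩, rfl⟩ := hx
    induction l with
    | nil => exact K.ι_e_smul_vermaVec μ i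
    | cons j l ih =>
      dsimp only at ih ⊢
      rw [word_cons, LieHom.map_lie, LieRing.of_associative_ring_bracket, sub_smul, mul_smul,
        mul_smul, ih, K.ι_e_smul_vermaVec, smul_zero, smul_zero, sub_zero]
  | zero => rw [map_zero, zero_smul]
  | add x y _ _ hx hy => rw [map_add, add_smul, hx, hy, add_zero]
  | smul c x _ hx => rw [map_smul, smul_assoc, hx, smul_zero]

theorem borel_smul_vermaVec (μ : Module.Dual ℂ 𝔥) (x : K.borel) :
    ∃ c : ℂ, K.ι (x : 𝔤) • K.vermaVec μ = c • K.vermaVec μ := by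
  obtain ⟨x, hx⟩ := x
  obtain ⟨_, ⟨y, rfl⟩, p, hp, rfl⟩ := Submodule.mem_sup.mp hx
  refine ⟨μ y, ?_⟩
  rw [map_add, add_smul, K.word_e_smul_vermaVec μ hp, add_zero]
  exact K.vermaVec_mem μ y

theorem inclMap_borel_smul_vermaVec (μ : Module.Dual ℂ 𝔥)
    (d : UniversalEnvelopingAlgebra ℂ K.borel) :
    PBW.inclMap K.borel d • K.vermaVec μ ∈ Submodule.span ℂ {K.vermaVec μ} := by
  let P : Submodule ℂ (UniversalEnvelopingAlgebra ℂ K.borel) :=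
    { carrier := {d | PBW.inclMap K.borel d • K.vermaVec μ ∈ Submodule.span ℂ {K.vermaVec μ}}
      add_mem' := fun {a b} ha hb => by
        rw [Set.mem_ofPred_eq, map_add, add_smul]; exact add_mem ha hb
      zero_mem' := by rw [Set.mem_ofPred_eq, map_zero, zero_smul]; exact zero_mem _
      smul_mem' := fun c a ha => by
        rw [Set.mem_ofPred_eq, map_smul, smul_assoc]; exact Submodule.smul_mem _ c ha }
  refine PBW.mem_of_stable P ?_ ?_ d
  · change PBW.inclMap K.borel 1 • K.vermaVec μ ∈ Submodule.span ℂ {K.vermaVec μ}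
    rw [map_one, one_smul]
    exact Submodule.mem_span_singleton_self _
  · intro x u hu
    obtain ⟨c, hc⟩ := Submodule.mem_span_singleton.mp hu
    obtain ⟨r, hr⟩ := K.borel_smul_vermaVec μ x
    change PBW.inclMap K.borel (UniversalEnvelopingAlgebra.ι ℂ x * u) • K.vermaVec μ ∈
      Submodule.span ℂ {K.vermaVec μ}
    have h1 : K.ι (x : 𝔤) • c • K.vermaVec μ = c • K.ι (x : 𝔤) • K.vermaVec μ :=
      smul_comm _ _ _
    rw [map_mul, PBW.inclMap_ι, mul_smul, ← hc]
    refine Submodule.mem_span_singleton.mpr ⟨c * r, ?_⟩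
    rw [mul_smul, ← hr]
    exact h1.symm

theorem vermaMap_surjective (μ : Module.Dual ℂ 𝔥) : Function.Surjective (K.vermaMap μ) := by
  intro v
  obtain ⟨u, rfl⟩ := (K.vermaIdeal μ).mkQ_surjective v
  let P : Submodule ℂ K.U :=
    (LinearMap.range (K.vermaMap μ)).comap ((K.vermaIdeal μ).mkQ.restrictScalars ℂ)
  refine PBW.mem_of_mul_mem K.isCompl_nMinus_borel P (fun c d => ?_) u
  obtain ⟨r, hr⟩ := Submodule.mem_span_singleton.mp (K.inclMap_borel_smul_vermaVec μ d)
  refine ⟨r • c, ?_⟩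
  change _ = (K.vermaIdeal μ).mkQ _
  rw [map_smul, vermaMap_apply, ← smul_comm, hr, ← mul_smul, minusMap_eq, vermaVec, ← map_smul,
    smul_eq_mul, mul_one]

/-- `M(μ)` is free of rank one over `U𝔫⁻`. -/
def vermaEquiv (μ : Module.Dual ℂ 𝔥) : K.UMinus ≃ₗ[ℂ] K.Verma μ :=
  LinearEquiv.ofBijective (K.vermaMap μ) ⟨K.vermaMap_injective μ, K.vermaMap_surjective μ⟩

theorem vermaEquiv_apply (μ : Module.Dual ℂ 𝔥) (c : K.UMinus) :
    K.vermaEquiv μ c = K.minusMap c • K.vermaVec μ := rfl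

namespace NegBasis

variable {K} {X : Set I} (B : K.NegBasis X)

/-- The basis of `M(μ)` consisting of the ordered monomials in the basis of `𝔫⁻`, applied to the
highest weight vector. -/
def vermaBasis (μ : Module.Dual ℂ 𝔥) : Module.Basis (Multiset B.ι) ℂ (K.Verma μ) :=
  (PBW.basis B.basis).map (K.vermaEquiv μ)

theorem vermaBasis_apply (μ : Module.Dual ℂ 𝔥) (M : Multiset B.ι) :
    B.vermaBasis μ M = K.minusMap (PBW.mono B.basis M) • K.vermaVec μ := by
  rw [vermaBasis, Module.Basis.map_apply, PBW.basis_apply, vermaEquiv_apply]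

theorem vermaBasis_zero (μ : Module.Dual ℂ 𝔥) : B.vermaBasis μ 0 = K.vermaVec μ := by
  rw [vermaBasis_apply, PBW.mono_zero, map_one, one_smul]

/-- The monomial `M` has weight `-wtSum M`. -/
def wtSum (M : Multiset B.ι) : I →₀ ℕ := (M.map B.wt).sum

theorem wtSum_add (M N : Multiset B.ι) : B.wtSum (M + N) = B.wtSum M + B.wtSum N := by
  rw [wtSum, Multiset.map_add, Multiset.sum_add, wtSum, wtSum]

theorem vermaBasis_mem (μ : Module.Dual ℂ 𝔥) (M : Multiset B.ι) :
    B.vermaBasis μ M ∈ K.weightSpace (K.Verma μ) (μ - R.rootSum (B.wtSum M)) := by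
  induction M using PBW.min_induction with
  | h0 =>
    rw [vermaBasis_zero, wtSum, Multiset.map_zero, Multiset.sum_zero, Realization.rootSum_zero,
      sub_zero]
    exact K.vermaVec_mem μ
  | hc i N h ih =>
    rw [vermaBasis_apply] at ih ⊢
    rw [PBW.mono_cons _ h, map_mul, mul_smul, minusMap_eq, PBW.inclMap_ι]
    have := smul_mem_weightSpace (B.basis_mem i) ih
    rwa [sub_add, sub_neg_eq_add, ← Realization.rootSum_add, add_comm,
      show B.wt i + B.wtSum N = B.wtSum (i ::ₘ N) by simp [wtSum]] at this

theorem card_le_degree (M : Multiset B.ι) : Multiset.card M ≤ (B.wtSum M).degree := by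
  induction M using Multiset.induction_on with
  | empty => simp
  | cons i M ih =>
    have h1 : B.wtSum (i ::ₘ M) = B.wt i + B.wtSum M := by simp [wtSum]
    have h2 : (B.wt i).degree ≠ 0 := by
      rw [Ne, Finsupp.degree_eq_zero_iff]; exact B.wt_ne_zero i
    rw [h1, map_add, Multiset.card_cons]
    omega

theorem finite_wtSum (β : I →₀ ℕ) : {M | B.wtSum M = β}.Finite := by
  classical
  have hS : {i | B.wt i ≤ β}.Finite := by
    have : {i | B.wt i ≤ β} = ⋃ γ ∈ Set.Iic β, {i | B.wt i = γ} := by ext; simp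
    rw [this]
    exact (Set.finite_Iic β).biUnion fun γ _ => B.finite_wt γ
  refine (Set.finite_Iic (β.degree • hS.toFinset.val)).subset fun M hM => ?_
  rw [Set.mem_ofPred_eq] at hM
  rw [Set.mem_Iic, Multiset.le_iff_count]
  intro i
  by_cases hi : i ∈ M
  · have h1 : B.wt i ≤ β := by
      rw [← hM, wtSum]
      exact Multiset.single_le_sum (fun _ _ => zero_le) _ (Multiset.mem_map_of_mem _ hi)
    rw [Multiset.count_nsmul, Multiset.count_eq_one_of_mem hS.toFinset.nodup (by simpa using h1),
      mul_one, ← hM]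
    exact (Multiset.count_le_card i M).trans (B.card_le_degree M)
  · rw [Multiset.count_eq_zero_of_notMem hi]; exact Nat.zero_le _

theorem finite_weight (lam μ : Module.Dual ℂ 𝔥) :
    {M | lam - R.rootSum (B.wtSum M) = μ}.Finite := by
  by_cases h : ∃ M, lam - R.rootSum (B.wtSum M) = μ
  · obtain ⟨M, hM⟩ := h
    refine (B.finite_wtSum (B.wtSum M)).subset fun N hN => ?_
    rw [Set.mem_ofPred_eq, ← hM] at hN
    exact R.rootSum_add_injective (sub_right_injective hN)
  · push Not at h
    convert Set.finite_empty
    ext M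
    simp [h M]

end NegBasis

theorem hasCharacter_verma (μ : Module.Dual ℂ 𝔥) : K.HasCharacter (K.Verma μ) := by
  obtain ⟨B⟩ := K.exists_negBasis ∅
  exact K.hasCharacter_of_basis (B.vermaBasis μ) (B.vermaBasis_mem μ) (B.finite_weight μ)

end KMAlgebra

end KacMoody

end

noncomputable section

set_option linter.unusedSectionVars false

/-! ### Generating functions of multisets -/

namespace MultisetGF

variable {I ι : Type*} (wt : ι → I →₀ ℕ)

/-- The multisets of total weight `β` with entries in `J`. -/
def fibre (J : Set ι) (β : I →₀ ℕ) : Set (Multiset ι) :=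
  {M | (∀ i ∈ M, i ∈ J) ∧ (M.map wt).sum = β}

/-- The generating function of the multisets with entries in `J`. -/
def gf (J : Set ι) : MvPowerSeries I ℤ := fun β => ((fibre wt J β).ncard : ℤ)

theorem coeff_gf (J : Set ι) (β : I →₀ ℕ) :
    MvPowerSeries.coeff β (gf wt J) = ((fibre wt J β).ncard : ℤ) := rfl

variable {wt} (hfin : ∀ β, {M : Multiset ι | (M.map wt).sum = β}.Finite)

include hfin in
/-- Multisets which contain `i` arise from arbitrary ones by adding `i`, so this multiplication
leaves the multisets which do not contain `i`. -/
theorem one_sub_mul_gf {J : Set ι} {i : ι} (hi : i ∈ J) :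
    (1 - MvPowerSeries.monomial (wt i) 1) * gf wt J = gf wt (J \ {i}) := by
  classical
  have hf : ∀ J β, (fibre wt J β).Finite := fun J β => (hfin β).subset fun M hM => hM.2
  ext β
  rw [sub_mul, one_mul, map_sub, MvPowerSeries.coeff_monomial_mul, coeff_gf, coeff_gf, one_mul]
  -- a multiset either avoids `i`, or is `i ::ₘ N` for a multiset `N` of weight `β - wt i`
  have hsplit : fibre wt J β = fibre wt (J \ {i}) β ∪ {M ∈ fibre wt J β | i ∈ M} := by
    ext M
    simp only [fibre, Set.mem_union, Set.mem_ofPred_eq, Set.mem_sdiff, Set.mem_singleton_iff]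
    constructor
    · rintro ⟨h1, h2⟩
      by_cases hM : i ∈ M
      · exact Or.inr ⟨⟨h1, h2⟩, hM⟩
      · exact Or.inl ⟨fun j hj => ⟨h1 j hj, fun h => hM (h ▸ hj)⟩, h2⟩
    · rintro (⟨h1, h2⟩ | ⟨h, -⟩)
      · exact ⟨fun j hj => (h1 j hj).1, h2⟩
      · exact h
  have hdisj : Disjoint (fibre wt (J \ {i}) β) {M ∈ fibre wt J β | i ∈ M} := by
    rw [Set.disjoint_left]
    rintro M ⟨h1, -⟩ ⟨-, h2⟩
    exact (h1 i h2).2 rfl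
  have hcard := Set.ncard_union_eq hdisj (hf _ _) ((hf J β).subset fun M hM => hM.1)
  rw [← hsplit] at hcard
  split_ifs with hle
  · have himg : {M ∈ fibre wt J β | i ∈ M} = (i ::ₘ ·) '' fibre wt J (β - wt i) := by
      ext M
      simp only [fibre, Set.mem_ofPred_eq, Set.mem_image]
      constructor
      · rintro ⟨⟨h1, h2⟩, hM⟩
        obtain ⟨N, rfl⟩ := Multiset.exists_cons_of_mem hM
        refine ⟨N, ⟨fun j hj => h1 j (Multiset.mem_cons_of_mem hj), ?_⟩, rfl⟩
        rw [← h2, Multiset.map_cons, Multiset.sum_cons, add_tsub_cancel_left]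
      · rintro ⟨N, ⟨h1, h2⟩, rfl⟩
        refine ⟨⟨fun j hj => ?_, ?_⟩, Multiset.mem_cons_self i N⟩
        · rcases Multiset.mem_cons.mp hj with rfl | hj
          · exact hi
          · exact h1 j hj
        · rw [Multiset.map_cons, Multiset.sum_cons, h2, add_tsub_cancel_of_le hle]
    rw [himg,
      Set.ncard_image_of_injective _ (fun M N h => (Multiset.cons_inj_right i).mp h)] at hcard
    rw [hcard, coeff_gf]
    push_cast
    ring
  · have hempty : {M ∈ fibre wt J β | i ∈ M} = ∅ := by
      rw [Set.eq_empty_iff_forall_notMem]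
      rintro M ⟨⟨-, h2⟩, hM⟩
      apply hle
      rw [← h2]
      exact Multiset.single_le_sum (fun _ _ => zero_le) _ (Multiset.mem_map_of_mem _ hM)
    rw [hempty, Set.ncard_empty, add_zero] at hcard
    rw [hcard, sub_zero, coeff_gf]

include hfin in
theorem prod_one_sub_mul_gf (F : Finset ι) :
    (∏ i ∈ F, (1 - MvPowerSeries.monomial (wt i) (1 : ℤ))) * gf wt Set.univ =
      gf wt (F : Set ι)ᶜ := by
  classical
  induction F using Finset.induction_on with
  | empty => simp
  | insert i F hi ih =>
    rw [Finset.prod_insert hi, mul_assoc, ih, one_sub_mul_gf hfin (by simpa using hi)]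
    congr 1
    ext j
    simp [and_comm]

theorem coeff_gf_of_forall_not_le [DecidableEq I] {J : Set ι} {β : I →₀ ℕ} (h : ∀ i ∈ J, ¬ wt i ≤ β)
    {γ : I →₀ ℕ} (hγ : γ ≤ β) : MvPowerSeries.coeff γ (gf wt J) = if γ = 0 then 1 else 0 := by
  rw [coeff_gf]
  have h0 : ∀ M ∈ fibre wt J γ, M = 0 := by
    rintro M ⟨h1, h2⟩
    by_contra hM
    obtain ⟨i, hi⟩ := Multiset.exists_mem_of_ne_zero hM
    refine h i (h1 i hi) (le_trans ?_ hγ)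
    rw [← h2]
    exact Multiset.single_le_sum (fun _ _ => zero_le) _ (Multiset.mem_map_of_mem _ hi)
  split_ifs with hz
  · have : fibre wt J γ = {0} := by
      refine Set.eq_singleton_iff_unique_mem.mpr ⟨⟨by simp, by simp [hz]⟩, h0⟩
    rw [this, Set.ncard_singleton, Nat.cast_one]
  · have : fibre wt J γ = ∅ := by
      rw [Set.eq_empty_iff_forall_notMem]
      intro M hM
      have := hM.2
      rw [h0 M hM] at this
      exact hz (by simpa using this.symm)
    rw [this, Set.ncard_empty, Nat.cast_zero]

theorem constantCoeff_gf (h0 : ∀ i, wt i ≠ 0) :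
    MvPowerSeries.constantCoeff (gf wt Set.univ) = 1 := by
  classical
  rw [← MvPowerSeries.coeff_zero_eq_constantCoeff_apply,
    coeff_gf_of_forall_not_le (β := 0) (fun i _ h => h0 i (le_antisymm h zero_le)) le_rfl,
    if_pos rfl]

theorem exists_mul_gf_eq_one (h0 : ∀ i, wt i ≠ 0) : ∃ Q, Q * gf wt Set.univ = 1 := by
  have h : IsUnit (gf wt Set.univ) := by
    rw [MvPowerSeries.isUnit_iff_constantCoeff, constantCoeff_gf h0]
    exact isUnit_one
  obtain ⟨Q, hQ⟩ := h.exists_left_inv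
  exact ⟨Q, hQ⟩

include hfin in
/-- The coefficients of a partial product `∏ (1 - e^{wt i})` which contains all relevant factors
agree with those of the inverse of the generating function. -/
theorem coeff_prod_eq {Q : MvPowerSeries I ℤ} (hQ : Q * gf wt Set.univ = 1) {β : I →₀ ℕ}
    {F : Finset ι} (hF : ∀ i, wt i ≤ β → i ∈ F) :
    MvPowerSeries.coeff β (∏ i ∈ F, (1 - MvPowerSeries.monomial (wt i) (1 : ℤ))) =
      MvPowerSeries.coeff β Q := by
  classical
  have h1 : ∏ i ∈ F, (1 - MvPowerSeries.monomial (wt i) (1 : ℤ)) = gf wt (F : Set ι)ᶜ * Q := by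
    rw [← prod_one_sub_mul_gf hfin, mul_assoc, mul_comm _ Q, hQ, mul_one]
  rw [h1, MvPowerSeries.coeff_mul, Finset.sum_eq_single (0, β)]
  · rw [coeff_gf_of_forall_not_le (J := (F : Set ι)ᶜ) (β := β) (fun i hi h => hi (hF i h)) zero_le,
      if_pos rfl, one_mul]
  · rintro ⟨a, b⟩ hab hne
    rw [Finset.HasAntidiagonal.mem_antidiagonal] at hab
    rw [coeff_gf_of_forall_not_le (J := (F : Set ι)ᶜ) (β := β) (fun i hi h => hi (hF i h))
      (hab ▸ le_self_add), if_neg, zero_mul]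
    rintro rfl
    exact hne (Prod.ext rfl (by simpa using hab))
  · intro h
    exact absurd (Finset.HasAntidiagonal.mem_antidiagonal.mpr (zero_add β)) h

end MultisetGF

namespace KacMoody

universe u v w

variable {I : Type u} [Fintype I] [DecidableEq I] {A : Matrix I I ℤ}
  {𝔥 : Type v} [AddCommGroup 𝔥] [Module ℂ 𝔥] [FiniteDimensional ℂ 𝔥]
  {R : Realization A 𝔥} {𝔤 : Type w} [LieRing 𝔤] [LieAlgebra ℂ 𝔤]

namespace KMAlgebra

variable {K : KMAlgebra R 𝔤} {X : Set I} (B : K.NegBasis X)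

/-! ### The denominator and the characters of Verma modules -/

namespace NegBasis

/-- The Kostant partition function, as a power series. -/
def kostant : MvPowerSeries I ℤ := MultisetGF.gf B.wt Set.univ

theorem coeff_kostant (β : I →₀ ℕ) :
    MvPowerSeries.coeff β B.kostant = (Nat.card {M // B.wtSum M = β} : ℤ) := by
  rw [kostant, MultisetGF.coeff_gf, ← Nat.card_coe_set_eq]
  congr 1
  refine Nat.card_congr (Equiv.subtypeEquivRight fun M => ?_)
  simp [MultisetGF.fibre, wtSum]

theorem wt_mem_posRoots (i : B.ι) : B.wt i ∈ K.posRoots := by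
  refine ⟨B.wt_ne_zero i, fun h => ?_⟩
  have h1 := B.basis_mem i
  rw [h, Submodule.mem_bot] at h1
  exact B.basis.ne_zero i (Subtype.ext h1)

theorem factor_eq (β : K.posRoots) : K.factor β =
    ∏ i ∈ (B.finite_wt β).toFinset, (1 - MvPowerSeries.monomial (B.wt i) (1 : ℤ)) := by
  rw [Finset.prod_congr rfl (g := fun _ => 1 - MvPowerSeries.monomial (β : I →₀ ℕ) (1 : ℤ)),
    Finset.prod_const, factor, mult, (B.finiteDimensional_and_finrank_rootSpace β.2.1).2]
  · congr 1
    rw [← Set.ncard_eq_toFinset_card _ (B.finite_wt β)]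
    rfl
  · intro i hi
    rw [Set.Finite.mem_toFinset] at hi
    rw [show B.wt i = β from hi]

theorem hasProd_factor {Q : MvPowerSeries I ℤ} (hQ : Q * B.kostant = 1) : HasProd K.factor Q := by
  classical
  change Filter.Tendsto _ _ _
  rw [SummationFilter.unconditional_filter,
    MvPowerSeries.WithPiTopology.tendsto_iff_coeff_tendsto]
  intro β
  apply tendsto_const_nhds.congr'
  have hS : {γ : K.posRoots | (γ : I →₀ ℕ) ≤ β}.Finite :=
    (Set.finite_Iic β).preimage Subtype.val_injective.injOn
  filter_upwards [Filter.eventually_ge_atTop hS.toFinset] with S hle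
  have h1 : ∏ γ ∈ S, K.factor γ = ∏ i ∈ S.biUnion fun γ => (B.finite_wt γ).toFinset,
      (1 - MvPowerSeries.monomial (B.wt i) (1 : ℤ)) := by
    rw [Finset.prod_biUnion]
    · exact Finset.prod_congr rfl fun γ _ => B.factor_eq γ
    · intro γ _ δ _ hne
      rw [Function.onFun, Finset.disjoint_left]
      intro i hi hi'
      rw [Set.Finite.mem_toFinset] at hi hi'
      exact hne (Subtype.ext ((show B.wt i = γ from hi).symm.trans hi'))
  rw [h1, MultisetGF.coeff_prod_eq B.finite_wtSum hQ]
  intro i hi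
  rw [Finset.mem_biUnion]
  exact ⟨⟨B.wt i, B.wt_mem_posRoots i⟩, hle (by simpa using hi), by simp⟩

theorem denominator_mul_kostant : K.denominator * B.kostant = 1 := by
  obtain ⟨Q, hQ⟩ := MultisetGF.exists_mul_gf_eq_one B.wt_ne_zero
  rw [denominator, (B.hasProd_factor hQ).tprod_eq]
  exact hQ

theorem inverse_denominator : Ring.inverse K.denominator = B.kostant :=
  by
  have h := B.denominator_mul_kostant
  have hu : IsUnit K.denominator := IsUnit.of_mul_eq_one _ h
  rw [← one_mul B.kostant, ← Ring.inverse_mul_cancel _ hu, mul_assoc, h, mul_one]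

end NegBasis

variable (K)

theorem multipliable_factor : Multipliable K.factor := by
  obtain ⟨B⟩ := K.exists_negBasis ∅
  obtain ⟨Q, hQ⟩ := MultisetGF.exists_mul_gf_eq_one B.wt_ne_zero
  exact ⟨Q, B.hasProd_factor hQ⟩

theorem isUnit_denominator : IsUnit K.denominator := by
  obtain ⟨B⟩ := K.exists_negBasis ∅
  exact IsUnit.of_mul_eq_one _ B.denominator_mul_kostant

theorem ch_verma (μ : Module.Dual ℂ 𝔥) :
    K.ch (K.Verma μ) = R.expMul μ (Ring.inverse K.denominator) := by
  classical
  obtain ⟨B⟩ := K.exists_negBasis ∅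
  funext ν
  rw [K.ch_of_basis (B.vermaBasis μ) (B.vermaBasis_mem μ), B.inverse_denominator,
    Realization.expMul]
  by_cases h : ∃ β, ν = μ - R.rootSum β
  · obtain ⟨β, rfl⟩ := h
    rw [finsum_eq_single _ β, if_pos rfl, B.coeff_kostant]
    · congr 1
      refine Nat.card_congr (Equiv.subtypeEquivRight fun M => ?_)
      exact ⟨fun h => R.rootSum_add_injective (sub_right_injective h), fun h => by rw [h]⟩
    · intro γ hγ
      rw [if_neg]
      intro h
      exact hγ (R.rootSum_add_injective (sub_right_injective h)).symm
  · push Not at h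
    have : IsEmpty {M // μ - R.rootSum (B.wtSum M) = ν} := ⟨fun M => h _ M.2.symm⟩
    rw [Nat.card_of_isEmpty, Nat.cast_zero]
    symm
    exact finsum_eq_zero_of_forall_eq_zero fun β => if_neg (h β)

end KMAlgebra

end KacMoody

end

noncomputable section

/-! ### Families of augmented simplicial chain complexes -/

namespace SimplexComplex

variable {k : ℕ} {P : Type*} (T : P → Finset (Fin k))

/-- The sign with which the face `J ∖ {j}` occurs in the boundary of `J`. -/
def sign (j : Fin k) (J : Finset (Fin k)) : ℤ := (-1) ^ (J.filter (· < j)).card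

theorem sign_erase {i j : Fin k} {J : Finset (Fin k)} (hi : i ∈ J) :
    sign j (J.erase i) = if i < j then -sign j J else sign j J := by
  rw [sign, Finset.filter_erase, sign]
  split_ifs with h
  · have h1 : i ∈ J.filter (· < j) := Finset.mem_filter.mpr ⟨hi, h⟩
    have h2 := Finset.card_erase_add_one h1
    rw [← h2, pow_succ]
    ring
  · rw [Finset.erase_eq_of_notMem]
    exact fun h1 => h (Finset.mem_filter.mp h1).2

theorem sign_mul_sign {i j : Fin k} {J : Finset (Fin k)} (hi : i ∈ J) (hj : j ∈ J) (hij : i ≠ j) :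
    sign i J * sign j (J.erase i) = -(sign j J * sign i (J.erase j)) := by
  rw [sign_erase hi, sign_erase hj]
  rcases lt_or_gt_of_ne hij with h | h
  · rw [if_pos h, if_neg h.not_gt]; ring
  · rw [if_pos h, if_neg h.not_gt]; ring

/-- The simplices of dimension `t - 1` of the full simplices on the vertex sets `T p`. -/
abbrev Simplex (t : ℕ) : Type _ := {x : Finset (Fin k) × P // x.1.card = t ∧ x.1 ⊆ T x.2}

variable {T} {V : ℕ → Type*} [∀ t, AddCommGroup (V t)] [∀ t, Module ℂ (V t)]
  (b : ∀ t, Module.Basis (Simplex T t) ℂ (V t))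

open Classical in
/-- The basis vector attached to a simplex, extended by zero. -/
def vec (t : ℕ) (J : Finset (Fin k)) (p : P) : V t :=
  if h : J.card = t ∧ J ⊆ T p then b t ⟨(J, p), h⟩ else 0

theorem basis_eq_vec (t : ℕ) (x : Simplex T t) : b t x = vec b t x.1.1 x.1.2 := by
  rw [vec, dif_pos x.2]

open Classical in
/-- The contracting homotopy: the cone with the least vertex of `T p` as its apex. -/
def cone (t : ℕ) : V t →ₗ[ℂ] V (t + 1) :=
  (b t).constr ℂ fun x =>
    if h : (T x.1.2).Nonempty then
      if (T x.1.2).min' h ∈ x.1.1 then 0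
      else vec b (t + 1) (insert ((T x.1.2).min' h) x.1.1) x.1.2
    else 0

theorem cone_of_mem {t : ℕ} {J : Finset (Fin k)} {p : P} (h : (T p).Nonempty)
    (hm : (T p).min' h ∈ J) : cone b t (vec b t J p) = 0 := by
  rw [vec]
  split_ifs with hJ
  · rw [cone, Module.Basis.constr_basis, dif_pos h, if_pos hm]
  · exact map_zero _

theorem cone_of_notMem {t : ℕ} {J : Finset (Fin k)} {p : P} (h : (T p).Nonempty)
    (hJ : J.card = t) (hJT : J ⊆ T p) (hm : (T p).min' h ∉ J) :
    cone b t (vec b t J p) = vec b (t + 1) (insert ((T p).min' h) J) p := by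
  rw [vec, dif_pos ⟨hJ, hJT⟩, cone, Module.Basis.constr_basis, dif_pos h, if_neg hm]

/-- The maps `d t` are given on simplices by the alternating sum of the faces. -/
def IsBoundary (d : ∀ t, V (t + 1) →ₗ[ℂ] V t) : Prop :=
  ∀ t J p, J.card = t + 1 → J ⊆ T p →
    d t (vec b (t + 1) J p) = ∑ j ∈ J, sign j J • vec b t (J.erase j) p

variable {d : ∀ t, V (t + 1) →ₗ[ℂ] V t} (hd : IsBoundary b d)

include hd

theorem d_comp_d (t : ℕ) (x : V (t + 2)) : d t (d (t + 1) x) = 0 := by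
  refine LinearMap.congr_fun (f := (d t).comp (d (t + 1))) (g := 0)
    ((b (t + 2)).ext fun x => ?_) x
  obtain ⟨⟨J, p⟩, hJ, hJT⟩ := x
  dsimp only at hJ hJT
  rw [LinearMap.comp_apply, basis_eq_vec, hd _ _ _ hJ hJT, map_sum, LinearMap.zero_apply]
  let g : Fin k → Fin k → V t := fun i j =>
    (sign i J * sign j (J.erase i)) • vec b t ((J.erase i).erase j) p
  have h1 : ∀ i ∈ J, d t (sign i J • vec b (t + 1) (J.erase i) p) =
      ∑ j ∈ J, if i = j then 0 else g i j := by
    intro i hi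
    rw [map_zsmul, hd t _ _ (by rw [Finset.card_erase_of_mem hi, hJ]; rfl)
      ((Finset.erase_subset _ _).trans hJT), Finset.smul_sum]
    rw [← Finset.add_sum_erase J _ hi, if_pos rfl, zero_add]
    refine Finset.sum_congr rfl fun j hj => ?_
    rw [if_neg (Finset.ne_of_mem_erase hj).symm, smul_smul]
  rw [Finset.sum_congr rfl h1]
  -- the summands are antisymmetric in the two removed vertices
  have h2 : ∑ i ∈ J, ∑ j ∈ J, (if i = j then 0 else g i j) =
      -∑ i ∈ J, ∑ j ∈ J, (if i = j then 0 else g i j) := by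
    conv_lhs => rw [Finset.sum_comm]
    rw [← Finset.sum_neg_distrib]
    refine Finset.sum_congr rfl fun i hi => ?_
    rw [← Finset.sum_neg_distrib]
    refine Finset.sum_congr rfl fun j hj => ?_
    by_cases hij : j = i
    · simp [hij]
    · rw [if_neg hij, if_neg (Ne.symm hij)]
      simp only [g]
      rw [sign_mul_sign hj hi hij, neg_smul, Finset.erase_right_comm]
  rw [eq_neg_iff_add_eq_zero, ← two_smul ℂ] at h2
  exact (smul_eq_zero.mp h2).resolve_left two_ne_zero

theorem homotopy (t : ℕ) (x : V (t + 1)) :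
    d (t + 1) (cone b (t + 1) x) + cone b t (d t x) = x := by
  refine LinearMap.congr_fun (f := (d (t + 1)).comp (cone b (t + 1)) + (cone b t).comp (d t))
    (g := LinearMap.id) ((b (t + 1)).ext fun x => ?_) x
  obtain ⟨⟨J, p⟩, hJ, hJT⟩ := x
  dsimp only at hJ hJT
  have hne : (T p).Nonempty := by
    obtain ⟨j, hj⟩ := Finset.card_pos.mp (by rw [hJ]; exact Nat.succ_pos t)
    exact ⟨j, hJT hj⟩
  set m := (T p).min' hne with hm
  have hle : ∀ j ∈ J, m ≤ j := fun j hj => Finset.min'_le _ _ (hJT hj)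
  have hsub : insert m J ⊆ T p := Finset.insert_subset (Finset.min'_mem _ _) hJT
  simp only [LinearMap.add_apply, LinearMap.comp_apply, LinearMap.id_apply]
  rw [basis_eq_vec]
  dsimp only
  rw [hd t J p hJ hJT, map_sum]
  by_cases hmJ : m ∈ J
  · rw [cone_of_mem b hne hmJ, map_zero, zero_add, Finset.sum_eq_single m]
    · have h1 : sign m J = 1 := by
        rw [sign, Finset.filter_false_of_mem fun j hj => not_lt.mpr (hle j hj)]
        simp
      rw [h1, one_smul, cone_of_notMem b hne (by rw [Finset.card_erase_of_mem hmJ, hJ]; rfl)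
        ((Finset.erase_subset _ _).trans hJT) (Finset.notMem_erase m J), Finset.insert_erase hmJ]
    · intro j hj hjm
      rw [map_zsmul, cone_of_mem b hne (Finset.mem_erase.mpr ⟨hjm.symm, hmJ⟩), smul_zero]
    · exact fun h => absurd hmJ h
  · rw [cone_of_notMem b hne hJ hJT hmJ, hd (t + 1) _ _
      (by rw [Finset.card_insert_of_notMem hmJ, hJ]) hsub, Finset.sum_insert hmJ,
      Finset.erase_insert hmJ]
    have h1 : sign m (insert m J) = 1 := by
      rw [sign, Finset.filter_false_of_mem]
      · simp
      · intro j hj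
        rcases Finset.mem_insert.mp hj with rfl | hj
        · exact lt_irrefl _
        · exact not_lt.mpr (hle j hj)
    rw [h1, one_smul, add_assoc, ← Finset.sum_add_distrib, Finset.sum_eq_zero, add_zero]
    intro j hj
    have hmj : m ≠ j := fun h => hmJ (h ▸ hj)
    have h2 : sign j J = -sign j (insert m J) := by
      have := sign_erase (j := j) (Finset.mem_insert_self m J)
      rw [Finset.erase_insert hmJ, if_pos (lt_of_le_of_ne (hle j hj) hmj)] at this
      exact this
    rw [map_zsmul, cone_of_notMem b hne (by rw [Finset.card_erase_of_mem hj, hJ]; rfl)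
      ((Finset.erase_subset _ _).trans hJT) (fun h => hmJ (Finset.mem_of_mem_erase h)),
      Finset.erase_insert_of_ne hmj, h2, neg_smul, ← hm, add_neg_cancel]

/-- The chain complexes of full simplices, put together, are exact in positive degrees. -/
theorem exact (t : ℕ) : Function.Exact (d (t + 1)) (d t) := by
  intro x
  constructor
  · intro hx
    have := homotopy b hd t x
    rw [hx, map_zero, add_zero] at this
    exact ⟨_, this⟩
  · rintro ⟨y, rfl⟩
    exact d_comp_d b hd t y

end SimplexComplex

end

noncomputable section

set_option linter.unusedSectionVars false

namespace KacMoody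

attribute [local instance 100] LieRing.ofAssociativeRing

universe u v w

variable {I : Type u} [Fintype I] [DecidableEq I] {A : Matrix I I ℤ}
  {𝔥 : Type v} [AddCommGroup 𝔥] [Module ℂ 𝔥] [FiniteDimensional ℂ 𝔥]
  {R : Realization A 𝔥} {𝔤 : Type w} [LieRing 𝔤] [LieAlgebra ℂ 𝔤]

theorem IsIndep.subset {X Y : Set I} (hX : IsIndep A X) (h : Y ⊆ X) : IsIndep A Y := hX.mono h

theorem Realization.expo_eq (R : Realization A 𝔥) {lam : Module.Dual ℂ 𝔥} {i : I}
    (hi : i ∈ R.integrability lam) : (R.expo lam i : ℂ) = lam (R.coroot i) + 1 := by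
  obtain ⟨n, hn⟩ := hi
  rw [expo, hn]
  simp

namespace KMAlgebra

/-! ### Singular vectors -/

section Singular

variable (K : KMAlgebra R 𝔤)

theorem fH_empty (lam : Module.Dual ℂ 𝔥) : K.fH lam ∅ = 1 := by
  rw [fH]
  split_ifs
  · exact Finset.noncommProd_empty _ _
  · rfl

theorem fH_insert (lam : Module.Dual ℂ 𝔥) {i : I} {S : Finset I} (hi : i ∉ S)
    (hS : IsIndep A (insert i S : Set I)) :
    K.fH lam (insert i S) = K.ι (K.f i) ^ R.expo lam i * K.fH lam S := by
  classical
  have h1 : IsIndep A ((insert i S : Finset I) : Set I) := by rwa [Finset.coe_insert]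
  rw [fH, dif_pos h1, fH, dif_pos (hS.subset (Set.subset_insert _ _))]
  exact Finset.noncommProd_insert_of_notMem _ _ _ _ hi

variable {K} {V : Type*} [AddCommGroup V] [Module ℂ V] [Module K.U V] [IsScalarTower ℂ K.U V]

theorem f_mem_rootSpace (i : I) : K.f i ∈ K.rootSpace (-R.root i) := fun y => K.lie_h_f y i

theorem f_pow_smul_mem {μ : Module.Dual ℂ 𝔥} {v : V} (hv : v ∈ K.weightSpace V μ) (i : I) (n : ℕ) :
    K.ι (K.f i) ^ n • v ∈ K.weightSpace V (μ - (n : ℂ) • R.root i) := by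
  induction n with
  | zero => simpa using hv
  | succ n ih =>
    rw [pow_succ', mul_smul]
    have := smul_mem_weightSpace (f_mem_rootSpace (K := K) i) ih
    convert this using 2
    push_cast
    rw [add_smul, one_smul]
    abel

theorem e_smul_f_smul (i j : I) (v : V) : K.ι (K.e i) • K.ι (K.f j) • v =
    K.ι (K.f j) • K.ι (K.e i) • v + K.ι ⁅K.e i, K.f j⁆ • v := by
  rw [LieHom.map_lie, LieRing.of_associative_ring_bracket, sub_smul, mul_smul, mul_smul]
  abel

theorem e_smul_f_pow_smul_of_ne {i j : I} (h : i ≠ j) {v : V} (he : K.ι (K.e i) • v = 0) (n : ℕ) :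
    K.ι (K.e i) • K.ι (K.f j) ^ n • v = 0 := by
  induction n with
  | zero => simpa using he
  | succ n ih =>
    rw [pow_succ', mul_smul, e_smul_f_smul, ih, smul_zero, K.lie_e_f_ne h, map_zero, zero_smul,
      add_zero]

theorem e_smul_f_pow_smul {μ : Module.Dual ℂ 𝔥} {v : V} (hv : v ∈ K.weightSpace V μ) {i : I}
    (he : K.ι (K.e i) • v = 0) (n : ℕ) : K.ι (K.e i) • K.ι (K.f i) ^ (n + 1) • v =
      (((n : ℂ) + 1) * (μ (R.coroot i) - n)) • K.ι (K.f i) ^ n • v := by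
  have hc : R.root i (R.coroot i) = 2 := by rw [R.pairing, R.isGCM.diag]; norm_num
  induction n with
  | zero =>
    rw [pow_succ', pow_zero, mul_one, one_smul, e_smul_f_smul, he, smul_zero, zero_add,
      K.lie_e_f, hv]
    simp
  | succ n ih =>
    have h1 := f_pow_smul_mem hv i (n + 1) (R.coroot i)
    have h2 : ∀ c : ℂ, K.ι (K.f i) • c • K.ι (K.f i) ^ n • v =
        c • K.ι (K.f i) ^ (n + 1) • v := fun c => by
      rw [pow_succ', mul_smul, smul_comm]
    rw [pow_succ', mul_smul, e_smul_f_smul, ih, K.lie_e_f, h1, h2, ← add_smul]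
    congr 1
    simp only [LinearMap.sub_apply, LinearMap.smul_apply, hc, smul_eq_mul]
    push_cast
    ring

/-- Applying `𝐟_S` to a singular vector, whose weight pairs with the coroots of `S` in the same
way as `λ` does, gives a singular vector. -/
theorem fH_smul_singular {lam μ : Module.Dual ℂ 𝔥} {v : V} (hv : v ∈ K.weightSpace V μ)
    (he : ∀ i, K.ι (K.e i) • v = 0) {S : Finset I} (hS : IsIndep A (S : Set I))
    (hμ : ∀ i ∈ S, (R.expo lam i : ℂ) = μ (R.coroot i) + 1) :
    K.fH lam S • v ∈ K.weightSpace V (μ - ∑ i ∈ S, (R.expo lam i : ℂ) • R.root i) ∧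
      ∀ i, K.ι (K.e i) • K.fH lam S • v = 0 := by
  induction S using Finset.induction_on with
  | empty => simpa [fH_empty] using ⟨hv, he⟩
  | insert j S hj ih =>
    rw [Finset.coe_insert] at hS
    obtain ⟨ih1, ih2⟩ := ih (hS.subset (Set.subset_insert _ _))
      fun i hi => hμ i (Finset.mem_insert_of_mem hi)
    rw [fH_insert K lam hj hS, mul_smul]
    constructor
    · have := f_pow_smul_mem ih1 j (R.expo lam j)
      rw [Finset.sum_insert hj]
      rwa [sub_sub, add_comm] at this
    · intro i
      by_cases hij : i = j
      · subst hij
        obtain ⟨n, hn⟩ : ∃ n, R.expo lam i = n + 1 := ⟨_, rfl⟩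
        have h1 := hμ i (Finset.mem_insert_self _ _)
        rw [hn] at h1 ⊢
        have h2 : ∑ x ∈ S, (R.expo lam x : ℂ) * R.root x (R.coroot i) = 0 := by
          refine Finset.sum_eq_zero fun x hx => ?_
          rw [R.pairing, hS (Set.mem_insert _ _) (Set.mem_insert_of_mem _ hx)
            (fun h => hj (h ▸ hx))]
          simp
        rw [e_smul_f_pow_smul ih1 (ih2 i)]
        simp only [LinearMap.sub_apply, LinearMap.sum_apply, LinearMap.smul_apply, smul_eq_mul, h2]
        push_cast at h1
        rw [show μ (R.coroot i) - 0 - (n : ℂ) = 0 by linear_combination -h1, mul_zero, zero_smul]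
      · exact e_smul_f_pow_smul_of_ne hij (ih2 i) _

variable {W : Type*} [AddCommGroup W] [Module ℂ W] [Module K.U W] [IsScalarTower ℂ K.U W]

theorem map_mem_weightSpace (φ : V →ₗ[K.U] W) {μ : Module.Dual ℂ 𝔥} {v : V}
    (hv : v ∈ K.weightSpace V μ) : φ v ∈ K.weightSpace W μ := by
  intro x
  rw [← map_smul, hv x, LinearMap.map_smul_of_tower]

theorem verma_hom_ext {μ : Module.Dual ℂ 𝔥} {φ ψ : K.Verma μ →ₗ[K.U] V}
    (h : φ (K.vermaVec μ) = ψ (K.vermaVec μ)) : φ = ψ :=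
  Submodule.linearMap_qext _ (LinearMap.ext_ring h)

end Singular

/-! ### The action of `𝐟_S` on monomials -/

section Monomials

variable {K : KMAlgebra R 𝔤} {X : Set I} (B : K.NegBasis X) (lam : Module.Dual ℂ 𝔥)

namespace NegBasis

/-- The monomial which corresponds to `𝐟_S`. -/
def mulS (S : Finset I) : Multiset B.ι :=
  ∑ i ∈ S, Multiset.replicate (R.expo lam i) (B.idx i)

theorem mulS_add {S S' : Finset I} (h : Disjoint S S') :
    B.mulS lam S + B.mulS lam S' = B.mulS lam (S ∪ S') := (Finset.sum_union h).symm

theorem mulS_sdiff_add {S S' : Finset I} :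
    B.mulS lam (S \ S') + B.mulS lam S' = B.mulS lam (S ∪ S') := by
  rw [mulS_add _ _ Finset.sdiff_disjoint, Finset.sdiff_union_self_eq_union]

theorem mulS_le_iff [DecidableEq B.ι] {S : Finset I} {M : Multiset B.ι} :
    B.mulS lam S ≤ M ↔ ∀ i ∈ S, R.expo lam i ≤ M.count (B.idx i) := by
  have hcount : ∀ x, (B.mulS lam S).count x = ∑ i ∈ S, if B.idx i = x then R.expo lam i else 0 := by
    intro x
    rw [mulS, Multiset.count_sum']
    exact Finset.sum_congr rfl fun i _ => Multiset.count_replicate _ _ _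
  have hc : ∀ i ∈ S, (B.mulS lam S).count (B.idx i) = R.expo lam i := by
    intro i hi
    rw [hcount, Finset.sum_eq_single i, if_pos rfl]
    · exact fun j _ hj => if_neg fun h => hj (B.idx_injective h)
    · exact fun h => absurd hi h
  rw [Multiset.le_iff_count]
  constructor
  · intro h i hi
    rw [← hc i hi]
    exact h _
  · intro h x
    by_cases hx : ∃ i ∈ S, B.idx i = x
    · obtain ⟨i, hi, rfl⟩ := hx
      rw [hc i hi]
      exact h i hi
    · rw [hcount, Finset.sum_eq_zero]
      · exact Nat.zero_le _
      · exact fun i hi => if_neg fun h => hx ⟨i, hi, h⟩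

theorem wtSum_mulS (S : Finset I) :
    R.rootSum (B.wtSum (B.mulS lam S)) = ∑ i ∈ S, (R.expo lam i : ℂ) • R.root i := by
  induction S using Finset.induction_on with
  | empty => simp [mulS, wtSum, Realization.rootSum_zero]
  | insert j S hj ih =>
    rw [mulS, Finset.sum_insert hj, Finset.sum_insert hj, wtSum_add, Realization.rootSum_add,
      ← mulS, ih, wtSum, Multiset.map_replicate, Multiset.sum_replicate, B.wt_idx,
      Finsupp.smul_single, smul_eq_mul, mul_one, Realization.rootSum_single]

theorem lamH_eq {S : Finset I} (hS : (S : Set I) ⊆ R.integrability lam) :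
    R.lamH lam S = lam - R.rootSum (B.wtSum (B.mulS lam S)) := by
  rw [wtSum_mulS, Realization.lamH]
  congr 1
  exact Finset.sum_congr rfl fun i hi => by rw [R.expo_eq (hS hi)]

variable (hX : IsIndep A X)

include hX

theorem minusMap_mono_mul_f {i : I} (hi : i ∈ X) (M : Multiset B.ι) :
    K.minusMap (PBW.mono B.basis M) * K.ι (K.f i) =
      K.minusMap (PBW.mono B.basis (B.idx i ::ₘ M)) := by
  rw [PBW.mono_cons_right B.basis B.isUpperSet _ (Set.mem_image_of_mem _ hi), map_mul,
    minusMap_eq, PBW.inclMap_ι, B.basis_idx]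
  · rfl
  · rintro _ ⟨i, hi, rfl⟩ _ ⟨j, hj, rfl⟩
    refine Subtype.ext ?_
    rw [LieSubalgebra.coe_bracket, B.basis_idx, B.basis_idx]
    by_cases hij : i = j
    · rw [hij, lie_self]; rfl
    · exact K.lie_f_f (hX hi hj hij) hij

theorem minusMap_mono_mul_f_pow {i : I} (hi : i ∈ X) (M : Multiset B.ι) (n : ℕ) :
    K.minusMap (PBW.mono B.basis M) * K.ι (K.f i) ^ n =
      K.minusMap (PBW.mono B.basis (M + Multiset.replicate n (B.idx i))) := by
  induction n with
  | zero => simp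
  | succ n ih =>
    rw [pow_succ, ← mul_assoc, ih, B.minusMap_mono_mul_f hX hi, Multiset.replicate_succ,
      Multiset.add_cons]

/-- Right multiplication by `𝐟_S` permutes the ordered monomials. -/
theorem minusMap_mono_mul_fH {S : Finset I} (hS : (S : Set I) ⊆ X) (M : Multiset B.ι) :
    K.minusMap (PBW.mono B.basis M) * K.fH lam S =
      K.minusMap (PBW.mono B.basis (M + B.mulS lam S)) := by
  induction S using Finset.induction_on generalizing M with
  | empty => rw [fH_empty, mul_one, mulS, Finset.sum_empty, add_zero]
  | insert j S hj ih =>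
    rw [Finset.coe_insert, Set.insert_subset_iff] at hS
    rw [fH_insert K lam hj (hX.subset (Set.insert_subset hS.1 hS.2)), ← mul_assoc,
      B.minusMap_mono_mul_f_pow hX hS.1, ih hS.2, add_assoc, mulS, mulS, Finset.sum_insert hj]

theorem minusMap_mono_smul_fH {S : Finset I} (hS : (S : Set I) ⊆ X) (M : Multiset B.ι)
    (μ : Module.Dual ℂ 𝔥) :
    K.minusMap (PBW.mono B.basis M) • K.fH lam S • K.vermaVec μ =
      B.vermaBasis μ (M + B.mulS lam S) := by
  rw [← mul_smul, B.minusMap_mono_mul_fH lam hX hS, vermaBasis_apply]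

end NegBasis

end Monomials

/-! ### The resolution -/

section Resolution

variable (K : KMAlgebra R 𝔤) {lam : Module.Dual ℂ 𝔥} {k : ℕ} {H : Fin k → Finset I}

theorem bggVec_eq (t : ℕ) (J : {J : Finset (Fin k) // J.card = t}) :
    K.bggVec lam H t J = DirectSum.lof K.U {J : Finset (Fin k) // J.card = t}
      (fun J => K.Verma (R.lamH lam (unionH H J))) J (K.vermaVec _) := rfl

variable {K} in
theorem bgg_hom_ext {V : Type*} [AddCommGroup V] [Module K.U V] {t : ℕ}
    {φ ψ : K.BGG lam H t →ₗ[K.U] V}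
    (h : ∀ J, φ (K.bggVec lam H t J) = ψ (K.bggVec lam H t J)) : φ = ψ := by
  refine DirectSum.linearMap_ext _ fun J => ?_
  refine Submodule.linearMap_qext _ (LinearMap.ext_ring (h J))

theorem bggVec_mem (t : ℕ) (J : {J : Finset (Fin k) // J.card = t}) :
    K.bggVec lam H t J ∈ K.weightSpace (K.BGG lam H t) (R.lamH lam (unionH H J)) :=
  map_mem_weightSpace _ (K.vermaVec_mem _)

theorem ι_e_smul_bggVec (t : ℕ) (J : {J : Finset (Fin k) // J.card = t}) (i : I) :
    K.ι (K.e i) • K.bggVec lam H t J = 0 := by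
  rw [bggVec_eq, ← map_smul, ι_e_smul_vermaVec, map_zero]

theorem subsingleton_bgg {t : ℕ} (ht : k < t) : Subsingleton (K.BGG lam H t) := by
  have : IsEmpty {J : Finset (Fin k) // J.card = t} :=
    ⟨fun J => absurd J.2 (by have := Finset.card_le_univ J.1; simp at this; omega)⟩
  infer_instance

theorem existsUnique_bgg (t : ℕ) (x : K.BGG lam H t) :
    ∃! c : {J : Finset (Fin k) // J.card = t} → K.UMinus,
      x = ∑ J, K.minusMap (c J) • K.bggVec lam H t J := by
  have key : ∀ c : {J : Finset (Fin k) // J.card = t} → K.UMinus,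
      ∀ J, (∑ J, K.minusMap (c J) • K.bggVec lam H t J) J = K.vermaEquiv _ (c J) := by
    intro c J
    have h1 : ∀ J', (K.minusMap (c J') • K.bggVec lam H t J') =
        DirectSum.lof K.U {J : Finset (Fin k) // J.card = t}
          (fun J => K.Verma (R.lamH lam (unionH H J))) J' (K.vermaEquiv _ (c J')) := by
      intro J'
      rw [vermaEquiv_apply, map_smul, bggVec_eq]
    simp only [h1]
    rw [DFinsupp.finsetSum_apply, Finset.sum_eq_single J]
    · exact DirectSum.lof_apply _ _ _
    · intro J' _ hne
      exact DirectSum.of_eq_of_ne _ _ _ hne.symm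
    · exact fun h => absurd (Finset.mem_univ J) h
  refine ⟨fun J => (K.vermaEquiv _).symm (x J), ?_, fun c hc => ?_⟩
  · refine DFinsupp.ext fun J => ?_
    rw [key, LinearEquiv.apply_symm_apply]
  · funext J
    rw [hc, key, LinearEquiv.symm_apply_apply]

end Resolution

end KMAlgebra

end KacMoody

end

noncomputable section

set_option linter.unusedSectionVars false

theorem DirectSum.basis_eq_lof {R S ι : Type*} [Semiring R] [Semiring S] [DecidableEq ι]
    {M : ι → Type*} [∀ i, AddCommMonoid (M i)] [∀ i, Module R (M i)] [∀ i, Module S (M i)]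
    {η : ι → Type*} (b : ∀ i, Module.Basis (η i) R (M i)) (i : ι) (m : η i) :
    DFinsupp.basis b ⟨i, m⟩ = DirectSum.lof S ι M i (b i m) := by
  apply (DFinsupp.basis b).repr.injective
  rw [Module.Basis.repr_self]
  change _ = (sigmaFinsuppLequivDFinsupp R).symm
    (DFinsupp.mapRange.linearEquiv (fun i => (b i).repr) (DFinsupp.single i (b i m)))
  rw [LinearEquiv.eq_symm_apply, DFinsupp.mapRange.linearEquiv_apply, DFinsupp.mapRange_single,
    Module.Basis.repr_self]
  exact sigmaFinsuppEquivDFinsupp_single _ _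

namespace KacMoody

attribute [local instance 100] LieRing.ofAssociativeRing

universe u v w

variable {I : Type u} [Fintype I] [DecidableEq I] {A : Matrix I I ℤ}
  {𝔥 : Type v} [AddCommGroup 𝔥] [Module ℂ 𝔥] [FiniteDimensional ℂ 𝔥]
  {R : Realization A 𝔥} {𝔤 : Type w} [LieRing 𝔤] [LieAlgebra ℂ 𝔤]

theorem unionH_subset {k : ℕ} {H : Fin k → Finset I} {X : Set I} (hHX : ∀ j, (H j : Set I) ⊆ X)
    (J : Finset (Fin k)) : (unionH H J : Set I) ⊆ X := by
  intro i hi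
  obtain ⟨j, -, hj⟩ := Finset.mem_biUnion.mp (Finset.mem_coe.mp hi)
  exact hHX j hj

theorem union_unionH_erase {k : ℕ} {H : Fin k → Finset I} {J : Finset (Fin k)} {j : Fin k}
    (hj : j ∈ J) : H j ∪ unionH H (J.erase j) = unionH H J := by
  conv_rhs => rw [← Finset.insert_erase hj]
  rw [unionH, unionH, Finset.biUnion_insert]

theorem Realization.lamH_coroot (R : Realization A 𝔥) {X : Set I} (hX : IsIndep A X)
    (lam : Module.Dual ℂ 𝔥) {S : Finset I} (hS : (S : Set I) ⊆ X) {i : I} (hi : i ∈ X)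
    (hiS : i ∉ S) : R.lamH lam S (R.coroot i) = lam (R.coroot i) := by
  rw [lamH, LinearMap.sub_apply, LinearMap.sum_apply, Finset.sum_eq_zero, sub_zero]
  intro h hh
  rw [LinearMap.smul_apply, R.pairing, hX hi (hS hh) (fun e => hiS (e ▸ hh))]
  simp

namespace KMAlgebra

theorem fH_union (K : KMAlgebra R 𝔤) (lam : Module.Dual ℂ 𝔥) {S S' : Finset I}
    (hd : Disjoint S S') (h : IsIndep A ((S ∪ S' : Finset I) : Set I)) :
    K.fH lam (S ∪ S') = K.fH lam S * K.fH lam S' := by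
  induction S using Finset.induction_on with
  | empty => rw [Finset.empty_union, fH_empty, one_mul]
  | insert i S hi ih =>
    rw [Finset.disjoint_insert_left] at hd
    rw [Finset.insert_union, Finset.coe_insert] at h
    have h1 : IsIndep A (insert i (S : Set I)) := h.subset
      (Set.insert_subset_insert (by rw [Finset.coe_union]; exact Set.subset_union_left))
    rw [Finset.insert_union, fH_insert K lam (by simp [hi, hd.1]) h, fH_insert K lam hi h1,
      ih hd.2 (h.subset (Set.subset_insert _ _)), mul_assoc]

section Complex

variable {K : KMAlgebra R 𝔤} {lam : Module.Dual ℂ 𝔥} {k : ℕ} {H : Fin k → Finset I} {X : Set I}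
  (hX : IsIndep A X) (hXi : X ⊆ R.integrability lam) (hHX : ∀ j, (H j : Set I) ⊆ X)

/-! ### Differentials -/

include hX hXi hHX in
/-- The value of the differential at `m_{λ(J)}` has weight `λ(J)` and is killed by all `e_i`. -/
theorem bggDiff_singular (t : ℕ) (J : {J : Finset (Fin k) // J.card = t + 1}) :
    K.bggDiff lam H t J ∈ K.weightSpace (K.BGG lam H t) (R.lamH lam (unionH H J.1)) ∧
      ∀ i, K.ι (K.e i) • K.bggDiff lam H t J = 0 := by
  obtain ⟨B⟩ := K.exists_negBasis X
  have key : ∀ (j : {j // j ∈ J.1}) (J' : {J : Finset (Fin k) // J.card = t}),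
      J'.1 = J.1.erase j.1 →
      K.fH lam (H j.1 \ unionH H (J.1.erase j.1)) • K.bggVec lam H t J' ∈
        K.weightSpace (K.BGG lam H t) (R.lamH lam (unionH H J.1)) ∧
      ∀ i, K.ι (K.e i) • K.fH lam (H j.1 \ unionH H (J.1.erase j.1)) • K.bggVec lam H t J' = 0 := by
    rintro ⟨j, hj⟩ J' hJ'
    have hsub : ((H j \ unionH H (J.1.erase j) : Finset I) : Set I) ⊆ X :=
      (Finset.coe_subset.mpr Finset.sdiff_subset).trans (hHX j)
    have := fH_smul_singular (lam := lam) (K.bggVec_mem t J') (K.ι_e_smul_bggVec t J')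
      (hX.subset hsub) (by
        intro i hi
        rw [R.expo_eq (hXi (hsub hi)), hJ', R.lamH_coroot hX lam (unionH_subset hHX _) (hsub hi)
          (Finset.mem_sdiff.mp hi).2])
    rw [hJ', B.lamH_eq lam ((unionH_subset hHX _).trans hXi), ← B.wtSum_mulS, sub_sub,
      ← Realization.rootSum_add, ← B.wtSum_add, add_comm (B.mulS lam _), B.mulS_sdiff_add,
      union_unionH_erase hj, ← B.lamH_eq lam ((unionH_subset hHX _).trans hXi)] at this
    exact this
  constructor
  · refine Submodule.sum_mem _ fun j _ => ?_
    exact Submodule.smul_of_tower_mem _ _ (key j _ rfl).1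
  · intro i
    rw [bggDiff, Finset.smul_sum]
    refine Finset.sum_eq_zero fun j _ => ?_
    rw [smul_comm, (key j _ rfl).2, smul_zero]

include hX hXi hHX in
variable (K) in
theorem exists_differential (t : ℕ) : ∃ d : K.BGG lam H (t + 1) →ₗ[K.U] K.BGG lam H t,
    ∀ J, d (K.bggVec lam H (t + 1) J) = K.bggDiff lam H t J := by
  have h := fun J => bggDiff_singular (K := K) hX hXi hHX t J
  choose φ hφ using fun J => K.exists_verma_hom (h J).1 (h J).2
  refine ⟨DirectSum.toModule K.U _ _ φ, fun J => ?_⟩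
  rw [bggVec_eq, DirectSum.toModule_lof]
  exact hφ J

/-! ### Monomial bases of the terms -/

variable (B : K.NegBasis X)

open Classical in
/-- The indices `j` such that the monomial `p` is divisible by `𝐟_{H_j}`. -/
def divisors (lam : Module.Dual ℂ 𝔥) (H : Fin k → Finset I) (p : Multiset B.ι) :
    Finset (Fin k) := Finset.univ.filter fun j => B.mulS lam (H j) ≤ p

theorem subset_divisors_iff {J : Finset (Fin k)} {p : Multiset B.ι} :
    J ⊆ divisors B lam H p ↔ B.mulS lam (unionH H J) ≤ p := by
  classical
  rw [B.mulS_le_iff]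
  constructor
  · intro h i hi
    obtain ⟨j, hj, hij⟩ := Finset.mem_biUnion.mp hi
    have h1 := (Finset.mem_filter.mp (h hj)).2
    rw [B.mulS_le_iff] at h1
    exact h1 i hij
  · intro h j hj
    refine Finset.mem_filter.mpr ⟨Finset.mem_univ j, ?_⟩
    rw [B.mulS_le_iff]
    exact fun i hi => h i (Finset.mem_biUnion.mpr ⟨j, hj, hi⟩)

open Classical in
/-- The monomial `M` in the summand `M(λ(J))` is placed at the multidegree `M 𝐟_{H_J}`. -/
def simplexEquiv (lam : Module.Dual ℂ 𝔥) (H : Fin k → Finset I) (t : ℕ) :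
    (Σ _ : {J : Finset (Fin k) // J.card = t}, Multiset B.ι) ≃
      SimplexComplex.Simplex (divisors B lam H) t where
  toFun x := ⟨(x.1.1, x.2 + B.mulS lam (unionH H x.1.1)),
    x.1.2, (subset_divisors_iff B).mpr (Multiset.le_add_left _ _)⟩
  invFun x := ⟨⟨x.1.1, x.2.1⟩, x.1.2 - B.mulS lam (unionH H x.1.1)⟩
  left_inv x := by simp
  right_inv x := Subtype.ext (Prod.ext rfl
    (Multiset.sub_add_cancel ((subset_divisors_iff B).mp x.2.2)))

/-- The basis of the `t`-th term consisting of monomials. -/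
def bggBasis (lam : Module.Dual ℂ 𝔥) (H : Fin k → Finset I) (t : ℕ) :
    Module.Basis (SimplexComplex.Simplex (divisors B lam H) t) ℂ (K.BGG lam H t) :=
  (DFinsupp.basis fun J : {J : Finset (Fin k) // J.card = t} =>
    B.vermaBasis (R.lamH lam (unionH H J))).reindex (simplexEquiv B lam H t)

theorem vec_bggBasis {t : ℕ} {J : Finset (Fin k)} (hJ : J.card = t) (M : Multiset B.ι) :
    SimplexComplex.vec (bggBasis B lam H) t J (M + B.mulS lam (unionH H J)) =
      K.minusMap (PBW.mono B.basis M) • K.bggVec lam H t ⟨J, hJ⟩ := by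
  rw [SimplexComplex.vec,
    dif_pos ⟨hJ, (subset_divisors_iff B).mpr (Multiset.le_add_left _ _)⟩, bggBasis,
    Module.Basis.reindex_apply]
  have : (simplexEquiv B lam H t).symm ⟨(J, M + B.mulS lam (unionH H J)),
      hJ, (subset_divisors_iff B).mpr (Multiset.le_add_left _ _)⟩ = ⟨⟨J, hJ⟩, M⟩ := by
    rw [Equiv.symm_apply_eq]
    rfl
  rw [this, bggVec_eq, ← map_smul, ← B.vermaBasis_apply]
  exact DirectSum.basis_eq_lof _ _ _

include hX hHX in
/-- On the monomials of a fixed multidegree `p`, the differential is the boundary map of a full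
simplex. -/
theorem isBoundary_differential {d : ∀ t, K.BGG lam H (t + 1) →ₗ[K.U] K.BGG lam H t}
    (hd : ∀ t J, d t (K.bggVec lam H (t + 1) J) = K.bggDiff lam H t J) :
    SimplexComplex.IsBoundary (V := fun t => K.BGG lam H t) (bggBasis B lam H)
      fun t => (d t).restrictScalars ℂ := by
  intro t J p hJ hJp
  rw [LinearMap.restrictScalars_apply]
  obtain ⟨M, rfl⟩ : ∃ M, p = M + B.mulS lam (unionH H J) := by
    obtain ⟨M, hM⟩ := Multiset.le_iff_exists_add.mp ((subset_divisors_iff B).mp hJp)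
    exact ⟨M, hM.trans (add_comm _ _)⟩
  rw [vec_bggBasis B hJ, map_smul, hd, bggDiff, Finset.smul_sum, ← Finset.sum_coe_sort J]
  refine Finset.sum_congr rfl fun j _ => ?_
  obtain ⟨j, hj⟩ := j
  have hsub : ((H j \ unionH H (J.erase j) : Finset I) : Set I) ⊆ X :=
    (Finset.coe_subset.mpr Finset.sdiff_subset).trans (hHX j)
  have hp : M + B.mulS lam (unionH H J) =
      (M + B.mulS lam (H j \ unionH H (J.erase j))) + B.mulS lam (unionH H (J.erase j)) := by
    rw [add_assoc, B.mulS_sdiff_add, union_unionH_erase hj]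
  rw [hp, vec_bggBasis B (by rw [Finset.card_erase_of_mem hj, hJ]; rfl),
    ← B.minusMap_mono_mul_fH lam hX hsub, mul_smul]
  exact smul_comm _ _ _

include hX hHX in
theorem exact_differential {d : ∀ t, K.BGG lam H (t + 1) →ₗ[K.U] K.BGG lam H t}
    (hd : ∀ t J, d t (K.bggVec lam H (t + 1) J) = K.bggDiff lam H t J) (t : ℕ) :
    Function.Exact (d (t + 1)) (d t) := by
  obtain ⟨B⟩ := K.exists_negBasis X
  exact SimplexComplex.exact (V := fun t => K.BGG lam H t) (bggBasis B lam H)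
    (d := fun t => (d t).restrictScalars ℂ)
    (isBoundary_differential hX hHX B hd) t

end Complex

/-! ### The augmentation -/

section Augmentation

variable {K : KMAlgebra R 𝔤} {lam : Module.Dual ℂ 𝔥} {k : ℕ} {H : Fin k → Finset I}
  {𝓗 : Set (Finset I)} (h𝓗 : 𝓗 ⊆ Indep A (R.integrability lam))
  (hmin : Set.range H = {S | Minimal (fun S => S ∈ 𝓗) S})

include hmin in
theorem H_mem (j : Fin k) : H j ∈ 𝓗 :=
  ((hmin ▸ Set.mem_range_self j : H j ∈ {S | Minimal (fun S => S ∈ 𝓗) S})).prop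

include h𝓗 hmin in
theorem holeSubmodule_eq : K.holeSubmodule lam 𝓗 =
    Submodule.span K.U (Set.range fun j => K.fH lam (H j) • K.vermaVec lam) := by
  apply le_antisymm
  · rw [holeSubmodule, Submodule.span_le]
    rintro _ ⟨S, hS, rfl⟩
    obtain ⟨S', hle, hS'⟩ := exists_minimal_le_of_wellFoundedLT (fun S => S ∈ 𝓗) S hS
    obtain ⟨j, rfl⟩ : S' ∈ Set.range H := hmin ▸ hS'
    have h1 : S \ H j ∪ H j = S := Finset.sdiff_union_of_subset hle
    have h2 := K.fH_union lam (S := S \ H j) (S' := H j) Finset.sdiff_disjoint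
      (by rw [h1]; exact (h𝓗 hS).1)
    rw [h1] at h2
    dsimp only
    rw [h2, mul_smul]
    exact Submodule.smul_mem _ _ (Submodule.subset_span ⟨j, rfl⟩)
  · rw [Submodule.span_le]
    rintro _ ⟨j, rfl⟩
    exact Submodule.subset_span ⟨H j, H_mem hmin j, rfl⟩

theorem unionH_empty (H : Fin k → Finset I) : unionH H ∅ = ∅ := rfl

theorem lamH_empty (lam : Module.Dual ℂ 𝔥) : R.lamH lam ∅ = lam := by
  rw [Realization.lamH, Finset.sum_empty, sub_zero]

variable (K) in
theorem exists_augmentation (lam : Module.Dual ℂ 𝔥) (H : Fin k → Finset I)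
    (𝓗 : Set (Finset I)) : ∃ ε : K.BGG lam H 0 →ₗ[K.U] K.HigherVerma lam 𝓗,
      ε (K.bggVec lam H 0 ⟨∅, rfl⟩) = (K.holeSubmodule lam 𝓗).mkQ (K.vermaVec lam) := by
  have h : ∀ J : {J : Finset (Fin k) // J.card = 0}, (K.holeSubmodule lam 𝓗).mkQ (K.vermaVec lam) ∈
      K.weightSpace (K.HigherVerma lam 𝓗) (R.lamH lam (unionH H J.1)) := by
    rintro ⟨J, hJ⟩
    obtain rfl := Finset.card_eq_zero.mp hJ
    rw [unionH_empty, lamH_empty]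
    exact map_mem_weightSpace _ (K.vermaVec_mem lam)
  have h' : ∀ i, K.ι (K.e i) • (K.holeSubmodule lam 𝓗).mkQ (K.vermaVec lam) = 0 := fun i => by
    rw [← map_smul, ι_e_smul_vermaVec, map_zero]
  choose φ hφ using fun J => K.exists_verma_hom (h J) h'
  refine ⟨DirectSum.toModule K.U _ _ φ, ?_⟩
  rw [bggVec_eq, DirectSum.toModule_lof]
  exact hφ _

theorem bggVec_zero (J : {J : Finset (Fin k) // J.card = 0}) :
    K.bggVec lam H 0 J = K.bggVec lam H 0 ⟨∅, rfl⟩ := by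
  congr 1
  exact Subtype.ext (Finset.card_eq_zero.mp J.2)

theorem bggDiff_zero (j : Fin k) : K.bggDiff lam H 0 ⟨{j}, rfl⟩ =
    K.fH lam (H j) • K.bggVec lam H 0 ⟨∅, rfl⟩ := by
  rw [bggDiff]
  have : ∀ x : {i // i ∈ ({j} : Finset (Fin k))}, x = ⟨j, Finset.mem_singleton_self j⟩ :=
    fun x => Subtype.ext (Finset.mem_singleton.mp x.2)
  rw [Finset.sum_eq_single ⟨j, Finset.mem_singleton_self j⟩ (fun x _ hx => absurd (this x) hx)
    (fun h => absurd (Finset.mem_univ _) h), bggVec_zero]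
  have h1 : (({j} : Finset (Fin k)).filter (· < j)).card = 0 := by simp
  rw [h1, pow_zero, one_smul, Finset.erase_singleton, unionH, Finset.biUnion_empty,
    Finset.sdiff_empty]

include h𝓗 hmin in
theorem augmentation_properties {ε : K.BGG lam H 0 →ₗ[K.U] K.HigherVerma lam 𝓗}
    {d : K.BGG lam H 1 →ₗ[K.U] K.BGG lam H 0}
    (hε : ε (K.bggVec lam H 0 ⟨∅, rfl⟩) = (K.holeSubmodule lam 𝓗).mkQ (K.vermaVec lam))
    (hd : ∀ J, d (K.bggVec lam H 1 J) = K.bggDiff lam H 0 J) :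
    Function.Surjective ε ∧ Function.Exact d ε := by
  have hd1 : ∀ j, d (K.bggVec lam H 1 ⟨{j}, rfl⟩) =
      K.fH lam (H j) • K.bggVec lam H 0 ⟨∅, rfl⟩ := fun j => by rw [hd, bggDiff_zero]
  -- the identification of the single summand `M(λ(∅))` of the zeroth term with `M(λ)`
  have hmem : K.bggVec lam H 0 ⟨∅, rfl⟩ ∈ K.weightSpace (K.BGG lam H 0) lam := by
    have := K.bggVec_mem (lam := lam) (H := H) 0 ⟨∅, rfl⟩
    rwa [unionH_empty, lamH_empty] at this
  obtain ⟨ψ, hψ⟩ := K.exists_verma_hom hmem (K.ι_e_smul_bggVec 0 ⟨∅, rfl⟩)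
  have hεψ : ε.comp ψ = (K.holeSubmodule lam 𝓗).mkQ := verma_hom_ext (by
    rw [LinearMap.comp_apply, hψ, hε])
  have hψs : Function.Surjective ψ := by
    intro x
    obtain ⟨c, hc, -⟩ := K.existsUnique_bgg 0 x
    refine ⟨∑ J, K.minusMap (c J) • K.vermaVec lam, ?_⟩
    rw [hc, map_sum]
    refine Finset.sum_congr rfl fun J _ => ?_
    rw [map_smul, hψ, bggVec_zero J]
  constructor
  · intro y
    obtain ⟨v, rfl⟩ := (K.holeSubmodule lam 𝓗).mkQ_surjective y
    exact ⟨ψ v, by rw [← hεψ]; rfl⟩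
  · intro x
    constructor
    · intro hx
      obtain ⟨v, rfl⟩ := hψs x
      have hv : v ∈ K.holeSubmodule lam 𝓗 := by
        rw [← (K.holeSubmodule lam 𝓗).ker_mkQ, ← hεψ]
        exact hx
      rw [holeSubmodule_eq h𝓗 hmin] at hv
      have hle : Submodule.span K.U (Set.range fun j => K.fH lam (H j) • K.vermaVec lam) ≤
          (LinearMap.range d).comap ψ := by
        rw [Submodule.span_le]
        rintro _ ⟨j, rfl⟩
        refine ⟨K.bggVec lam H 1 ⟨{j}, rfl⟩, ?_⟩
        rw [hd1, map_smul, hψ]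
      exact hle hv
    · rintro ⟨y, rfl⟩
      have h0 : ε.comp d = 0 := by
        refine bgg_hom_ext fun J => ?_
        obtain ⟨J, hJ⟩ := J
        obtain ⟨j, rfl⟩ := Finset.card_eq_one.mp hJ
        rw [LinearMap.comp_apply, hd1, map_smul, hε, ← map_smul, LinearMap.zero_apply,
          Submodule.mkQ_apply, Submodule.Quotient.mk_eq_zero]
        exact Submodule.subset_span ⟨H j, H_mem hmin j, rfl⟩
      exact LinearMap.congr_fun h0 y

end Augmentation

end KMAlgebra

end KacMoody

end

noncomputable section

set_option linter.unusedSectionVars false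

/-! ### Quotients by coordinate subspaces -/

section QuotientBasis

variable {U V κ : Type*} [Ring U] [Algebra ℂ U] [AddCommGroup V] [Module ℂ V] [Module U V]
  [IsScalarTower ℂ U V]

/-- If a submodule is spanned by some of the vectors of a basis, then the others give a basis of the
quotient. -/
theorem exists_quotientBasis (b : Module.Basis κ ℂ V) {N : Submodule U V} {Z : Set κ}
    (h : N.restrictScalars ℂ = Submodule.span ℂ (b '' Z)) :
    ∃ c : Module.Basis {x // x ∉ Z} ℂ (V ⧸ N), ∀ x, c x = N.mkQ (b x) := by
  let f : V →ₗ[ℂ] V ⧸ N := N.mkQ.restrictScalars ℂ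
  have hf : LinearMap.ker f = Submodule.span ℂ (b '' Z) := by
    rw [← h]
    ext v
    simp [f]
  have hr : (Set.range fun x : {x // x ∉ Z} => b x) = b '' Zᶜ := by
    ext v; simp
  have hli : LinearIndependent ℂ fun x : {x // x ∉ Z} => f (b x) := by
    refine (b.linearIndependent.comp _ Subtype.val_injective).map ?_
    change Disjoint (Submodule.span ℂ (Set.range fun x : {x // x ∉ Z} => b x)) _
    rw [hf, hr]
    exact b.linearIndependent.disjoint_span_image disjoint_compl_left
  have hsp : ⊤ ≤ Submodule.span ℂ (Set.range fun x : {x // x ∉ Z} => f (b x)) := by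
    have h1 : (⊤ : Submodule ℂ (V ⧸ N)) = (⊤ : Submodule ℂ V).map f := by
      rw [Submodule.map_top, LinearMap.range_eq_top.mpr]
      exact N.mkQ_surjective
    rw [h1, ← b.span_eq, Submodule.map_span, Submodule.span_le]
    rintro _ ⟨_, ⟨x, rfl⟩, rfl⟩
    by_cases hx : x ∈ Z
    · have h2 : b x ∈ LinearMap.ker f := hf ▸ Submodule.subset_span ⟨x, hx, rfl⟩
      rw [SetLike.mem_coe, LinearMap.mem_ker.mp h2]
      exact zero_mem _
    · exact Submodule.subset_span ⟨⟨x, hx⟩, rfl⟩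
  exact ⟨Module.Basis.mk hli hsp, fun x => Module.Basis.mk_apply hli hsp x⟩

end QuotientBasis

namespace KacMoody

attribute [local instance 100] LieRing.ofAssociativeRing

universe u v w

variable {I : Type u} [Fintype I] [DecidableEq I] {A : Matrix I I ℤ}
  {𝔥 : Type v} [AddCommGroup 𝔥] [Module ℂ 𝔥] [FiniteDimensional ℂ 𝔥]
  {R : Realization A 𝔥} {𝔤 : Type w} [LieRing 𝔤] [LieAlgebra ℂ 𝔤]

namespace KMAlgebra

variable {K : KMAlgebra R 𝔤} {lam : Module.Dual ℂ 𝔥} {k : ℕ} {H : Fin k → Finset I} {X : Set I}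
  (hX : IsIndep A X) (hXi : X ⊆ R.integrability lam) (hHX : ∀ j, (H j : Set I) ⊆ X)
  {𝓗 : Set (Finset I)} (h𝓗 : 𝓗 ⊆ Indep A (R.integrability lam))
  (hmin : Set.range H = {S | Minimal (fun S => S ∈ 𝓗) S}) (B : K.NegBasis X)

/-! ### The character of a higher order Verma module -/

include hX hXi hHX h𝓗 hmin in
/-- The submodule by which one divides is spanned by the monomials divisible by some `𝐟_{H_j}`. -/
theorem holeSubmodule_eq_span : (K.holeSubmodule lam 𝓗).restrictScalars ℂ =
    Submodule.span ℂ (B.vermaBasis lam '' {M | (divisors B lam H M).Nonempty}) := by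
  apply le_antisymm
  · rw [holeSubmodule_eq h𝓗 hmin]
    -- each generator is a singular vector, hence the image of a highest weight vector
    have hφ : ∀ j, ∃ φ : K.Verma (R.lamH lam (H j)) →ₗ[K.U] K.Verma lam,
        φ (K.vermaVec _) = K.fH lam (H j) • K.vermaVec lam := by
      intro j
      have := fH_smul_singular (lam := lam) (K.vermaVec_mem lam) (K.ι_e_smul_vermaVec lam)
        (hX.subset (hHX j)) (fun i hi => R.expo_eq (hXi (hHX j hi)))
      rw [← B.wtSum_mulS, ← B.lamH_eq lam ((hHX j).trans hXi)] at this
      exact K.exists_verma_hom this.1 this.2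
    have key : ∀ v ∈ Submodule.span K.U
        (Set.range fun j => K.fH lam (H j) • K.vermaVec lam), ∀ u : K.U, u • v ∈
        Submodule.span ℂ (B.vermaBasis lam '' {M | (divisors B lam H M).Nonempty}) := by
      intro v hv
      induction hv using Submodule.span_induction with
      | mem _ hv =>
        obtain ⟨j, rfl⟩ := hv
        obtain ⟨φ, hφ⟩ := hφ j
        intro u
        dsimp only
        rw [← hφ, ← map_smul]
        have hle : Submodule.span ℂ (Set.range (B.vermaBasis (R.lamH lam (H j)))) ≤
            (Submodule.span ℂ (B.vermaBasis lam '' {M | (divisors B lam H M).Nonempty})).comap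
              (φ.restrictScalars ℂ) := by
          rw [Submodule.span_le]
          rintro _ ⟨M, rfl⟩
          change φ (B.vermaBasis _ M) ∈
            Submodule.span ℂ (B.vermaBasis lam '' {M | (divisors B lam H M).Nonempty})
          rw [B.vermaBasis_apply, map_smul, hφ, B.minusMap_mono_smul_fH lam hX (hHX j)]
          refine Submodule.subset_span ⟨_, ⟨j, ?_⟩, rfl⟩
          exact Finset.mem_filter.mpr ⟨Finset.mem_univ j, Multiset.le_add_left _ _⟩
        exact hle (Module.Basis.mem_span _ _)
      | zero => intro u; rw [smul_zero]; exact zero_mem _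
      | add x y _ _ hx hy => intro u; rw [smul_add]; exact add_mem (hx u) (hy u)
      | smul c x _ hx => intro u; rw [← mul_smul]; exact hx _
    intro v hv
    have := key v hv 1
    rwa [one_smul] at this
  · rw [Submodule.span_le]
    rintro _ ⟨M, ⟨j, hj⟩, rfl⟩
    have hj' : B.mulS lam (H j) ≤ M := by
      classical
      exact (Finset.mem_filter.mp hj).2
    obtain ⟨N, rfl⟩ := Multiset.le_iff_exists_add.mp hj'
    rw [add_comm, ← B.minusMap_mono_smul_fH lam hX (hHX j)]
    exact Submodule.smul_mem (K.holeSubmodule lam 𝓗) _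
      (Submodule.subset_span ⟨H j, H_mem hmin j, rfl⟩)

include hX hXi hHX h𝓗 hmin in
theorem exists_higherVermaBasis :
    ∃ c : Module.Basis {M // M ∉ {M | (divisors B lam H M).Nonempty}} ℂ (K.HigherVerma lam 𝓗),
      ∀ M, c M ∈ K.weightSpace (K.HigherVerma lam 𝓗) (lam - R.rootSum (B.wtSum M.1)) := by
  obtain ⟨c, hc⟩ := exists_quotientBasis (B.vermaBasis lam)
    (holeSubmodule_eq_span hX hXi hHX h𝓗 hmin B)
  refine ⟨c, fun M => ?_⟩
  rw [hc]
  exact map_mem_weightSpace _ (B.vermaBasis_mem lam M.1)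

include hX hXi hHX h𝓗 hmin in
theorem hasCharacter_higherVerma : K.HasCharacter (K.HigherVerma lam 𝓗) := by
  obtain ⟨B⟩ := K.exists_negBasis X
  obtain ⟨c, hc⟩ := exists_higherVermaBasis hX hXi hHX h𝓗 hmin B
  exact K.hasCharacter_of_basis c hc fun μ =>
    (B.finite_weight lam μ).preimage Subtype.val_injective.injOn

include hX hXi hHX h𝓗 hmin in
/-- The character counts the monomials which are divisible by no `𝐟_{H_j}`. -/
theorem ch_higherVerma : K.ch (K.HigherVerma lam 𝓗) = ∑ J : Finset (Fin k),
    (-1 : ℤ) ^ J.card • K.ch (K.Verma (R.lamH lam (unionH H J))) := by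
  classical
  obtain ⟨B⟩ := K.exists_negBasis X
  obtain ⟨c, hc⟩ := exists_higherVermaBasis hX hXi hHX h𝓗 hmin B
  funext ν
  set F := (B.finite_weight lam ν).toFinset with hF
  have hmemF : ∀ M, M ∈ F ↔ lam - R.rootSum (B.wtSum M) = ν := fun M => by simp [hF]
  have h1 : K.ch (K.HigherVerma lam 𝓗) ν =
      ((F.filter fun M => divisors B lam H M = ∅).card : ℤ) := by
    rw [K.ch_of_basis c hc, ← Nat.card_eq_finsetCard]
    congr 1
    refine Nat.card_congr ((Equiv.subtypeSubtypeEquivSubtypeInter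
      (fun M => M ∉ {M | (divisors B lam H M).Nonempty})
      (fun M => lam - R.rootSum (B.wtSum M) = ν)).trans (Equiv.subtypeEquivRight fun M => ?_))
    rw [Finset.mem_filter, hmemF, Set.mem_ofPred_eq, Finset.not_nonempty_iff_eq_empty, and_comm]
  have h2 : ∀ J : Finset (Fin k), K.ch (K.Verma (R.lamH lam (unionH H J))) ν =
      ((F.filter fun M => J ⊆ divisors B lam H M).card : ℤ) := by
    intro J
    rw [K.ch_of_basis (B.vermaBasis _) (B.vermaBasis_mem _), ← Nat.card_eq_finsetCard]
    congr 1
    have hw : ∀ M, R.lamH lam (unionH H J) - R.rootSum (B.wtSum M) =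
        lam - R.rootSum (B.wtSum (M + B.mulS lam (unionH H J))) := fun M => by
      rw [B.lamH_eq lam ((unionH_subset hHX _).trans hXi), sub_sub, ← Realization.rootSum_add,
        ← B.wtSum_add, add_comm]
    have hmem : ∀ M : {M // R.lamH lam (unionH H J) - R.rootSum (B.wtSum M) = ν},
        M.1 + B.mulS lam (unionH H J) ∈ F.filter fun M => J ⊆ divisors B lam H M := fun M => by
      rw [Finset.mem_filter, hmemF, ← hw, subset_divisors_iff]
      exact ⟨M.2, Multiset.le_add_left _ _⟩
    refine Nat.card_congr (Equiv.ofBijective (fun M => ⟨_, hmem M⟩) ⟨fun M N h => ?_, ?_⟩)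
    · exact Subtype.ext (add_right_cancel (Subtype.ext_iff.mp h))
    · rintro ⟨p, hp⟩
      rw [Finset.mem_filter, hmemF, subset_divisors_iff] at hp
      obtain ⟨M, rfl⟩ := Multiset.le_iff_exists_add.mp hp.2
      exact ⟨⟨M, by rw [hw, add_comm]; exact hp.1⟩, Subtype.ext (add_comm _ _)⟩
  rw [h1, Finset.sum_apply]
  simp only [Pi.smul_apply, h2, smul_eq_mul, Finset.card_filter, Nat.cast_sum, Finset.mul_sum]
  rw [Finset.sum_comm]
  refine Finset.sum_congr rfl fun M _ => ?_
  -- inclusion–exclusion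
  have h3 := Finset.sum_powerset_neg_one_pow_card (x := divisors B lam H M)
  rw [← Finset.filter_subset_univ, Finset.sum_filter] at h3
  rw [Nat.cast_ite, Nat.cast_one, Nat.cast_zero, ← h3]
  refine Finset.sum_congr rfl fun J _ => ?_
  split_ifs <;> simp

end KMAlgebra

end KacMoody

end

noncomputable section

set_option linter.unusedSectionVars false

namespace KacMoody

attribute [local instance 100] LieRing.ofAssociativeRing

universe u v w

variable {I : Type u} [Fintype I] [DecidableEq I] {A : Matrix I I ℤ}
  {𝔥 : Type v} [AddCommGroup 𝔥] [Module ℂ 𝔥] [FiniteDimensional ℂ 𝔥]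
  {R : Realization A 𝔥}

/-! ### Products of orthogonal simple reflections -/

namespace Realization

theorem sH_empty : R.sH ∅ = 1 := by
  rw [sH]
  split_ifs
  · exact Finset.noncommProd_empty _ _
  · rfl

theorem sH_insert {i : I} {S : Finset I} (hi : i ∉ S) (hS : IsIndep A (insert i S : Set I)) :
    R.sH (insert i S) = R.simpleReflection i * R.sH S := by
  classical
  have h1 : IsIndep A ((insert i S : Finset I) : Set I) := by rwa [Finset.coe_insert]
  rw [sH, dif_pos h1, sH, dif_pos (hS.subset (Set.subset_insert _ _))]
  exact Finset.noncommProd_insert_of_notMem _ _ _ _ hi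

theorem simpleReflection_apply (i : I) (μ : Module.Dual ℂ 𝔥) :
    R.simpleReflection i μ = μ - μ (R.coroot i) • R.root i := by
  rw [simpleReflection, Module.reflection_apply, Module.Dual.eval_apply]

theorem sH_apply {S : Finset I} (hS : IsIndep A (S : Set I)) (μ : Module.Dual ℂ 𝔥) :
    R.sH S μ = μ - ∑ h ∈ S, μ (R.coroot h) • R.root h := by
  induction S using Finset.induction_on with
  | empty => rw [sH_empty, Finset.sum_empty, sub_zero]; rfl
  | insert i S hi ih =>
    rw [Finset.coe_insert] at hS
    rw [sH_insert hi hS, LinearEquiv.mul_apply, ih (hS.subset (Set.subset_insert _ _)),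
      simpleReflection_apply, Finset.sum_insert hi]
    have h0 : (∑ h ∈ S, μ (R.coroot h) • R.root h) (R.coroot i) = 0 := by
      rw [LinearMap.sum_apply]
      refine Finset.sum_eq_zero fun h hh => ?_
      rw [LinearMap.smul_apply, R.pairing, hS (Set.mem_insert _ _) (Set.mem_insert_of_mem _ hh)
        (fun e => hi (e ▸ hh)), Int.cast_zero, smul_zero]
    rw [LinearMap.sub_apply, h0, sub_zero]
    abel

theorem dot_sH {S : Finset I} (hS : IsIndep A (S : Set I)) {ρ : Module.Dual ℂ 𝔥}
    (hρ : ∀ i, ρ (R.coroot i) = 1) (lam : Module.Dual ℂ 𝔥) :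
    R.dot ρ (R.sH S) lam = R.lamH lam S := by
  rw [dot, sH_apply hS, lamH]
  simp only [LinearMap.add_apply, hρ]
  abel

/-- The coefficients of a linear combination of simple roots determine its support. -/
theorem eq_of_sum_smul_root_eq {S T : Finset I} {c : I → ℂ} (hc : ∀ i ∈ S ∪ T, c i ≠ 0)
    (h : ∑ i ∈ S, c i • R.root i = ∑ i ∈ T, c i • R.root i) : S = T := by
  have h1 : ∀ S : Finset I, ∑ i ∈ S, c i • R.root i =
      ∑ i, (if i ∈ S then c i else 0) • R.root i := fun S => by
    simp [ite_smul, Finset.sum_ite_mem]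
  rw [h1, h1, ← sub_eq_zero, ← Finset.sum_sub_distrib] at h
  simp only [← sub_smul] at h
  have h2 := Fintype.linearIndependent_iff.mp R.root_linearIndependent _ h
  ext i
  have h3 := h2 i
  have h4 := hc i
  rw [Finset.mem_union] at h4
  by_cases hS : i ∈ S <;> by_cases hT : i ∈ T <;> simp_all

theorem lamH_injOn {lam : Module.Dual ℂ 𝔥} {S T : Finset I} (hS : (S : Set I) ⊆ R.integrability lam)
    (hT : (T : Set I) ⊆ R.integrability lam) (h : R.lamH lam S = R.lamH lam T) : S = T := by
  refine eq_of_sum_smul_root_eq (R := R) (c := fun i => lam (R.coroot i) + 1) (fun i hi => ?_)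
    (sub_right_inj.mp h)
  have hi' : i ∈ R.integrability lam := by
    rcases Finset.mem_union.mp hi with hi | hi
    · exact hS hi
    · exact hT hi
  rw [← R.expo_eq hi', Nat.cast_ne_zero, expo]
  exact Nat.succ_ne_zero _

/-- Different independent sets give different elements of the Weyl group, as they act differently on
a Weyl vector. -/
theorem sH_injOn {ρ : Module.Dual ℂ 𝔥} (hρ : ∀ i, ρ (R.coroot i) = 1) {S T : Finset I}
    (hS : IsIndep A (S : Set I)) (hT : IsIndep A (T : Set I)) (h : R.sH S = R.sH T) : S = T := by
  have h1 := congr($h ρ)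
  rw [sH_apply hS, sH_apply hT] at h1
  simp only [hρ] at h1
  exact eq_of_sum_smul_root_eq (R := R) (c := fun _ => 1) (fun _ _ => one_ne_zero)
    (sub_right_inj.mp h1)

theorem sH_mem_weylGroup (S : Finset I) : R.sH S ∈ R.weylGroup := by
  classical
  rw [sH]
  split_ifs
  · exact Subgroup.noncommProd_mem _ _ fun i _ => Subgroup.subset_closure ⟨i, rfl⟩
  · exact one_mem _

/-- The simple reflections in `X` commute and are involutions, so products over subsets of `X`
multiply by symmetric difference. -/
theorem sH_mul_sH {X : Set I} (hX : IsIndep A X) {S T : Finset I} (hS : (S : Set I) ⊆ X)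
    (hT : (T : Set I) ⊆ X) : R.sH S * R.sH T = R.sH (symmDiff S T) := by
  refine LinearEquiv.ext fun μ => ?_
  have hST : ((symmDiff S T : Finset I) : Set I) ⊆ X := fun i hi => by
    rcases Finset.mem_symmDiff.mp hi with h | h
    · exact hS h.1
    · exact hT h.1
  rw [LinearEquiv.mul_apply, sH_apply (hX.subset hT), sH_apply (hX.subset hS),
    sH_apply (hX.subset hST)]
  have h1 : ∀ i ∈ S, (μ - ∑ h ∈ T, μ (R.coroot h) • R.root h) (R.coroot i) =
      if i ∈ T then -μ (R.coroot i) else μ (R.coroot i) := by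
    intro i hi
    have h2 : ∀ h ∈ T, (μ (R.coroot h) • R.root h) (R.coroot i) =
        if h = i then 2 * μ (R.coroot i) else 0 := by
      intro h hh
      rw [LinearMap.smul_apply, R.pairing]
      split_ifs with e
      · rw [e, R.isGCM.diag, smul_eq_mul]; push_cast; ring
      · rw [hX (hS hi) (hT hh) (Ne.symm e), Int.cast_zero, smul_zero]
    rw [LinearMap.sub_apply, LinearMap.sum_apply, Finset.sum_congr rfl h2, Finset.sum_ite_eq']
    split_ifs <;> ring
  rw [Finset.sum_congr
    (f := fun h => (μ - ∑ h ∈ T, μ (R.coroot h) • R.root h) (R.coroot h) • R.root h) rfl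
    (fun i hi => congrArg (· • R.root i) (h1 i hi)), sub_sub]
  congr 1
  have h2 : ∀ S : Finset I, ∀ c : I → ℂ, ∑ i ∈ S, c i • R.root i =
      ∑ i, (if i ∈ S then c i else 0) • R.root i := fun S c => by
    simp [ite_smul, Finset.sum_ite_mem]
  rw [h2, h2 S, h2 (symmDiff S T), ← Finset.sum_add_distrib]
  refine Finset.sum_congr rfl fun i _ => ?_
  rw [← add_smul]
  congr 1
  simp only [Finset.mem_symmDiff]
  by_cases hS : i ∈ S <;> by_cases hT : i ∈ T <;> simp [hS, hT]

end Realization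

/-! ### Unions of pairwise disjoint sets -/

section Union

variable {k : ℕ} {H : Fin k → Finset I}

theorem unionH_singleton (j : Fin k) : unionH H {j} = H j := Finset.singleton_biUnion

theorem mem_unionH {J : Finset (Fin k)} {i : I} : i ∈ unionH H J ↔ ∃ j ∈ J, i ∈ H j :=
  Finset.mem_biUnion

theorem disjoint_of_orthogonal (hA : IsGCM A)
    (horth : Pairwise fun a b => Orthogonal A (H a) (H b)) :
    Pairwise fun a b => Disjoint (H a) (H b) := fun a b hab =>
  Finset.disjoint_left.mpr fun i hia hib => by
    have h1 := horth hab i hia i hib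
    rw [hA.diag] at h1
    exact two_ne_zero h1

theorem mem_unionH_iff (hd : Pairwise fun a b => Disjoint (H a) (H b)) {J : Finset (Fin k)}
    {i : I} {j : Fin k} (hi : i ∈ H j) : i ∈ unionH H J ↔ j ∈ J := by
  rw [mem_unionH]
  refine ⟨fun ⟨l, hl, hil⟩ => ?_, fun hj => ⟨j, hj, hi⟩⟩
  by_contra hj
  exact Finset.disjoint_left.mp (hd fun e : l = j => hj (e ▸ hl)) hil hi

theorem unionH_injective (hd : Pairwise fun a b => Disjoint (H a) (H b))
    (hne : ∀ j, (H j).Nonempty) : Function.Injective (unionH H) := by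
  intro J L h
  ext j
  obtain ⟨i, hi⟩ := hne j
  rw [← mem_unionH_iff hd hi, h, mem_unionH_iff hd hi]

theorem unionH_symmDiff (hd : Pairwise fun a b => Disjoint (H a) (H b)) (J L : Finset (Fin k)) :
    unionH H (symmDiff J L) = symmDiff (unionH H J) (unionH H L) := by
  ext i
  by_cases h : ∃ j, i ∈ H j
  · obtain ⟨j, hj⟩ := h
    rw [Finset.mem_symmDiff, mem_unionH_iff hd hj, mem_unionH_iff hd hj, mem_unionH_iff hd hj,
      Finset.mem_symmDiff]
  · have : ∀ J, i ∉ unionH H J := fun J hJ => by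
      obtain ⟨j, -, hj⟩ := mem_unionH.mp hJ
      exact h ⟨j, hj⟩
    simp [Finset.mem_symmDiff, this]

theorem unionH_union (J L : Finset (Fin k)) : unionH H (J ∪ L) = unionH H J ∪ unionH H L :=
  Finset.union_biUnion

end Union

/-! ### The parabolic Weyl group -/

section Parabolic

variable {k : ℕ} {H : Fin k → Finset I} {X : Set I} (hX : IsIndep A X)
  (hHX : ∀ j, (H j : Set I) ⊆ X) (hd : Pairwise fun a b => Disjoint (H a) (H b))

theorem parabolicWeylGroup_le : parabolicWeylGroup R H ≤ R.weylGroup := by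
  rw [parabolicWeylGroup, Subgroup.closure_le]
  rintro _ ⟨j, rfl⟩
  exact R.sH_mem_weylGroup _

/-- The support of a vector over `ℤ/2`. -/
def support₂ (a : Fin k → ZMod 2) : Finset (Fin k) := Finset.univ.filter fun j => a j = 1

theorem support₂_add (a b : Fin k → ZMod 2) :
    support₂ (a + b) = symmDiff (support₂ a) (support₂ b) := by
  ext j
  simp only [support₂, Finset.mem_symmDiff, Finset.mem_filter, Finset.mem_univ, true_and,
    Pi.add_apply]
  generalize a j = x
  generalize b j = y
  revert x y
  decide

theorem support₂_indicator (J : Finset (Fin k)) :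
    support₂ (fun j => if j ∈ J then 1 else 0) = J := by
  ext j
  simp [support₂]

theorem support₂_injective : Function.Injective (support₂ (k := k)) := by
  intro a b h
  funext j
  have h1 : (a j = 1) ↔ (b j = 1) := by
    simpa [support₂] using congr(j ∈ $h)
  revert h1
  generalize a j = x
  generalize b j = y
  revert x y
  decide

variable (R) in
/-- The homomorphism `(ℤ/2)^k → W`, sending the indicator vector of `J` to `𝐬_{H_J}`. -/
def signHom : Multiplicative (Fin k → ZMod 2) →* (Module.Dual ℂ 𝔥 ≃ₗ[ℂ] Module.Dual ℂ 𝔥) where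
  toFun a := R.sH (unionH H (support₂ a.toAdd))
  map_one' := by
    have : support₂ (0 : Fin k → ZMod 2) = ∅ := by ext; simp [support₂]
    rw [toAdd_one, this]
    exact Realization.sH_empty
  map_mul' a b := by
    rw [toAdd_mul, support₂_add, unionH_symmDiff hd,
      Realization.sH_mul_sH hX (unionH_subset hHX _) (unionH_subset hHX _)]

include hX hHX hd in
theorem sH_unionH_insert {j : Fin k} {J : Finset (Fin k)} (hj : j ∉ J) :
    R.sH (unionH H (insert j J)) = R.sH (H j) * R.sH (unionH H J) := by
  have h1 : insert j J = symmDiff {j} J := by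
    ext l
    by_cases e : l = j
    · subst e; simp [Finset.mem_symmDiff, hj]
    · simp [Finset.mem_symmDiff, e]
  rw [h1, unionH_symmDiff hd, ← Realization.sH_mul_sH hX (unionH_subset hHX _)
    (unionH_subset hHX _), unionH_singleton]

include hX hHX hd in
theorem exists_list_prod_eq (J : Finset (Fin k)) :
    ∃ l : List (Module.Dual ℂ 𝔥 ≃ₗ[ℂ] Module.Dual ℂ 𝔥), l.length = J.card ∧
      (∀ x ∈ l, x ∈ Set.range fun j => R.sH (H j)) ∧ l.prod = R.sH (unionH H J) := by
  induction J using Finset.induction_on with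
  | empty => exact ⟨[], rfl, by simp, Realization.sH_empty.symm⟩
  | insert j J hj ih =>
    obtain ⟨l, h1, h2, h3⟩ := ih
    refine ⟨R.sH (H j) :: l, by rw [List.length_cons, h1, Finset.card_insert_of_notMem hj], ?_, ?_⟩
    · rintro x hx
      rcases List.mem_cons.mp hx with rfl | hx
      · exact ⟨j, rfl⟩
      · exact h2 x hx
    · rw [List.prod_cons, h3, sH_unionH_insert hX hHX hd hj]

include hX hHX hd in
theorem list_prod_eq_sH {l : List (Module.Dual ℂ 𝔥 ≃ₗ[ℂ] Module.Dual ℂ 𝔥)}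
    (hl : ∀ x ∈ l, x ∈ Set.range fun j => R.sH (H j)) :
    ∃ J : Finset (Fin k), J.card ≤ l.length ∧ l.prod = R.sH (unionH H J) := by
  induction l with
  | nil => exact ⟨∅, le_rfl, Realization.sH_empty.symm⟩
  | cons x l ih =>
    obtain ⟨J, h1, h2⟩ := ih fun y hy => hl y (List.mem_cons_of_mem _ hy)
    obtain ⟨j, rfl⟩ := hl x List.mem_cons_self
    refine ⟨symmDiff {j} J, ?_, ?_⟩
    · refine (Finset.card_le_card symmDiff_le_sup).trans ((Finset.card_union_le _ _).trans ?_)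
      rw [Finset.card_singleton, List.length_cons]
      omega
    · rw [List.prod_cons, h2, unionH_symmDiff hd, ← Realization.sH_mul_sH hX (unionH_subset hHX _)
        (unionH_subset hHX _), unionH_singleton]

include hX hHX hd in
theorem range_signHom : (signHom R hX hHX hd).range = parabolicWeylGroup R H := by
  apply le_antisymm
  · rintro _ ⟨a, rfl⟩
    obtain ⟨l, -, h2, h3⟩ := exists_list_prod_eq (R := R) hX hHX hd (support₂ a.toAdd)
    change R.sH (unionH H (support₂ a.toAdd)) ∈ _
    rw [← h3]
    exact Subgroup.list_prod_mem _ fun x hx => Subgroup.subset_closure (h2 x hx)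
  · rw [parabolicWeylGroup, Subgroup.closure_le]
    rintro _ ⟨j, rfl⟩
    refine ⟨Multiplicative.ofAdd fun i => if i ∈ ({j} : Finset (Fin k)) then 1 else 0, ?_⟩
    change R.sH (unionH H (support₂ _)) = _
    rw [toAdd_ofAdd, support₂_indicator, unionH_singleton]

variable (hne : ∀ j, (H j).Nonempty) {ρ : Module.Dual ℂ 𝔥} (hρ : ∀ i, ρ (R.coroot i) = 1)

include hX hHX hd hne hρ

theorem sH_unionH_injective : Function.Injective fun J : Finset (Fin k) => R.sH (unionH H J) :=
  fun J L h => unionH_injective hd hne (R.sH_injOn hρ (hX.subset (unionH_subset hHX J))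
    (hX.subset (unionH_subset hHX L)) h)

theorem exists_mulEquiv_parabolicWeylGroup :
    ∃ e : Multiplicative (Fin k → ZMod 2) ≃* parabolicWeylGroup R H, ∀ J : Finset (Fin k),
      (e (Multiplicative.ofAdd fun j => if j ∈ J then 1 else 0)).1 = R.sH (unionH H J) := by
  have hinj : Function.Injective (signHom R hX hHX hd) := fun a b h =>
    Multiplicative.toAdd.injective
      (support₂_injective (sH_unionH_injective hX hHX hd hne hρ h))
  refine ⟨(MonoidHom.ofInjective hinj).trans
    (MulEquiv.subgroupCongr (range_signHom (R := R) hX hHX hd)), fun J => ?_⟩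
  change R.sH (unionH H (support₂ _)) = _
  rw [toAdd_ofAdd, support₂_indicator]

/-- A product of `n` generators is `𝐬_{H_J}` for some `J` with at most `n` elements, and `J` is
determined by `𝐬_{H_J}`. -/
theorem wordLength_sH_unionH (J : Finset (Fin k)) :
    wordLength (Set.range fun j => R.sH (H j)) (R.sH (unionH H J)) = J.card := by
  have hmem := exists_list_prod_eq (R := R) hX hHX hd J
  apply le_antisymm (Nat.sInf_le hmem)
  refine le_csInf ⟨_, hmem⟩ ?_
  rintro n ⟨l, rfl, hl, hJ⟩
  obtain ⟨L, h1, h2⟩ := list_prod_eq_sH (R := R) hX hHX hd hl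
  rwa [← sH_unionH_injective hX hHX hd hne hρ (h2.symm.trans hJ)]

/-- The elements of the parabolic Weyl group are the `𝐬_{H_J}`, one for each `J`. -/
theorem exists_equiv_parabolicWeylGroup :
    ∃ e : Finset (Fin k) ≃ parabolicWeylGroup R H, ∀ J, (e J).1 = R.sH (unionH H J) := by
  have hmem : ∀ J : Finset (Fin k), R.sH (unionH H J) ∈ parabolicWeylGroup R H := fun J => by
    rw [← range_signHom (R := R) hX hHX hd]
    refine ⟨Multiplicative.ofAdd fun i => if i ∈ J then 1 else 0, ?_⟩
    change R.sH (unionH H (support₂ _)) = _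
    rw [toAdd_ofAdd, support₂_indicator]
  refine ⟨Equiv.ofBijective (fun J => ⟨_, hmem J⟩) ⟨fun J L h => ?_, ?_⟩, fun J => rfl⟩
  · exact sH_unionH_injective hX hHX hd hne hρ (Subtype.ext_iff.mp h)
  · rintro ⟨w, hw⟩
    rw [← range_signHom (R := R) hX hHX hd] at hw
    obtain ⟨a, rfl⟩ := hw
    exact ⟨support₂ a.toAdd, rfl⟩

end Parabolic

/-! ### The parabolic Weyl semigroup -/

/-- The semigroup acts on the set of the weights `λ(J)`. -/
theorem exists_semigroup_action {k : ℕ} {H : Fin k → Finset I} {lam : Module.Dual ℂ 𝔥}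
    (hH : ∀ j, (H j : Set I) ⊆ R.integrability lam) :
    ∃ act : ParabolicWeylSemigroup R H →
        Set.range (fun J : Finset (Fin k) => R.lamH lam (unionH H J)) →
        Set.range (fun J : Finset (Fin k) => R.lamH lam (unionH H J)),
      (∀ p q x, act (p * q) x = act p (act q x)) ∧
      ∀ J L : Finset (Fin k), (act (ParabolicWeylSemigroup.mk R H J)
        ⟨R.lamH lam (unionH H L), L, rfl⟩).1 = R.lamH lam (unionH H (J ∪ L)) := by
  -- `λ(L)` determines `⋃_{j ∈ L} H j`, so that `λ(J ∪ L)` depends on `J` and `λ(L)` only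
  have key : ∀ J L L' : Finset (Fin k), R.lamH lam (unionH H L) = R.lamH lam (unionH H L') →
      R.lamH lam (unionH H (J ∪ L)) = R.lamH lam (unionH H (J ∪ L')) := fun J L L' h => by
    rw [unionH_union, unionH_union,
      R.lamH_injOn (unionH_subset hH L) (unionH_subset hH L') h]
  let act : ParabolicWeylSemigroup R H →
      Set.range (fun J : Finset (Fin k) => R.lamH lam (unionH H J)) →
      Set.range (fun J : Finset (Fin k) => R.lamH lam (unionH H J)) := fun p x =>
    ⟨R.lamH lam (unionH H (p.1.2 ∪ x.2.choose)), _, rfl⟩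
  have hact : ∀ (p : ParabolicWeylSemigroup R H) (L : Finset (Fin k)),
      act p ⟨R.lamH lam (unionH H L), L, rfl⟩ =
        ⟨R.lamH lam (unionH H (p.1.2 ∪ L)), p.1.2 ∪ L, rfl⟩ := fun p L =>
    Subtype.ext (key _ _ _ (Exists.choose_spec (p := fun L' : Finset (Fin k) =>
      R.lamH lam (unionH H L') = R.lamH lam (unionH H L)) ⟨L, rfl⟩))
  refine ⟨act, ?_, fun J L => congrArg Subtype.val (hact _ L)⟩
  rintro p q ⟨_, L, rfl⟩
  refine (hact (p * q) L).trans (Eq.trans ?_ (congrArg (act p) (hact q L)).symm)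
  refine Eq.trans ?_ (hact p _).symm
  refine Subtype.ext ?_
  change R.lamH lam (unionH H ((p.1.2 ∪ q.1.2) ∪ L)) = _
  rw [Finset.union_assoc]

/-! ### Reindexing the terms of the resolution -/

theorem KMAlgebra.nonempty_bggEquiv {𝔤 : Type w} [LieRing 𝔤] [LieAlgebra ℂ 𝔤] (K : KMAlgebra R 𝔤)
    (lam : Module.Dual ℂ 𝔥) {k : ℕ} (H : Fin k → Finset I) {t : ℕ} {κ : Type*}
    (e : {J : Finset (Fin k) // J.card = t} ≃ κ) {ν : κ → Module.Dual ℂ 𝔥}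
    (hν : ∀ J, ν (e J) = R.lamH lam (unionH H J.1)) :
    Nonempty (K.BGG lam H t ≃ₗ[K.U] ⨁ w, K.Verma (ν w)) := by
  obtain rfl : ν = fun w => R.lamH lam (unionH H (e.symm w).1) := by
    funext w
    rw [← hν, e.apply_symm_apply]
  exact ⟨DirectSum.lequivCongrLeft K.U e⟩

/-! ### The two settings -/

/-- In both settings the minimal elements of `𝓗` lie in a common independent set; this is all that
the resolution needs to know about them. -/
theorem exists_independent_superset {k : ℕ} {H : Fin k → Finset I} {Y : Set I}
    (hH : ∀ j, H j ∈ Indep A Y)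
    (hset : (Pairwise fun a b => Orthogonal A (H a) (H b)) ∨ IsIndep A Y) :
    ∃ X : Set I, IsIndep A X ∧ X ⊆ Y ∧ ∀ j, (H j : Set I) ⊆ X := by
  rcases hset with h | h
  · refine ⟨⋃ j, (H j : Set I), ?_, Set.iUnion_subset fun j => (hH j).2,
      fun j => Set.subset_iUnion (fun j => (H j : Set I)) j⟩
    intro i hi i' hi' hne
    obtain ⟨a, ha⟩ := Set.mem_iUnion.mp hi
    obtain ⟨b, hb⟩ := Set.mem_iUnion.mp hi'
    by_cases hab : a = b
    · exact (hH b).1 (hab ▸ ha) hb hne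
    · exact h hab i ha i' hb
  · exact ⟨Y, h, subset_rfl, fun j => (hH j).2⟩

end KacMoody

end

theorem theoremE
    {I : Type*} [Fintype I] [DecidableEq I] {A : Matrix I I ℤ}
    {𝔥 : Type*} [AddCommGroup 𝔥] [Module ℂ 𝔥] [FiniteDimensional ℂ 𝔥]
    (R : KacMoody.Realization A 𝔥)
    {𝔤 : Type*} [LieRing 𝔤] [LieAlgebra ℂ 𝔤] (K : KacMoody.KMAlgebra R 𝔤)
    (lam : Module.Dual ℂ 𝔥)
    -- a set of independent subsets of `J_λ`, with minimal elements `H 1, …, H k`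
    (𝓗 : Set (Finset I)) (h𝓗 : 𝓗 ⊆ KacMoody.Indep A (R.integrability lam))
    {k : ℕ} (H : Fin k → Finset I) (hH : Function.Injective H)
    (hmin : Set.range H = {S | Minimal (fun S => S ∈ 𝓗) S})
    -- a Weyl vector, used to write the dot action
    (ρ : Module.Dual ℂ 𝔥) (hρ : ∀ i, ρ (R.coroot i) = 1)
    -- one of the two settings
    (hset : (Pairwise fun a b => KacMoody.Orthogonal A (H a) (H b)) ∨
      KacMoody.IsIndep A (R.integrability lam)) :
    -- the resolution of `𝕄(λ, 𝓗)`, with its differentials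
    (∃ (ε : K.BGG lam H 0 →ₗ[K.U] K.HigherVerma lam 𝓗)
        (d : ∀ t, K.BGG lam H (t + 1) →ₗ[K.U] K.BGG lam H t),
      ε (K.bggVec lam H 0 ⟨∅, rfl⟩) = (K.holeSubmodule lam 𝓗).mkQ (K.vermaVec lam) ∧
      (∀ t J, d t (K.bggVec lam H (t + 1) J) = K.bggDiff lam H t J) ∧
      Function.Surjective ε ∧ Function.Exact (d 0) ε ∧
      ∀ t, Function.Exact (d (t + 1)) (d t)) ∧
    (∀ t, k < t → Subsingleton (K.BGG lam H t)) ∧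
    -- its terms are free over `U𝔫^-`, on the highest weight vectors
    (∀ t (x : K.BGG lam H t), ∃! c : {J : Finset (Fin k) // J.card = t} → K.UMinus,
      x = ∑ J, K.minusMap (c J) • K.bggVec lam H t J) ∧
    -- characters
    K.HasCharacter (K.HigherVerma lam 𝓗) ∧
    (∀ μ, K.HasCharacter (K.Verma μ)) ∧
    K.ch (K.HigherVerma lam 𝓗) =
      ∑ J : Finset (Fin k),
        (-1 : ℤ) ^ J.card • K.ch (K.Verma (R.lamH lam (KacMoody.unionH H J))) ∧
    -- the denominator makes sense
    (∀ β : I →₀ ℕ, β ≠ 0 → FiniteDimensional ℂ (K.rootSpace (-R.rootSum β))) ∧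
    Multipliable K.factor ∧ IsUnit K.denominator ∧
    (K.HasChevalleyInvolution →
      ∀ β : I →₀ ℕ, Module.finrank ℂ (K.rootSpace (R.rootSum β)) = K.mult β) ∧
    -- the weights `λ(J)` form the orbit of `λ`
    (∀ J : Finset (Fin k), R.dot ρ (R.sH (KacMoody.unionH H J)) lam =
      R.lamH lam (KacMoody.unionH H J)) ∧
    -- setting (i): the parabolic Weyl group and the Weyl–Kac type character formula
    ((Pairwise fun a b => KacMoody.Orthogonal A (H a) (H b)) → ∅ ∉ 𝓗 →
      KacMoody.parabolicWeylGroup R H ≤ R.weylGroup ∧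
      (∃ e : Multiplicative (Fin k → ZMod 2) ≃* KacMoody.parabolicWeylGroup R H,
        ∀ J : Finset (Fin k),
          (e (Multiplicative.ofAdd fun j => if j ∈ J then 1 else 0)).1 =
            R.sH (KacMoody.unionH H J)) ∧
      (∀ J : Finset (Fin k), KacMoody.wordLength (Set.range fun j => R.sH (H j))
        (R.sH (KacMoody.unionH H J)) = J.card) ∧
      (∀ t, Nonempty (K.BGG lam H t ≃ₗ[K.U]
        ⨁ w : {w : KacMoody.parabolicWeylGroup R H //
            KacMoody.wordLength (Set.range fun j => R.sH (H j)) w.1 = t},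
          K.Verma (R.dot ρ w.1.1 lam))) ∧
      K.ch (K.HigherVerma lam 𝓗) =
        ∑ᶠ w : KacMoody.parabolicWeylGroup R H,
          (-1 : ℤ) ^ KacMoody.wordLength (Set.range fun j => R.sH (H j)) w.1 •
            R.expMul (R.dot ρ w.1 lam) (Ring.inverse K.denominator)) ∧
    -- setting (ii): the parabolic Weyl semigroup and the Weyl–Kac type character formula
    (KacMoody.IsIndep A (R.integrability lam) →
      (∃ act : KacMoody.ParabolicWeylSemigroup R H →
          Set.range (fun J : Finset (Fin k) => R.lamH lam (KacMoody.unionH H J)) →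
          Set.range (fun J : Finset (Fin k) => R.lamH lam (KacMoody.unionH H J)),
        (∀ p q x, act (p * q) x = act p (act q x)) ∧
        (∀ J L : Finset (Fin k),
          (act (KacMoody.ParabolicWeylSemigroup.mk R H J)
            ⟨R.lamH lam (KacMoody.unionH H L), L, rfl⟩).1 =
              R.lamH lam (KacMoody.unionH H (J ∪ L)))) ∧
      (∀ t, Nonempty (K.BGG lam H t ≃ₗ[K.U]
        ⨁ w : {w : KacMoody.ParabolicWeylSemigroup R H // w.length = t},
          K.Verma (R.dot ρ w.1.toWeyl lam))) ∧
      K.ch (K.HigherVerma lam 𝓗) =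
        ∑ w : KacMoody.ParabolicWeylSemigroup R H,
          (-1 : ℤ) ^ w.length •
            R.expMul (R.dot ρ w.toWeyl lam) (Ring.inverse K.denominator)) := by
  classical
  -- all the `H j` lie in one independent subset `X` of `J_λ`
  obtain ⟨X, hX, hXi, hHX⟩ : ∃ X : Set I, KacMoody.IsIndep A X ∧ X ⊆ R.integrability lam ∧
      ∀ j, (H j : Set I) ⊆ X :=
    KacMoody.exists_independent_superset
      (fun j => h𝓗 (KacMoody.KMAlgebra.H_mem hmin j)) hset
  have hsH : ∀ J : Finset (Fin k), R.dot ρ (R.sH (KacMoody.unionH H J)) lam =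
      R.lamH lam (KacMoody.unionH H J) := fun J =>
    R.dot_sH (hX.subset (KacMoody.unionH_subset hHX J)) hρ lam
  have hch := KacMoody.KMAlgebra.ch_higherVerma (K := K) hX hXi hHX h𝓗 hmin
  refine ⟨?_, fun t ht => K.subsingleton_bgg ht, K.existsUnique_bgg,
    KacMoody.KMAlgebra.hasCharacter_higherVerma hX hXi hHX h𝓗 hmin, K.hasCharacter_verma, hch,
    ?_, K.multipliable_factor, K.isUnit_denominator, K.finrank_rootSpace_of_involution, hsH,
    ?_, ?_⟩
  · obtain ⟨ε, hε⟩ := K.exists_augmentation lam H 𝓗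
    choose d hd using fun t => KacMoody.KMAlgebra.exists_differential K hX hXi hHX t
    have hε' := KacMoody.KMAlgebra.augmentation_properties h𝓗 hmin hε (hd 0)
    exact ⟨ε, d, hε, hd, hε'.1, hε'.2, KacMoody.KMAlgebra.exact_differential hX hHX hd⟩
  · intro β hβ
    obtain ⟨B⟩ := K.exists_negBasis ∅
    exact (B.finiteDimensional_and_finrank_rootSpace hβ).1
  · intro horth h0
    have hd := KacMoody.disjoint_of_orthogonal R.isGCM horth
    have hne : ∀ j, (H j).Nonempty := fun j => Finset.nonempty_iff_ne_empty.mpr fun e =>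
      h0 (e ▸ KacMoody.KMAlgebra.H_mem hmin j)
    have hlen := KacMoody.wordLength_sH_unionH hX hHX hd hne hρ
    obtain ⟨e, he⟩ := KacMoody.exists_equiv_parabolicWeylGroup hX hHX hd hne hρ
    have hlen' : ∀ J, KacMoody.wordLength (Set.range fun j => R.sH (H j)) (e J).1 = J.card :=
      fun J => by rw [he, hlen]
    refine ⟨KacMoody.parabolicWeylGroup_le,
      KacMoody.exists_mulEquiv_parabolicWeylGroup hX hHX hd hne hρ, hlen, fun t => ?_, ?_⟩
    · exact K.nonempty_bggEquiv lam H (e.subtypeEquiv fun J => by rw [hlen'])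
        (ν := fun w => R.dot ρ w.1.1 lam)
        (fun J => (congrArg (fun s => R.dot ρ s lam) (he J.1)).trans (hsH J.1))
    · rw [hch, ← finsum_comp_equiv e, finsum_eq_sum_of_fintype]
      refine Finset.sum_congr rfl fun J _ => ?_
      rw [hlen', he, hsH, K.ch_verma]
  · intro _
    refine ⟨KacMoody.exists_semigroup_action fun j => (hHX j).trans hXi, fun t => ?_, ?_⟩
    · exact K.nonempty_bggEquiv lam H
        ((KacMoody.ParabolicWeylSemigroup.equiv R H).subtypeEquiv fun _ => Iff.rfl)
        (ν := fun w => R.dot ρ w.1.toWeyl lam) (fun J => hsH J.1)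
    · rw [hch, ← (KacMoody.ParabolicWeylSemigroup.equiv R H).sum_comp]
      refine Finset.sum_congr rfl fun J _ => ?_
      rw [K.ch_verma, ← hsH]
      rfl
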